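/- Let $n_e\in C^2(\mathbb R)$ satisfy $n_e(0)=1$, $n_e'(0)=-1$, let $\phi_b>0$, and let $f_\infty\in L^1(\mathbb R^3)$ satisfy $f_\infty\ge 0$, $\int_{\mathbb R^3} f_\infty\,d\xi=1$ and $f_\infty(\xi)=0$ for $\xi_1>0$, where $\xi=(\xi_1,\xi')\in\mathbb R\times\mathbb R^2$. Consider the boundary value problem (completely absorbing, attractive wall) $$\xi_1\partial_x f+\partial_x\phi\,\partial_{\xi_1}f=0,\qquad \partial_{xx}\phi=\int_{\mathbb R^3}f\,d\xi-n_e(\phi),\qquad x>0,\ \xi\in\mathbb R^3,$$ $$f(0,\xi)=0\ (\xi_1>0),\qquad \phi(0)=\phi_b,\qquad \lim_{x\to\infty}f(x,\xi)=f_\infty(\xi),\qquad \lim_{x\to\infty}\phi(x)=0 .\tag{P}$$ A pair $(f,\phi)$ is a *solution* of (P) if - $f\in L^1_{loc}([0,\infty)\times\mathbb R^3)\cap C([0,\infty);L^1(\mathbb R^3))$ and $\phi\in C^1([0,\infty))\cap C^2((0,\infty))$; - $f\ge0$, and either $\partial_x\phi>0$ on all of $[0,\infty)$ or $\partial_x\phi<0$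 on all of $[0,\infty)$; - $\int_0^\infty\!\int_{\mathbb R^3}f\,(\xi_1\partial_x\psi+\partial_x\phi\,\partial_{\xi_1}\psi)\,d\xi\,dx=0$ for every compactly supported $\psi\in C^1([0,\infty)\times\mathbb R^3)$ with $\psi(0,\xi)=0$ for $\xi_1<0$, and $\lim_{x\to\infty}\|f(x,\cdot)-f_\infty\|_{L^1(\mathbb R^3)}=0$; - $\partial_{xx}\phi=\int f\,d\xi-n_e(\phi)$ for $x>0$, $\phi(0)=\phi_b$ and $\lim_{x\to\infty}\phi(x)=0$ hold in the classical sense. Put $$\rho_i(\phi)=\int_{\mathbb R^3}f_\infty(\xi)\frac{-\xi_1}{\sqrt{\xi_1^2+2\phi}}\,d\xi,\quad V(\phi)=\int_0^\phi(\rho_i(s)-n_e(s))\,ds,\quad B=\{b>0:\ V(s)>0\text{ for all }s\in(0,b]\},$$ with $\sup B\in(0,\infty]$ if $B\neq\emptyset$, and let $\chi$ be the indicator function of $\{s>0\}$. (i) If $\int\xi_1^{-2}f_\infty\,d\xi<1$, then $B\ne\emptyset$. Problem (P) has a solution if and only if $\phi_b<\sup B$, and the solution $(f,\phi)$ is then unique.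 Moreover, for every $x\ge0$ and almost every $\xi$, $$f(x,\xi)=f_\infty\big(-\sqrt{\xi_1^2-2\phi(x)},\xi'\big)\,\chi(\xi_1^2-2\phi(x))\,\chi(-\xi_1),\tag{F}$$ and there are constants $c,C>0$ such that $|\partial_x^l\phi(x)|\le Ce^{-cx}$ for all $x\ge0$ and $l=0,1,2$. If in addition $f_\infty\in C^2(\mathbb R^3)$, then $(f,\phi)$, with $f$ given everywhere by (F), belongs to $C^1([0,\infty)\times\mathbb R^3)\times C^2([0,\infty))$ and is a classical solution of (P), i.e. all equations and boundary conditions of (P) hold pointwise. (ii) If $\int\xi_1^{-2}f_\infty\,d\xi=1$ and $B\neq\emptyset$, then (P) has a solution if and only if $\phi_b<\sup B$, and the solution is then unique. Moreover (F) holds for every $x\ge 0$ and almost every $\xi$, and if $f_\infty\in C^2(\mathbb R^3)$, then $(f,\phi)$, with $f$ given everywhere by (F), belongs to $C^1([0,\infty)\times\mathbb R^3)\times C^2([0,\infty))$ and is a classical solution of (P). (iii) If $\int\xi_1^{-2}f_\infty\,d\xi=1$ and $B=\emptyset$, then (P) has no solution. (iv) If $\int\xi_1^{-2}f_\infty\,d\xi>1$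 (possibly $=\infty$), then (P) has no solution. -/

import Mathlib

open Set Filter Topology MeasureTheory

namespace VlasovPoisson

/-- The velocity space `ℝ³`; a velocity is `ξ = (ξ₁, ξ')` with `ξ₁ = ξ.1 : ℝ` and
`ξ' = ξ.2 : ℝ × ℝ`. Its `volume` is Lebesgue measure. -/
abbrev Velocity : Type := ℝ × ℝ × ℝ

/-- The closed phase space `{x ≥ 0} × ℝ³`. -/
def closedPhaseSpace : Set (ℝ × Velocity) := Ici (0 : ℝ) ×ˢ univ

/-- The open phase space `{x > 0} × ℝ³`. -/
def openPhaseSpace : Set (ℝ × Velocity) := Ioi (0 : ℝ) ×ˢ univ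

/-- The derivative `∂ₓ φ` of a function on the closed half line `{x ≥ 0}`
(one-sided at `x = 0`). -/
noncomputable def dx (φ : ℝ → ℝ) (x : ℝ) : ℝ := derivWithin φ (Ici 0) x

/-- The second derivative `∂ₓₓ φ` of a function on the closed half line `{x ≥ 0}`. -/
noncomputable def dxx (φ : ℝ → ℝ) (x : ℝ) : ℝ := iteratedDerivWithin 2 φ (Ici 0) x

/-- Admissible test functions: `ψ` is `C¹` up to the boundary on `{x ≥ 0} × ℝ³`, has compact
support there, and `α ψ(0, ξ₁, ξ') = ψ(0, -ξ₁, ξ')` for `ξ₁ > 0`. -/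
structure IsTestFunction (α : ℝ) (ψ : ℝ × Velocity → ℝ) : Prop where
  contDiffOn : ContDiffOn ℝ 1 ψ closedPhaseSpace
  compactSupport : ∃ K : Set (ℝ × Velocity), IsCompact K ∧
    ∀ p ∈ closedPhaseSpace, p ∉ K → ψ p = 0
  boundary : ∀ ξ : Velocity, 0 < ξ.1 → α * ψ (0, ξ) = ψ (0, (-ξ.1, ξ.2))

/-- Solutions `(f, φ)` of the boundary value problem

* `ξ₁ ∂ₓ f + ∂ₓφ ∂_{ξ₁} f = 0`, `∂ₓₓ φ = ∫ f dξ - nₑ(φ)` for `x > 0`,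
* `f(0, ξ) = f_b(ξ) + α f(0, -ξ₁, ξ')` for `ξ₁ > 0`, `φ(0) = φ_b`,
* `f(x, ·) → f_∞`, `φ(x) → 0` as `x → ∞`.

Only the values at `x ≥ 0` matter, and `f x` matters only up to null sets of velocities. -/
structure IsSolution (ne : ℝ → ℝ) (α φb : ℝ) (fb finf : Velocity → ℝ)
    (f : ℝ → Velocity → ℝ) (φ : ℝ → ℝ) : Prop where
  /-- `f ∈ L¹_loc({x ≥ 0} × ℝ³)`. -/
  locallyIntegrable : LocallyIntegrableOn (fun p : ℝ × Velocity => f p.1 p.2) closedPhaseSpace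
  /-- `f ∈ C({x ≥ 0}; L¹(ℝ³))`. -/
  integrable : ∀ x, 0 ≤ x → Integrable (f x)
  continuous_L1 : ∀ x₀, 0 ≤ x₀ →
    Tendsto (fun x => ∫ ξ, |f x ξ - f x₀ ξ|) (𝓝[Ici 0] x₀) (𝓝 0)
  /-- `φ ∈ C¹({x ≥ 0}) ∩ C²({x > 0})`. -/
  contDiffOn_one : ContDiffOn ℝ 1 φ (Ici 0)
  contDiffOn_two : ContDiffOn ℝ 2 φ (Ioi 0)
  nonneg : ∀ x, 0 ≤ x → ∀ᵐ ξ, 0 ≤ f x ξ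
  /-- The potential is strictly monotone, with `∂ₓφ ≠ 0` up to the boundary. -/
  strict_sign : (∀ x, 0 ≤ x → 0 < dx φ x) ∨ (∀ x, 0 ≤ x → dx φ x < 0)
  /-- The Vlasov equation with the boundary condition at `x = 0`, in the weak sense. -/
  weak_vlasov : ∀ ψ : ℝ × Velocity → ℝ, IsTestFunction α ψ →
    (∫ p in openPhaseSpace, f p.1 p.2 *
        (p.2.1 * deriv (fun y => ψ (y, p.2)) p.1 +
          dx φ p.1 * deriv (fun s => ψ (p.1, (s, p.2.2))) p.2.1)) +
      (∫ ξ in {ξ : Velocity | 0 < ξ.1}, fb ξ * (ξ.1 * ψ (0, ξ))) = 0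
  tendsto_L1 : Tendsto (fun x => ∫ ξ, |f x ξ - finf ξ|) atTop (𝓝 0)
  poisson : ∀ x, 0 < x → dxx φ x = (∫ ξ, f x ξ) - ne (φ x)
  potential_boundary : φ 0 = φb
  potential_tendsto : Tendsto φ atTop (𝓝 0)

/-- Classical solutions of the same boundary value problem:
`f ∈ C¹({x ≥ 0} × ℝ³)`, `φ ∈ C²({x ≥ 0})`, and all equations and boundary conditions
hold pointwise. -/
structure IsClassicalSolution (ne : ℝ → ℝ) (α φb : ℝ) (fb finf : Velocity → ℝ)
    (f : ℝ → Velocity → ℝ) (φ : ℝ → ℝ) : Prop where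
  contDiffOn_f : ContDiffOn ℝ 1 (fun p : ℝ × Velocity => f p.1 p.2) closedPhaseSpace
  contDiffOn_potential : ContDiffOn ℝ 2 φ (Ici 0)
  vlasov : ∀ x, 0 < x → ∀ ξ : Velocity,
    ξ.1 * deriv (fun y => f y ξ) x + dx φ x * deriv (fun s => f x (s, ξ.2)) ξ.1 = 0
  poisson : ∀ x, 0 < x → dxx φ x = (∫ ξ, f x ξ) - ne (φ x)
  boundary : ∀ ξ : Velocity, 0 < ξ.1 → f 0 ξ = fb ξ + α * f 0 (-ξ.1, ξ.2)
  potential_boundary : φ 0 = φb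
  tendsto : ∀ ξ : Velocity, Tendsto (fun x => f x ξ) atTop (𝓝 (finf ξ))
  potential_tendsto : Tendsto φ atTop (𝓝 0)

/-- `ρᵢ(φ) = ∫ f_∞(ξ) (-ξ₁) / √(ξ₁² + 2φ) dξ`. -/
noncomputable def rhoI (finf : Velocity → ℝ) (s : ℝ) : ℝ :=
  ∫ ξ : Velocity, finf ξ * (-ξ.1 / Real.sqrt (ξ.1 ^ 2 + 2 * s))

/-- `V(φ) = ∫₀^φ (ρᵢ(s) - nₑ(s)) ds`. -/
noncomputable def sagdeev (ne : ℝ → ℝ) (finf : Velocity → ℝ) (s : ℝ) : ℝ :=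
  ∫ t in (0 : ℝ)..s, (rhoI finf t - ne t)

/-- `B = {b > 0 : V > 0 on (0, b]}`. -/
def setB (ne : ℝ → ℝ) (finf : Velocity → ℝ) : Set ℝ :=
  {b | 0 < b ∧ ∀ s ∈ Ioc 0 b, 0 < sagdeev ne finf s}

/-- `sup B`, possibly `+∞`. -/
noncomputable def supB (ne : ℝ → ℝ) (finf : Velocity → ℝ) : EReal :=
  sSup ((fun b : ℝ => (b : EReal)) '' setB ne finf)

/-- `∫ ξ₁⁻² f_∞(ξ) dξ ∈ [0, ∞]`, for nonnegative `f_∞`. -/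
noncomputable def bohmIntegral (finf : Velocity → ℝ) : ENNReal :=
  ∫⁻ ξ : Velocity, ENNReal.ofReal ((ξ.1 ^ 2)⁻¹ * finf ξ)

/-- The indicator function of `{s > 0}`. -/
noncomputable def chi (s : ℝ) : ℝ := (Ioi (0 : ℝ)).indicator 1 s

/-- `f_∞(-√(ξ₁² - 2φ(x)), ξ') χ(ξ₁² - 2φ(x)) χ(-ξ₁)`. -/
noncomputable def explicitForm (finf : Velocity → ℝ) (φ : ℝ → ℝ) (x : ℝ) (ξ : Velocity) : ℝ :=
  finf (-Real.sqrt (ξ.1 ^ 2 - 2 * φ x), ξ.2) * chi (ξ.1 ^ 2 - 2 * φ x) * chi (-ξ.1)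

/-- Exponential decay of `φ`, `∂ₓφ`, `∂ₓₓφ`. -/
def ExpDecay (φ : ℝ → ℝ) : Prop :=
  ∃ c > 0, ∃ C > 0, ∀ l ≤ 2, ∀ x, 0 ≤ x →
    |iteratedDerivWithin l φ (Ici 0) x| ≤ C * Real.exp (-c * x)

/-- Any two solutions coincide: the potentials agree on `{x ≥ 0}`, and the distributions agree
in `L¹(ℝ³)` for every `x ≥ 0`. -/
def AtMostOneSolution (ne : ℝ → ℝ) (α φb : ℝ) (fb finf : Velocity → ℝ) : Prop :=
  ∀ f φ g χ, IsSolution ne α φb fb finf f φ → IsSolution ne α φb fb finf g χ →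
    ∀ x, 0 ≤ x → φ x = χ x ∧ f x =ᵐ[volume] g x

end VlasovPoisson

open VlasovPoisson

namespace VlasovPoisson

/-! The problem reduces to a scalar first-order equation for φ. The energy ξ₁²/2 − φ(x) and ξ' are
constant along particle orbits, and φ has to decrease, since an increasing potential cannot go from
φ_b > 0 to 0 (`IsSolution.isDecreasingPotential`). The absorbing wall emits nothing, so f(x, ·)
consists only of particles that come from infinity and are accelerated through φ(x).

This rigidity is `IsSolution.ae_eq_shift`, and it has two halves. `IsSolution.vanish_locally` tests
the weak equation with a ramp in ξ₁ times a bump in the invariants. Only an integral of one sign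
survives, so f vanishes where ξ₁ > 0 or ξ₁² < 2φ. `IsSolution.integral_fluxWeight` uses a cutoff in
x instead: the flux of incoming particles in each energy range is independent of x and equals its
value at infinity, which determines f on the remaining orbits.

A change of variables now gives ∫ f dξ = ρᵢ(φ), so the Poisson equation reads φ'' = V'(φ). Its
energy φ'²/2 − V(φ) is constant and tends to zero along a sequence going to infinity, hence φ' =
−√(2V(φ)) (`IsSolution.dx_sq_eq`). As φ' ≠ 0 and φ takes every value in (0, φ_b], this forces φ_b ∈
B (`IsSolution.mem_setB`), and separation of variables gives uniqueness (`IsProfile.unique`).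
Conversely, for φ_b ∈ B the profile is obtained by inverting the travel time (`exists_isProfile`).
The bound V(s) ≤ C s², which follows from ρᵢ ≤ 1, makes the time needed to reach zero infinite. The
transported density solves the Vlasov equation because its pairing with a test function is an
integral of total derivatives along orbits (`weak_vlasov_shift`).

The Bohm integral governs V near 0. The quotient (1 − ρᵢ(s))/s is at most the Bohm integral, and by
Fatou its lower limit as s → 0⁺ is at least the Bohm integral, while (1 − nₑ(s))/s → 1. Below 1 this
gives V ≥ c s² near 0, hence B ≠ ∅ and exponential decay; above 1 it gives V ≤ 0 near 0 and B = ∅.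

Classical regularity rests on `contDiff_squareForm`: a C² density that vanishes for ξ₁ > 0 vanishes
to second order at ξ₁ = 0, which compensates the singularity of the square root. -/

instance : (volume : Measure Velocity).IsAddHaarMeasure :=
  have : (volume : Measure (ℝ × ℝ)).IsAddHaarMeasure := Measure.prod.instIsAddHaarMeasure _ _
  Measure.prod.instIsAddHaarMeasure _ _

/-- A probability density on the velocity space that is carried by `{ξ₁ ≤ 0}`. -/
structure IsIncoming (finf : Velocity → ℝ) : Prop where
  integrable : Integrable finf
  nonneg : ∀ᵐ ξ, 0 ≤ finf ξ
  mass : ∫ ξ, finf ξ = 1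
  support : ∀ᵐ ξ : Velocity, 0 < ξ.1 → finf ξ = 0

lemma ae_fst_ne (a : ℝ) : ∀ᵐ ξ : Velocity, ξ.1 ≠ a := by
  have h : ∀ᵐ v : ℝ, v ≠ a := by
    simp [ae_iff]
  exact Measure.quasiMeasurePreserving_fst.ae h

/-! ### The ion density as a function of the potential -/

lemma abs_velocity_ratio_le_one {v s : ℝ} (hs : 0 ≤ s) : |(-v / Real.sqrt (v ^ 2 + 2 * s))| ≤ 1 := by
  rw [abs_div, abs_neg, abs_of_nonneg (Real.sqrt_nonneg _)]
  apply div_le_one_of_le₀ _ (Real.sqrt_nonneg _)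
  apply Real.abs_le_sqrt
  linarith

/-- With r the square root, s = (r² − v²)/2. After removing the factor r + v ≥ 0 the claim becomes
2v² ≤ r(r − v), which holds because r ≥ −v > 0. -/
lemma one_sub_velocity_ratio_le {v s : ℝ} (hv : v < 0) (hs : 0 ≤ s) :
    1 - -v / Real.sqrt (v ^ 2 + 2 * s) ≤ (v ^ 2)⁻¹ * s := by
  have hv2 : 0 < v ^ 2 := by nlinarith
  have hS : 0 < Real.sqrt (v ^ 2 + 2 * s) := Real.sqrt_pos.2 (by positivity)
  have hsq : Real.sqrt (v ^ 2 + 2 * s) ^ 2 = v ^ 2 + 2 * s := Real.sq_sqrt (by positivity)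
  set r := Real.sqrt (v ^ 2 + 2 * s)
  have hr : -v ≤ r := by
    apply Real.le_sqrt_of_sq_le; nlinarith
  have key : v ^ 2 * (r + v) ≤ r * s := by
    have : s = (r ^ 2 - v ^ 2) / 2 := by linarith
    rw [this]
    have h1 : 0 ≤ r + v := by linarith
    have h2 : 2 * v ^ 2 ≤ r * (r - v) := by nlinarith
    nlinarith
  have e : (v ^ 2)⁻¹ * s - (1 - -v / r) = (r * s - v ^ 2 * (r + v)) / (v ^ 2 * r) := by
    have := hv.ne
    field_simp
    ring
  have : 0 ≤ (r * s - v ^ 2 * (r + v)) / (v ^ 2 * r) :=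
    div_nonneg (by linarith) (by positivity)
  linarith

/-- The limit is the derivative at s = 0; it identifies the Bohm weight as the initial slope of the
loss of density at fixed velocity. -/
lemma tendsto_velocity_ratio_quotient {v : ℝ} (hv : v < 0) :
    Tendsto (fun s : ℝ => (1 - -v / Real.sqrt (v ^ 2 + 2 * s)) / s) (𝓝[>] 0) (𝓝 (v ^ 2)⁻¹) := by
  have hv2 : 0 < v ^ 2 := by nlinarith
  have h0 : HasDerivAt (fun s : ℝ => 1 - -v / Real.sqrt (v ^ 2 + 2 * s)) ((v ^ 2)⁻¹) 0 := by
    have h1 : HasDerivAt (fun s : ℝ => v ^ 2 + 2 * s) 2 0 := by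
      simpa using ((hasDerivAt_id (0 : ℝ)).const_mul 2).const_add (v ^ 2)
    have h2 := h1.sqrt (by simp; exact hv.ne)
    have h3 := ((hasDerivAt_const (0 : ℝ) (-v)).div h2
      (by simp [Real.sqrt_sq_eq_abs]; exact hv.ne)).const_sub 1
    refine h3.congr_deriv ?_
    have := hv.ne
    simp only [mul_zero, add_zero, Real.sqrt_sq_eq_abs, abs_of_neg hv, zero_mul, zero_sub]
    field_simp
  have := h0.tendsto_slope_zero_right
  refine this.congr' ?_
  filter_upwards [self_mem_nhdsWithin] with s hs
  have : Real.sqrt (v ^ 2) = -v := by rw [Real.sqrt_sq_eq_abs, abs_of_neg hv]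
  simp [this, div_self hv.ne]
  ring

namespace IsIncoming

variable {finf : Velocity → ℝ}

lemma ae_neg (h : IsIncoming finf) : ∀ᵐ ξ : Velocity, ξ.1 < 0 ∨ finf ξ = 0 := by
  filter_upwards [h.support, ae_fst_ne 0] with ξ h1 h2
  rcases lt_or_gt_of_ne h2 with h3 | h3
  · exact Or.inl h3
  · exact Or.inr (h1 h3)

lemma aestronglyMeasurable_kernel (h : IsIncoming finf) (s : ℝ) :
    AEStronglyMeasurable (fun ξ : Velocity => finf ξ * (-ξ.1 / Real.sqrt (ξ.1 ^ 2 + 2 * s))) := by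
  apply h.integrable.1.mul
  apply Measurable.aestronglyMeasurable
  fun_prop

lemma norm_kernel_le {s : ℝ} (hs : 0 ≤ s) (ξ : Velocity) :
    ‖finf ξ * (-ξ.1 / Real.sqrt (ξ.1 ^ 2 + 2 * s))‖ ≤ ‖finf ξ‖ := by
  rw [norm_mul]
  exact mul_le_of_le_one_right (norm_nonneg _) (abs_velocity_ratio_le_one hs)

lemma integrable_kernel (h : IsIncoming finf) {s : ℝ} (hs : 0 ≤ s) :
    Integrable (fun ξ : Velocity => finf ξ * (-ξ.1 / Real.sqrt (ξ.1 ^ 2 + 2 * s))) :=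
  h.integrable.mono (h.aestronglyMeasurable_kernel s) (ae_of_all _ (norm_kernel_le hs))

lemma continuousOn_rhoI (h : IsIncoming finf) : ContinuousOn (rhoI finf) (Ici 0) := by
  intro s hs
  refine continuousWithinAt_of_dominated (bound := fun ξ => ‖finf ξ‖)
    (Eventually.of_forall fun s => h.aestronglyMeasurable_kernel s)
    (by filter_upwards [self_mem_nhdsWithin] with t ht using ae_of_all _ (norm_kernel_le ht))
    h.integrable.norm ?_
  filter_upwards [ae_fst_ne 0] with ξ hξ
  have : ξ.1 ^ 2 + 2 * s ≠ 0 := by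
    have : 0 < ξ.1 ^ 2 := by positivity
    have : 0 ≤ s := hs
    positivity
  apply ContinuousAt.continuousWithinAt
  apply continuousAt_const.mul
  apply continuousAt_const.div
  · fun_prop
  · have : 0 < ξ.1 ^ 2 := by positivity
    have : 0 ≤ s := hs
    exact (Real.sqrt_pos.2 (by positivity)).ne'

lemma one_sub_rhoI (h : IsIncoming finf) {s : ℝ} (hs : 0 ≤ s) :
    1 - rhoI finf s = ∫ ξ : Velocity, finf ξ * (1 - -ξ.1 / Real.sqrt (ξ.1 ^ 2 + 2 * s)) := by
  simp_rw [mul_sub, mul_one]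
  rw [integral_sub h.integrable (h.integrable_kernel hs), h.mass, rhoI]

lemma one_sub_kernel_nonneg (h : IsIncoming finf) {s : ℝ} (hs : 0 ≤ s) :
    ∀ᵐ ξ : Velocity, 0 ≤ finf ξ * (1 - -ξ.1 / Real.sqrt (ξ.1 ^ 2 + 2 * s)) := by
  filter_upwards [h.nonneg] with ξ hξ
  exact mul_nonneg hξ (sub_nonneg.2 ((le_abs_self _).trans (abs_velocity_ratio_le_one hs)))

lemma integrable_one_sub_kernel (h : IsIncoming finf) {s : ℝ} (hs : 0 ≤ s) :
    Integrable fun ξ : Velocity => finf ξ * (1 - -ξ.1 / Real.sqrt (ξ.1 ^ 2 + 2 * s)) := by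
  refine (h.integrable.sub (h.integrable_kernel hs)).congr (ae_of_all _ fun ξ => ?_)
  simp only [Pi.sub_apply]
  ring

lemma rhoI_le_one (h : IsIncoming finf) {s : ℝ} (hs : 0 ≤ s) : rhoI finf s ≤ 1 := by
  have := integral_nonneg_of_ae (h.one_sub_kernel_nonneg hs)
  rw [← h.one_sub_rhoI hs] at this
  linarith

lemma ofReal_one_sub_rhoI (h : IsIncoming finf) {s : ℝ} (hs : 0 ≤ s) :
    ENNReal.ofReal (1 - rhoI finf s) =
      ∫⁻ ξ : Velocity, ENNReal.ofReal (finf ξ * (1 - -ξ.1 / Real.sqrt (ξ.1 ^ 2 + 2 * s))) := by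
  rw [h.one_sub_rhoI hs, ofReal_integral_eq_lintegral_ofReal (h.integrable_one_sub_kernel hs)
    (h.one_sub_kernel_nonneg hs)]

/-- Integrates the pointwise bound `one_sub_velocity_ratio_le`. It holds for all s ≥ 0 and serves
both the lower bound on V near 0 and the decay of ∂ₓₓφ. -/
lemma one_sub_rhoI_le (h : IsIncoming finf) (hb : bohmIntegral finf ≠ ⊤) {s : ℝ} (hs : 0 ≤ s) :
    1 - rhoI finf s ≤ (bohmIntegral finf).toReal * s := by
  have key : ENNReal.ofReal (1 - rhoI finf s) ≤ bohmIntegral finf * ENNReal.ofReal s := by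
    rw [h.ofReal_one_sub_rhoI hs, bohmIntegral, ← lintegral_mul_const' _ _ ENNReal.ofReal_ne_top]
    apply lintegral_mono_ae
    filter_upwards [h.nonneg, h.ae_neg] with ξ h1 h2
    rw [← ENNReal.ofReal_mul' hs]
    apply ENNReal.ofReal_le_ofReal
    rcases h2 with h2 | h2
    · nlinarith [one_sub_velocity_ratio_le h2 hs]
    · simp [h2]
  have := ENNReal.toReal_mono (ENNReal.mul_ne_top hb ENNReal.ofReal_ne_top) key
  rw [ENNReal.toReal_mul, ENNReal.toReal_ofReal hs,
    ENNReal.toReal_ofReal (sub_nonneg.2 (h.rhoI_le_one hs))] at this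
  exact this

/-- Lower semicontinuity of the difference quotients of the ion density at zero potential. -/
lemma bohmIntegral_le_liminf (h : IsIncoming finf) :
    bohmIntegral finf ≤
      liminf (fun s => ENNReal.ofReal ((1 - rhoI finf s) / s)) (𝓝[>] (0 : ℝ)) := by
  -- Fatou's lemma is applied to measurable functions, whereas `finf` is only a.e. measurable.
  set g := h.integrable.1.mk finf
  have hg : finf =ᵐ[volume] g := h.integrable.1.ae_eq_mk
  have hgm : Measurable g := h.integrable.1.stronglyMeasurable_mk.measurable
  set F : ℝ → Velocity → ENNReal := fun s ξ =>
    ENNReal.ofReal (g ξ * ((1 - -ξ.1 / Real.sqrt (ξ.1 ^ 2 + 2 * s)) / s))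
  have hF : ∀ s, Measurable (F s) := fun s => by
    apply ENNReal.measurable_ofReal.comp
    fun_prop
  have h1 : bohmIntegral finf ≤ ∫⁻ ξ, liminf (fun s => F s ξ) (𝓝[>] (0 : ℝ)) := by
    apply lintegral_mono_ae
    filter_upwards [hg, h.ae_neg] with ξ h1 h2
    rcases h2 with h2 | h2
    · have : Tendsto (fun s => F s ξ) (𝓝[>] 0) (𝓝 (ENNReal.ofReal (g ξ * (ξ.1 ^ 2)⁻¹))) :=
        (ENNReal.continuous_ofReal.tendsto _).comp
          ((tendsto_velocity_ratio_quotient h2).const_mul _)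
      rw [this.liminf_eq, h1, mul_comm]
    · simp [h2]
  refine h1.trans ((lintegral_liminf_le hF).trans (le_of_eq ?_))
  apply liminf_congr
  filter_upwards [self_mem_nhdsWithin] with s hs
  have hs : 0 < s := hs
  rw [div_eq_mul_inv, ENNReal.ofReal_mul' (by positivity), h.ofReal_one_sub_rhoI hs.le,
    ← lintegral_mul_const' _ _ ENNReal.ofReal_ne_top]
  apply lintegral_congr_ae
  filter_upwards [hg] with ξ h1
  rw [← ENNReal.ofReal_mul' (by positivity), h1]
  simp only [F]
  congr 1
  ring

end IsIncoming

/-! ### The electron density near zero potential -/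

lemma exists_abs_one_sub_le {ne : ℝ → ℝ} (hne : ContDiff ℝ 2 ne) (hne0 : ne 0 = 1) (b : ℝ) :
    ∃ C > 0, ∀ s ∈ Icc 0 b, |1 - ne s| ≤ C * s := by
  have hc : Continuous (deriv ne) := hne.continuous_deriv (by norm_num)
  obtain ⟨C, hC⟩ := (isCompact_Icc (a := (0 : ℝ)) (b := b)).exists_bound_of_continuousOn
    hc.continuousOn
  refine ⟨max C 1, by positivity, fun s hs => ?_⟩
  have hd : ∀ x ∈ Icc 0 b, DifferentiableAt ℝ ne x :=
    fun x _ => (hne.differentiable (by norm_num)) x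
  have := (convex_Icc (0 : ℝ) b).norm_image_sub_le_of_norm_deriv_le hd
    (fun x hx => (hC x hx).trans (le_max_left C 1)) hs (left_mem_Icc.2 (hs.1.trans hs.2))
  simpa [hne0, abs_of_nonneg hs.1] using this

lemma tendsto_one_sub_div {ne : ℝ → ℝ} (hne : ContDiff ℝ 2 ne) (hne0 : ne 0 = 1)
    (hne1 : deriv ne 0 = -1) : Tendsto (fun s => (1 - ne s) / s) (𝓝[>] 0) (𝓝 1) := by
  have hd : HasDerivAt ne (-1) 0 := by
    rw [← hne1]
    exact ((hne.differentiable (by norm_num)) 0).hasDerivAt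
  have h := hd.tendsto_slope_zero_right.neg
  simp only [zero_add, hne0, neg_neg, smul_eq_mul] at h
  refine h.congr fun s => ?_
  ring

namespace IsIncoming

variable {finf : Velocity → ℝ} {ne : ℝ → ℝ}

/-! ### The Sagdeev potential -/

/-- Continuity of ρᵢ is available only on s ≥ 0, so the integrand is frozen at its value at 0 for
negative s. The fundamental theorem of calculus then applies on the whole line and includes the
one-sided derivative at 0. -/
lemma exists_extension_sagdeev (h : IsIncoming finf) (hne : Continuous ne) :
    ∃ W : ℝ → ℝ, (∀ s, HasDerivAt W (rhoI finf (max s 0) - ne (max s 0)) s) ∧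
      ∀ s, 0 ≤ s → W s = sagdeev ne finf s := by
  have hc : Continuous fun s => rhoI finf (max s 0) - ne (max s 0) := by
    refine Continuous.sub ?_ (by fun_prop)
    exact h.continuousOn_rhoI.comp_continuous (by fun_prop) (fun x => le_max_right x 0)
  refine ⟨fun s => ∫ t in (0 : ℝ)..s, (rhoI finf (max t 0) - ne (max t 0)), fun s => ?_,
    fun s hs => ?_⟩
  · exact hc.integral_hasStrictDerivAt 0 s |>.hasDerivAt
  · apply intervalIntegral.integral_congr
    intro t ht
    rw [uIcc_of_le hs] at ht
    simp only [max_eq_left ht.1]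

lemma hasDerivWithinAt_sagdeev (h : IsIncoming finf) (hne : Continuous ne) {s : ℝ} (hs : 0 ≤ s) :
    HasDerivWithinAt (sagdeev ne finf) (rhoI finf s - ne s) (Ici 0) s := by
  obtain ⟨W, hW, hWs⟩ := h.exists_extension_sagdeev hne
  have := (hW s).hasDerivWithinAt (s := Ici 0)
  rw [max_eq_left hs] at this
  exact this.congr (fun y hy => (hWs y hy).symm) (hWs s hs).symm

lemma hasDerivAt_sagdeev (h : IsIncoming finf) (hne : Continuous ne) {s : ℝ} (hs : 0 < s) :
    HasDerivAt (sagdeev ne finf) (rhoI finf s - ne s) s :=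
  (h.hasDerivWithinAt_sagdeev hne hs.le).hasDerivAt (Ici_mem_nhds hs)

lemma continuousOn_sagdeev (h : IsIncoming finf) (hne : Continuous ne) :
    ContinuousOn (sagdeev ne finf) (Ici 0) :=
  fun _ hs => (h.hasDerivWithinAt_sagdeev hne hs).continuousWithinAt


lemma intervalIntegrable_charge (h : IsIncoming finf) (hne : Continuous ne) {s : ℝ} (hs : 0 ≤ s) :
    IntervalIntegrable (fun t => rhoI finf t - ne t) volume 0 s := by
  apply ContinuousOn.intervalIntegrable
  rw [uIcc_of_le hs]
  exact (h.continuousOn_rhoI.mono Icc_subset_Ici_self).sub hne.continuousOn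

/-- Since ρᵢ ≤ 1, the charge is at most 1 − nₑ(s) = O(s), whatever the Bohm integral is. This bound
keeps profiles from reaching zero at a finite point. -/
lemma exists_sagdeev_le (h : IsIncoming finf) (hne : ContDiff ℝ 2 ne) (hne0 : ne 0 = 1) (b : ℝ) :
    ∃ C > 0, ∀ s ∈ Icc 0 b, sagdeev ne finf s ≤ C * s ^ 2 := by
  obtain ⟨C, hC0, hC⟩ := exists_abs_one_sub_le hne hne0 b
  refine ⟨C, hC0, fun s hs => ?_⟩
  have := intervalIntegral.integral_mono_on hs.1 (h.intervalIntegrable_charge hne.continuous hs.1)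
    (intervalIntegrable_const : IntervalIntegrable (fun _ => C * s) volume 0 s) (fun t ht => ?_)
  · simp only [intervalIntegral.integral_const, smul_eq_mul, sub_zero] at this
    exact this.trans (le_of_eq (by ring))
  · have h1 := (abs_le.1 (hC t ⟨ht.1, ht.2.trans hs.2⟩)).2
    have h2 := h.rhoI_le_one ht.1
    nlinarith [ht.2]

lemma exists_abs_charge_le (h : IsIncoming finf) (hne : ContDiff ℝ 2 ne) (hne0 : ne 0 = 1)
    (hb : bohmIntegral finf ≠ ⊤) (b : ℝ) :
    ∃ C > 0, ∀ s ∈ Icc 0 b, |rhoI finf s - ne s| ≤ C * s := by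
  obtain ⟨C, hC0, hC⟩ := exists_abs_one_sub_le hne hne0 b
  refine ⟨C + (bohmIntegral finf).toReal, by positivity, fun s hs => ?_⟩
  have h1 := h.one_sub_rhoI_le hb hs.1
  have h2 := h.rhoI_le_one hs.1
  have h3 := abs_le.1 (hC s hs)
  have h4 : 0 ≤ (bohmIntegral finf).toReal * s := mul_nonneg ENNReal.toReal_nonneg hs.1
  have h5 : 0 ≤ C * s := mul_nonneg hC0.le hs.1
  rw [add_mul, abs_le]
  constructor <;> linarith

lemma eventually_charge_ge (h : IsIncoming finf) (hne : ContDiff ℝ 2 ne) (hne0 : ne 0 = 1)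
    (hne1 : deriv ne 0 = -1) (hb : bohmIntegral finf < 1) :
    ∃ c > 0, ∀ᶠ s in 𝓝[>] (0 : ℝ), c * s ≤ rhoI finf s - ne s := by
  have hb' : (bohmIntegral finf).toReal < 1 := by
    rw [← ENNReal.toReal_one]
    exact (ENNReal.toReal_lt_toReal hb.ne_top (by simp)).2 hb
  set β := (bohmIntegral finf).toReal
  -- Near 0, 1 − nₑ(s) exceeds (1 + β)/2 · s while 1 − ρᵢ(s) ≤ β s; the constant is the difference
  -- of these slopes.
  refine ⟨(1 - β) / 2, by linarith, ?_⟩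
  filter_upwards [(tendsto_one_sub_div hne hne0 hne1).eventually
    (lt_mem_nhds (show (1 + β) / 2 < 1 by linarith)), self_mem_nhdsWithin] with s h1 hs
  have hs : 0 < s := hs
  have h2 := h.one_sub_rhoI_le hb.ne_top hs.le
  rw [lt_div_iff₀ hs] at h1
  nlinarith

/-- A number a strictly between 1 and the Bohm integral separates the slopes: by the Fatou bound (1
− ρᵢ(s))/s eventually exceeds a, while (1 − nₑ(s))/s → 1 falls below it. -/
lemma eventually_charge_neg (h : IsIncoming finf) (hne : ContDiff ℝ 2 ne) (hne0 : ne 0 = 1)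
    (hne1 : deriv ne 0 = -1) (hb : 1 < bohmIntegral finf) :
    ∀ᶠ s in 𝓝[>] (0 : ℝ), rhoI finf s - ne s < 0 := by
  obtain ⟨a, ha1, ha2⟩ := exists_between hb
  have hat : a ≠ ⊤ := (ha2.trans_le le_top).ne
  have ha1' : 1 < a.toReal := by
    rw [← ENNReal.toReal_one]
    exact (ENNReal.toReal_lt_toReal (by simp) hat).2 ha1
  filter_upwards [eventually_lt_of_lt_liminf (ha2.trans_le h.bohmIntegral_le_liminf),
    (tendsto_one_sub_div hne hne0 hne1).eventually (gt_mem_nhds ha1'),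
    self_mem_nhdsWithin] with s h1 h2 hs
  have hs : 0 < s := hs
  rw [ENNReal.lt_ofReal_iff_toReal_lt hat] at h1
  have := (div_lt_div_iff_of_pos_right hs).1 (h2.trans h1)
  linarith

lemma exists_le_sagdeev (h : IsIncoming finf) (hne : ContDiff ℝ 2 ne) (hne0 : ne 0 = 1)
    (hne1 : deriv ne 0 = -1) (hb : bohmIntegral finf < 1) :
    ∃ c > 0, ∃ ε > 0, ∀ s ∈ Icc 0 ε, c * s ^ 2 ≤ sagdeev ne finf s := by
  obtain ⟨c, hc, hev⟩ := h.eventually_charge_ge hne hne0 hne1 hb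
  obtain ⟨ε, hε, hsub⟩ := mem_nhdsGT_iff_exists_Ioc_subset.1 hev
  refine ⟨c / 2, by linarith, ε, hε, fun s hs => ?_⟩
  have := intervalIntegral.integral_mono_on_of_le_Ioo hs.1
    (f := fun t => c * t) (Continuous.intervalIntegrable (by fun_prop) _ _)
    (h.intervalIntegrable_charge hne.continuous hs.1)
    (fun t ht => hsub ⟨ht.1, ht.2.le.trans hs.2⟩)
  rw [intervalIntegral.integral_const_mul, integral_id] at this
  refine le_trans (le_of_eq ?_) this
  ring

lemma setB_nonempty (h : IsIncoming finf) (hne : ContDiff ℝ 2 ne) (hne0 : ne 0 = 1)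
    (hne1 : deriv ne 0 = -1) (hb : bohmIntegral finf < 1) : (setB ne finf).Nonempty := by
  obtain ⟨c, hc, ε, hε, H⟩ := h.exists_le_sagdeev hne hne0 hne1 hb
  refine ⟨ε, hε, fun s hs => lt_of_lt_of_le ?_ (H s ⟨hs.1.le, hs.2⟩)⟩
  have := hs.1
  positivity

lemma setB_eq_empty (h : IsIncoming finf) (hne : ContDiff ℝ 2 ne) (hne0 : ne 0 = 1)
    (hne1 : deriv ne 0 = -1) (hb : 1 < bohmIntegral finf) : setB ne finf = ∅ := by
  obtain ⟨ε, hε, hsub⟩ := mem_nhdsGT_iff_exists_Ioc_subset.1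
    (h.eventually_charge_neg hne hne0 hne1 hb)
  have hε : 0 < ε := hε
  refine eq_empty_of_forall_notMem fun b hB => ?_
  have hs : 0 < min b ε := lt_min hB.1 hε
  have h1 := hB.2 (min b ε) ⟨hs, min_le_left _ _⟩
  have := intervalIntegral.integral_mono_on_of_le_Ioo hs.le
    (g := fun _ => (0 : ℝ)) (h.intervalIntegrable_charge hne.continuous hs.le)
    intervalIntegrable_const
    (fun t ht => (hsub ⟨ht.1, ht.2.le.trans (min_le_right _ _)⟩ : _ < _).le)
  simp only [intervalIntegral.integral_const, smul_zero] at this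
  exact absurd h1 (not_lt.2 this)

/-- The potentials below `sup B` are exactly the elements of `B`. -/
lemma mem_setB_iff (h : IsIncoming finf) (hne : Continuous ne) {b : ℝ} (hb : 0 < b) :
    b ∈ setB ne finf ↔ (b : EReal) < supB ne finf := by
  constructor
  · intro hB
    have hc : ContinuousAt (sagdeev ne finf) b := (h.hasDerivAt_sagdeev hne hb).continuousAt
    have hev : ∀ᶠ s in 𝓝 b, 0 < sagdeev ne finf s :=
      hc.eventually (lt_mem_nhds (hB.2 b ⟨hb, le_rfl⟩))
    obtain ⟨ε, hε, hball⟩ := Metric.eventually_nhds_iff.1 hev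
    -- Positivity of V persists slightly beyond b, so B has no largest element and the inequality
    -- with its supremum is strict.
    have hmem : b + ε / 2 ∈ setB ne finf := by
      refine ⟨by linarith, fun s hs => ?_⟩
      rcases le_or_gt s b with hsb | hsb
      · exact hB.2 s ⟨hs.1, hsb⟩
      · apply hball
        rw [Real.dist_eq, abs_lt]
        constructor <;> linarith [hs.2]
    refine lt_of_lt_of_le (EReal.coe_lt_coe_iff.2 (show b < b + ε / 2 by linarith)) ?_
    exact le_sSup ⟨_, hmem, rfl⟩
  · intro hlt
    obtain ⟨_, ⟨b', hb', rfl⟩, hbb⟩ := lt_sSup_iff.1 hlt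
    have hbb : b < b' := EReal.coe_lt_coe_iff.1 hbb
    exact ⟨hb, fun s hs => hb'.2 s ⟨hs.1, hs.2.trans hbb.le⟩⟩

end IsIncoming

/-! ### Monotone profiles of the equation `φ' = -√(2 W(φ))` -/

section Profile

/-- Positive solutions of `φ' = -√(2 W(φ))`, `φ(0) = b` on the half line which decay to zero. -/
structure IsProfile (W : ℝ → ℝ) (b : ℝ) (φ : ℝ → ℝ) : Prop where
  initial : φ 0 = b
  pos : ∀ x, 0 ≤ x → 0 < φ x
  hasDeriv : ∀ x, 0 ≤ x → HasDerivWithinAt φ (-Real.sqrt (2 * W (φ x))) (Ici 0) x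
  tendsto : Tendsto φ atTop (𝓝 0)

variable {W w : ℝ → ℝ} {b : ℝ} {φ χ : ℝ → ℝ}

/-- The reciprocal speed of the profile in the logarithmic variable `u = -log (φ / b)`,
continued by a constant to `u < 0`. -/
noncomputable def slowness (W : ℝ → ℝ) (b u : ℝ) : ℝ :=
  b * Real.exp (-max u 0) / Real.sqrt (2 * W (b * Real.exp (-max u 0)))

lemma mul_exp_neg_max_mem (hb : 0 < b) (u : ℝ) : b * Real.exp (-max u 0) ∈ Ioc 0 b := by
  refine ⟨by positivity, mul_le_of_le_one_right hb.le ?_⟩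
  rw [Real.exp_le_one_iff]
  simp

lemma slowness_pos (hb : 0 < b) (hpos : ∀ s ∈ Ioc 0 b, 0 < W s) (u : ℝ) : 0 < slowness W b u := by
  have h := mul_exp_neg_max_mem hb u
  exact div_pos h.1 (Real.sqrt_pos.2 (mul_pos two_pos (hpos _ h)))

lemma continuous_slowness (hb : 0 < b) (hc : ContinuousOn W (Ioc 0 b))
    (hpos : ∀ s ∈ Ioc 0 b, 0 < W s) : Continuous (slowness W b) := by
  refine Continuous.div (by fun_prop) ?_ fun u => ?_
  · refine Real.continuous_sqrt.comp (continuous_const.mul ?_)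
    exact hc.comp_continuous (by fun_prop) (mul_exp_neg_max_mem hb)
  · exact (Real.sqrt_pos.2 (mul_pos two_pos (hpos _ (mul_exp_neg_max_mem hb u)))).ne'

/-- The travel time of the profile as a function of `u = -log (φ / b)`. -/
noncomputable def travelTime (W : ℝ → ℝ) (b u : ℝ) : ℝ := ∫ t in (0 : ℝ)..u, slowness W b t

lemma hasDerivAt_travelTime (hb : 0 < b) (hc : ContinuousOn W (Ioc 0 b))
    (hpos : ∀ s ∈ Ioc 0 b, 0 < W s) (u : ℝ) :
    HasDerivAt (travelTime W b) (slowness W b u) u :=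
  ((continuous_slowness hb hc hpos).integral_hasStrictDerivAt 0 u).hasDerivAt

lemma travelTime_zero : travelTime W b 0 = 0 := by simp [travelTime]

lemma strictMono_travelTime (hb : 0 < b) (hc : ContinuousOn W (Ioc 0 b))
    (hpos : ∀ s ∈ Ioc 0 b, 0 < W s) : StrictMono (travelTime W b) :=
  strictMono_of_hasDerivAt_pos (hasDerivAt_travelTime hb hc hpos) (slowness_pos hb hpos)

/-- The bound W(s) ≤ C s² keeps the slowness above k = 1/√(2C), so the travel time grows at least
linearly in both directions. The constant continuation to u < 0 makes it onto the whole line. -/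
lemma surjective_travelTime (hb : 0 < b) (hc : ContinuousOn W (Ioc 0 b))
    (hpos : ∀ s ∈ Ioc 0 b, 0 < W s) {C : ℝ} (hC : ∀ s ∈ Ioc 0 b, W s ≤ C * s ^ 2) :
    Function.Surjective (travelTime W b) := by
  have hCpos : 0 < C := by
    have h1 := hpos b ⟨hb, le_rfl⟩
    have h2 := hC b ⟨hb, le_rfl⟩
    have : 0 < b ^ 2 := by positivity
    by_contra hneg
    nlinarith
  set k := (Real.sqrt (2 * C))⁻¹
  have hk : 0 < k := inv_pos.2 (Real.sqrt_pos.2 (by positivity))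
  have hlow : ∀ u, k ≤ slowness W b u := fun u => by
    have hm := mul_exp_neg_max_mem hb u
    unfold slowness
    set s := b * Real.exp (-max u 0)
    have hW := hpos s hm
    rw [le_div_iff₀ (Real.sqrt_pos.2 (by positivity)), inv_mul_le_iff₀ (Real.sqrt_pos.2 (by positivity))]
    rw [← Real.sqrt_sq hm.1.le, ← Real.sqrt_mul (by positivity), Real.sqrt_sq hm.1.le]
    apply Real.sqrt_le_sqrt
    nlinarith [hC s hm]
  have hmono : Monotone fun u => travelTime W b u - k * u := by
    refine monotone_of_hasDerivAt_nonneg (f' := fun u => slowness W b u - k)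
      (fun u => ?_) fun u => sub_nonneg.2 (hlow u)
    refine ((hasDerivAt_travelTime hb hc hpos u).sub
      ((hasDerivAt_id u).const_mul k)).congr_deriv ?_
    rw [mul_one]
  have hcont : Continuous (travelTime W b) :=
    continuous_iff_continuousAt.2 fun u => (hasDerivAt_travelTime hb hc hpos u).continuousAt
  apply hcont.surjective
  · refine tendsto_atTop_mono' atTop ?_ (tendsto_id.const_mul_atTop hk)
    filter_upwards [eventually_ge_atTop 0] with u hu
    have := hmono hu
    simp only [travelTime_zero] at this
    simp only [id]
    linarith
  · refine tendsto_atBot_mono' atBot ?_ (tendsto_id.const_mul_atBot hk)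
    filter_upwards [eventually_le_atBot 0] with u hu
    have := hmono hu
    simp only [travelTime_zero] at this
    simp only [id]
    linarith

/-- The inverse u of the travel time has derivative 1/slowness, so φ = b e^{−u} satisfies φ' =
−√(2W(φ)) for x ≥ 0, and u → ∞ gives φ → 0. -/
theorem exists_isProfile (hb : 0 < b) (hc : ContinuousOn W (Ioc 0 b))
    (hpos : ∀ s ∈ Ioc 0 b, 0 < W s) {C : ℝ} (hC : ∀ s ∈ Ioc 0 b, W s ≤ C * s ^ 2) :
    ∃ φ, IsProfile W b φ := by
  set e : ℝ ≃o ℝ := StrictMono.orderIsoOfSurjective _ (strictMono_travelTime hb hc hpos)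
    (surjective_travelTime hb hc hpos hC)
  have he : ∀ x, travelTime W b (e.symm x) = x := fun x => e.apply_symm_apply x
  have he0 : e.symm 0 = 0 := by
    apply (strictMono_travelTime hb hc hpos).injective
    rw [he, travelTime_zero]
  have hd : ∀ x, HasDerivAt e.symm (slowness W b (e.symm x))⁻¹ x := fun x =>
    HasDerivAt.of_local_left_inverse e.symm.continuous.continuousAt
      (hasDerivAt_travelTime hb hc hpos _) (slowness_pos hb hpos _).ne' (Eventually.of_forall he)
  refine ⟨fun x => b * Real.exp (-e.symm x), by simp [he0], fun x _ => by positivity,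
    fun x hx => ?_, ?_⟩
  · have hx0 : 0 ≤ e.symm x := by
      rw [← he0]; exact e.symm.monotone hx
    have h1 := ((hd x).fun_neg.exp.const_mul b).hasDerivWithinAt (s := Ici 0)
    refine h1.congr_deriv ?_
    have hm := mul_exp_neg_max_mem hb (e.symm x)
    simp only [slowness, max_eq_left hx0] at hm ⊢
    have := (Real.sqrt_pos.2 (mul_pos two_pos (hpos _ hm))).ne'
    field_simp
  · have h1 : Tendsto (fun x => -e.symm x) atTop atBot :=
      tendsto_neg_atTop_atBot.comp e.symm.tendsto_atTop
    simpa using (Real.tendsto_exp_atBot.comp h1).const_mul b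

namespace IsProfile

lemma continuousOn (h : IsProfile W b φ) : ContinuousOn φ (Ici 0) :=
  fun x hx => (h.hasDeriv x hx).continuousWithinAt

lemma hasDerivAt (h : IsProfile W b φ) {x : ℝ} (hx : 0 < x) :
    HasDerivAt φ (-Real.sqrt (2 * W (φ x))) x :=
  (h.hasDeriv x hx.le).hasDerivAt (Ici_mem_nhds hx)

lemma antitoneOn (h : IsProfile W b φ) : AntitoneOn φ (Ici 0) := by
  refine antitoneOn_of_deriv_nonpos (convex_Ici 0) h.continuousOn ?_ ?_
  · intro x hx
    rw [interior_Ici] at hx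
    exact (h.hasDerivAt hx).differentiableAt.differentiableWithinAt
  · intro x hx
    rw [interior_Ici] at hx
    rw [(h.hasDerivAt hx).deriv]
    exact neg_nonpos.2 (Real.sqrt_nonneg _)

lemma mem_Ioc (h : IsProfile W b φ) {x : ℝ} (hx : 0 ≤ x) : φ x ∈ Ioc 0 b := by
  refine ⟨h.pos x hx, ?_⟩
  rw [← h.initial]
  exact h.antitoneOn self_mem_Ici hx hx

lemma dx_eq (h : IsProfile W b φ) {x : ℝ} (hx : 0 ≤ x) : dx φ x = -Real.sqrt (2 * W (φ x)) :=
  (h.hasDeriv x hx).derivWithin (uniqueDiffOn_Ici 0 x hx)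

/-- Separation of variables: along any profile the travel time minus x has zero derivative and
vanishes at x = 0. Uniqueness follows because the travel time is injective. -/
lemma travelTime_eq (h : IsProfile W b φ) (hc : ContinuousOn W (Ioc 0 b))
    (hpos : ∀ s ∈ Ioc 0 b, 0 < W s) {x : ℝ} (hx : 0 ≤ x) :
    travelTime W b (-Real.log (φ x / b)) = x := by
  have hb : 0 < b := h.initial ▸ h.pos 0 le_rfl
  have hd : ∀ y, 0 ≤ y → HasDerivWithinAt
      (fun y => travelTime W b (-Real.log (φ y / b)) - y) 0 (Ici 0) y := fun y hy => by
    have hφ := h.mem_Ioc hy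
    have hne : φ y / b ≠ 0 := (div_pos hφ.1 hb).ne'
    have h1 := (((h.hasDeriv y hy).div_const b).log hne).neg
    have h2 := (hasDerivAt_travelTime hb hc hpos (-Real.log (φ y / b))).comp_hasDerivWithinAt y h1
    refine (h2.sub (hasDerivWithinAt_id y _)).congr_deriv ?_
    have hu : 0 ≤ -Real.log (φ y / b) :=
      neg_nonneg.2 (Real.log_nonpos (div_pos hφ.1 hb).le ((div_le_one hb).2 hφ.2))
    have he : b * Real.exp (Real.log (φ y / b)) = φ y := by
      rw [Real.exp_log (div_pos hφ.1 hb)]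
      field_simp
    simp only [slowness, max_eq_left hu, neg_neg, he]
    have := (Real.sqrt_pos.2 (mul_pos two_pos (hpos _ hφ))).ne'
    have := hφ.1.ne'
    field_simp
    ring
  have := constant_of_has_deriv_right_zero (a := 0) (b := x)
    (f := fun y => travelTime W b (-Real.log (φ y / b)) - y)
    (fun y hy => (hd y hy.1).continuousWithinAt.mono Icc_subset_Ici_self)
    (fun y hy => (hd y hy.1).mono (Ici_subset_Ici.2 hy.1)) x (right_mem_Icc.2 hx)
  simp only [h.initial, div_self hb.ne', Real.log_one, neg_zero, travelTime_zero] at this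
  linarith

theorem unique (h : IsProfile W b φ) (h' : IsProfile W b χ) (hc : ContinuousOn W (Ioc 0 b))
    (hpos : ∀ s ∈ Ioc 0 b, 0 < W s) {x : ℝ} (hx : 0 ≤ x) : φ x = χ x := by
  have hb : 0 < b := h.initial ▸ h.pos 0 le_rfl
  have h1 := (strictMono_travelTime hb hc hpos).injective
    ((h.travelTime_eq hc hpos hx).trans (h'.travelTime_eq hc hpos hx).symm)
  have h2 := Real.log_injOn_pos (div_pos (h.pos x hx) hb) (div_pos (h'.pos x hx) hb)
    (neg_injective h1)
  exact (div_left_inj' hb.ne').1 h2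

/-- In the derivative of −√(2W(φ)) the factor φ' cancels the root in the denominator; W > 0 keeps
the root differentiable. -/
lemma hasDerivWithinAt_dx (h : IsProfile W b φ) (hpos : ∀ s ∈ Ioc 0 b, 0 < W s)
    (hw : ∀ s ∈ Ioc 0 b, HasDerivAt W (w s) s) {x : ℝ} (hx : 0 ≤ x) :
    HasDerivWithinAt (dx φ) (w (φ x)) (Ici 0) x := by
  have hφ := h.mem_Ioc hx
  have hS := (Real.sqrt_pos.2 (mul_pos two_pos (hpos _ hφ))).ne'
  have h1 := (((hw _ hφ).comp_hasDerivWithinAt x (h.hasDeriv x hx)).const_mul 2).sqrt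
    (mul_pos two_pos (hpos _ hφ)).ne' |>.neg
  refine (h1.congr (fun y hy => h.dx_eq hy) (h.dx_eq hx)).congr_deriv ?_
  simp only [Function.comp_apply]
  field_simp

lemma dxx_eq (h : IsProfile W b φ) (hpos : ∀ s ∈ Ioc 0 b, 0 < W s)
    (hw : ∀ s ∈ Ioc 0 b, HasDerivAt W (w s) s) {x : ℝ} (hx : 0 ≤ x) :
    dxx φ x = w (φ x) := by
  have h1 : iteratedDerivWithin 1 φ (Ici 0) = dx φ := iteratedDerivWithin_one
  rw [dxx, iteratedDerivWithin_succ, h1]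
  exact (h.hasDerivWithinAt_dx hpos hw hx).derivWithin (uniqueDiffOn_Ici 0 x hx)

lemma contDiffOn_two (h : IsProfile W b φ) (hpos : ∀ s ∈ Ioc 0 b, 0 < W s)
    (hw : ∀ s ∈ Ioc 0 b, HasDerivAt W (w s) s) (hwc : ContinuousOn w (Ioc 0 b)) :
    ContDiffOn ℝ 2 φ (Ici 0) := by
  have hu := uniqueDiffOn_Ici (0 : ℝ)
  have h1 : ContDiffOn ℝ 1 (dx φ) (Ici 0) := by
    rw [show (1 : WithTop ℕ∞) = 0 + 1 from rfl, contDiffOn_succ_iff_derivWithin hu]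
    refine ⟨fun x hx => (h.hasDerivWithinAt_dx hpos hw hx).differentiableWithinAt,
      fun hh => by simp at hh, ?_⟩
    rw [contDiffOn_zero]
    refine (hwc.comp h.continuousOn fun x hx => h.mem_Ioc hx).congr fun x hx => ?_
    exact (h.hasDerivWithinAt_dx hpos hw hx).derivWithin (hu x hx)
  rw [show (2 : WithTop ℕ∞) = 1 + 1 from rfl, contDiffOn_succ_iff_derivWithin hu]
  exact ⟨fun x hx => (h.hasDeriv x hx).differentiableWithinAt, fun hh => by simp at hh, h1⟩

theorem expDecay (h : IsProfile W b φ) (hpos : ∀ s ∈ Ioc 0 b, 0 < W s)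
    (hw : ∀ s ∈ Ioc 0 b, HasDerivAt W (w s) s) {k K L : ℝ} (hk : 0 < k)
    (hlow : ∀ s ∈ Ioc 0 b, k * s ^ 2 ≤ W s) (hup : ∀ s ∈ Ioc 0 b, W s ≤ K * s ^ 2)
    (hL : ∀ s ∈ Ioc 0 b, |w s| ≤ L * s) : ExpDecay φ := by
  have hb : 0 < b := h.initial ▸ h.pos 0 le_rfl
  -- The lower bound on W gives φ' ≤ −cφ for this c, so φ e^{cx} is nonincreasing.
  set c := Real.sqrt (2 * k)
  have hc : 0 < c := Real.sqrt_pos.2 (by positivity)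
  have hdecay : ∀ x, 0 ≤ x → φ x ≤ b * Real.exp (-c * x) := by
    intro x hx
    have hanti : AntitoneOn (fun x => φ x * Real.exp (c * x)) (Ici 0) := by
      have hd : ∀ y, 0 ≤ y → HasDerivWithinAt (fun x => φ x * Real.exp (c * x))
          ((-Real.sqrt (2 * W (φ y)) + c * φ y) * Real.exp (c * y)) (Ici 0) y := fun y hy => by
        have h1 : HasDerivAt (fun x => Real.exp (c * x)) (Real.exp (c * y) * (c * 1)) y :=
          ((hasDerivAt_id y).const_mul c).exp
        refine ((h.hasDeriv y hy).mul h1.hasDerivWithinAt).congr_deriv ?_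
        ring
      refine antitoneOn_of_deriv_nonpos (convex_Ici 0)
        (fun y hy => (hd y hy).continuousWithinAt) ?_ ?_
      · intro y hy
        exact (hd y (interior_subset hy)).differentiableWithinAt.mono interior_subset
      · intro y hy
        rw [interior_Ici] at hy
        have hy : 0 < y := hy
        rw [((hd y hy.le).hasDerivAt (Ici_mem_nhds hy)).deriv]
        have hm := h.mem_Ioc hy.le
        refine mul_nonpos_of_nonpos_of_nonneg ?_ (Real.exp_pos _).le
        have : c * φ y ≤ Real.sqrt (2 * W (φ y)) := by
          apply Real.le_sqrt_of_sq_le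
          rw [mul_pow, Real.sq_sqrt (by positivity)]
          nlinarith [hlow _ hm]
        linarith
    have h1 := hanti self_mem_Ici hx hx
    simp only [h.initial, mul_zero, Real.exp_zero, mul_one] at h1
    rw [neg_mul, Real.exp_neg, ← div_eq_mul_inv, le_div_iff₀ (Real.exp_pos _)]
    exact h1
  have hKpos : 0 < K := by
    have h1 := hpos b ⟨hb, le_rfl⟩
    have h2 := hup b ⟨hb, le_rfl⟩
    have : 0 < b ^ 2 := by positivity
    by_contra hneg
    nlinarith
  -- Chosen so that φ, |φ'| and |φ''| are all at most M φ.
  set M := max 1 (max (Real.sqrt (2 * K)) L)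
  have hM1 : 1 ≤ M := le_max_left _ _
  have hM2 : Real.sqrt (2 * K) ≤ M := (le_max_left _ _).trans (le_max_right _ _)
  have hM3 : L ≤ M := (le_max_right _ _).trans (le_max_right _ _)
  refine ⟨c, hc, M * b, by positivity, fun l hl x hx => ?_⟩
  have hm := h.mem_Ioc hx
  have hMφ : M * φ x ≤ M * b * Real.exp (-c * x) := by
    rw [mul_assoc]
    exact mul_le_mul_of_nonneg_left (hdecay x hx) (by positivity)
  refine le_trans ?_ hMφ
  interval_cases l
  · rw [iteratedDerivWithin_zero, abs_of_pos hm.1]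
    exact le_mul_of_one_le_left hm.1.le hM1
  · rw [iteratedDerivWithin_one, ← dx, h.dx_eq hx, abs_neg, abs_of_nonneg (Real.sqrt_nonneg _)]
    refine le_trans ?_ (mul_le_mul_of_nonneg_right hM2 hm.1.le)
    apply Real.sqrt_le_iff.2 ⟨by have := hm.1; positivity, ?_⟩
    rw [mul_pow, Real.sq_sqrt (by positivity)]
    nlinarith [hup _ hm]
  · rw [← dxx, h.dxx_eq hpos hw hx]
    exact (hL _ hm).trans (mul_le_mul_of_nonneg_right hM3 hm.1.le)

end IsProfile

end Profile

/-! ### Transport along the energy levels -/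

/-- The density obtained from the density `g` of incoming particles at zero potential by
acceleration through the potential difference `s`. -/
noncomputable def shift (g : Velocity → ℝ) (s : ℝ) (ξ : Velocity) : ℝ :=
  g (-Real.sqrt (ξ.1 ^ 2 - 2 * s), ξ.2) * chi (ξ.1 ^ 2 - 2 * s) * chi (-ξ.1)

/-- The velocity at potential `s` of a particle with incoming velocity `η` at zero potential. -/
noncomputable def accel (s : ℝ) (η : Velocity) : Velocity :=
  (-Real.sqrt (η.1 ^ 2 + 2 * s), η.2)

/-- The velocities reached at potential `s` by incoming particles. -/
def accelRegion (s : ℝ) : Set Velocity := {ξ | ξ.1 < 0 ∧ 2 * s < ξ.1 ^ 2}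

/-- The incoming velocities. -/
def incoming : Set Velocity := {η | η.1 < 0}

lemma isOpen_accelRegion (s : ℝ) : IsOpen (accelRegion s) := by
  unfold accelRegion
  exact (isOpen_lt (by fun_prop) (by fun_prop)).and (isOpen_lt (by fun_prop) (by fun_prop))

lemma isOpen_incoming : IsOpen incoming := isOpen_lt (by fun_prop) (by fun_prop)

lemma chi_of_pos {s : ℝ} (hs : 0 < s) : chi s = 1 := by simp [chi, hs]

lemma chi_of_nonpos {s : ℝ} (hs : s ≤ 0) : chi s = 0 := by simp [chi, hs]

lemma measurable_chi : Measurable chi := measurable_one.indicator measurableSet_Ioi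

lemma shift_of_mem (g : Velocity → ℝ) {s : ℝ} {ξ : Velocity} (h : ξ ∈ accelRegion s) :
    shift g s ξ = g (-Real.sqrt (ξ.1 ^ 2 - 2 * s), ξ.2) := by
  rw [shift, chi_of_pos (by linarith [h.2]), chi_of_pos (by linarith [h.1]), mul_one, mul_one]

lemma shift_of_notMem (g : Velocity → ℝ) {s : ℝ} {ξ : Velocity} (h : ξ ∉ accelRegion s) :
    shift g s ξ = 0 := by
  rw [accelRegion, mem_ofPred_eq, not_and_or, not_lt, not_lt] at h
  rcases h with h | h
  · rw [shift, chi_of_nonpos (show -ξ.1 ≤ 0 by linarith), mul_zero]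
  · rw [shift, chi_of_nonpos (show ξ.1 ^ 2 - 2 * s ≤ 0 by linarith), mul_zero, zero_mul]

lemma accel_mem {s : ℝ} (hs : 0 ≤ s) {η : Velocity} (hη : η ∈ incoming) :
    accel s η ∈ accelRegion s := by
  have h0 : 0 < η.1 ^ 2 := by have : η.1 < 0 := hη; nlinarith
  constructor
  · exact neg_neg_of_pos (Real.sqrt_pos.2 (by positivity))
  · simp only [accel, neg_sq]
    rw [Real.sq_sqrt (by positivity)]
    linarith

lemma accel_decel {s : ℝ} {ξ : Velocity} (hξ : ξ ∈ accelRegion s) :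
    accel s (-Real.sqrt (ξ.1 ^ 2 - 2 * s), ξ.2) = ξ := by
  have h1 : 0 ≤ ξ.1 ^ 2 - 2 * s := by linarith [hξ.2]
  ext
  · simp only [accel, neg_sq]
    rw [Real.sq_sqrt h1, sub_add_cancel, Real.sqrt_sq_eq_abs, abs_of_neg hξ.1, neg_neg]
  all_goals simp [accel]

lemma decel_accel {s : ℝ} (hs : 0 ≤ s) {η : Velocity} (hη : η ∈ incoming) :
    (-Real.sqrt ((accel s η).1 ^ 2 - 2 * s), (accel s η).2) = η := by
  have h1 : η.1 < 0 := hη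
  ext
  · simp only [accel, neg_sq]
    rw [Real.sq_sqrt (by positivity), add_sub_cancel_right, Real.sqrt_sq_eq_abs, abs_of_neg h1,
      neg_neg]
  all_goals simp [accel]

lemma shift_accel (g : Velocity → ℝ) {s : ℝ} (hs : 0 ≤ s) {η : Velocity} (hη : η ∈ incoming) :
    shift g s (accel s η) = g η := by
  rw [shift_of_mem g (accel_mem hs hη), decel_accel hs hη]

lemma decel_mem {s : ℝ} {ξ : Velocity} (hξ : ξ ∈ accelRegion s) :
    ((-Real.sqrt (ξ.1 ^ 2 - 2 * s), ξ.2) : Velocity) ∈ incoming :=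
  neg_neg_of_pos (Real.sqrt_pos.2 (by linarith [hξ.2]))

lemma accel_image {s : ℝ} (hs : 0 ≤ s) : accel s '' incoming = accelRegion s := by
  apply Subset.antisymm
  · rintro _ ⟨η, hη, rfl⟩
    exact accel_mem hs hη
  · intro ξ hξ
    exact ⟨_, decel_mem hξ, accel_decel hξ⟩

lemma injOn_accel {s : ℝ} (hs : 0 ≤ s) : InjOn (accel s) incoming := by
  intro η hη η' hη' h
  rw [← decel_accel hs hη, ← decel_accel hs hη', h]

/-- The Jacobian of `accel`. -/
noncomputable def accelJac (s : ℝ) (η : Velocity) : ℝ := -η.1 / Real.sqrt (η.1 ^ 2 + 2 * s)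

lemma accelJac_nonneg {s : ℝ} {η : Velocity} (hη : η ∈ incoming) : 0 ≤ accelJac s η := by
  have : η.1 < 0 := hη
  exact div_nonneg (by linarith) (Real.sqrt_nonneg _)

lemma accelJac_le_one {s : ℝ} (hs : 0 ≤ s) (η : Velocity) : accelJac s η ≤ 1 :=
  (le_abs_self _).trans (abs_velocity_ratio_le_one hs)

/-- The derivative of `accel`. -/
noncomputable def accelDeriv (s : ℝ) (η : Velocity) : Velocity →L[ℝ] Velocity :=
  (accelJac s η • ContinuousLinearMap.id ℝ ℝ).prodMap (ContinuousLinearMap.id ℝ (ℝ × ℝ))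

lemma det_accelDeriv (s : ℝ) (η : Velocity) : (accelDeriv s η).det = accelJac s η := by
  rw [accelDeriv, ContinuousLinearMap.det, ContinuousLinearMap.coe_prodMap, LinearMap.det_prodMap]
  simp

lemma hasDerivAt_neg_sqrt {s v : ℝ} (h : 0 < v ^ 2 + 2 * s) :
    HasDerivAt (fun v : ℝ => -Real.sqrt (v ^ 2 + 2 * s)) (-v / Real.sqrt (v ^ 2 + 2 * s)) v := by
  have h1 : HasDerivAt (fun v : ℝ => v ^ 2 + 2 * s) (2 * v) v := by
    simpa using (hasDerivAt_pow 2 v).add_const (2 * s)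
  refine (h1.sqrt h.ne').fun_neg.congr_deriv ?_
  have := (Real.sqrt_pos.2 h).ne'
  field_simp

lemma hasFDerivAt_accel {s : ℝ} (hs : 0 ≤ s) {η : Velocity} (hη : η ∈ incoming) :
    HasFDerivAt (accel s) (accelDeriv s η) η := by
  have h0 : 0 < η.1 ^ 2 := by have : η.1 < 0 := hη; nlinarith
  have h1 := (hasDerivAt_neg_sqrt (s := s) (v := η.1) (by positivity)).hasFDerivAt
  have h2 := HasFDerivAt.prodMap η h1 (hasFDerivAt_id η.2)
  refine h2.congr_fderiv ?_
  rw [accelDeriv]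
  congr 1
  ext
  simp [accelJac]

lemma lintegral_accelRegion {s : ℝ} (hs : 0 ≤ s) (F : Velocity → ENNReal) :
    ∫⁻ ξ in accelRegion s, F ξ =
      ∫⁻ η in incoming, ENNReal.ofReal (accelJac s η) * F (accel s η) := by
  rw [← accel_image hs, lintegral_image_eq_lintegral_abs_det_fderiv_mul volume
    isOpen_incoming.measurableSet (fun η hη => (hasFDerivAt_accel hs hη).hasFDerivWithinAt)
    (injOn_accel hs)]
  refine setLIntegral_congr_fun isOpen_incoming.measurableSet fun η hη => ?_
  simp only [det_accelDeriv, abs_of_nonneg (accelJac_nonneg hη)]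

lemma integral_accelRegion {s : ℝ} (hs : 0 ≤ s) (F : Velocity → ℝ) :
    ∫ ξ in accelRegion s, F ξ = ∫ η in incoming, accelJac s η * F (accel s η) := by
  rw [← accel_image hs, integral_image_eq_integral_abs_det_fderiv_smul volume
    isOpen_incoming.measurableSet (fun η hη => (hasFDerivAt_accel hs hη).hasFDerivWithinAt)
    (injOn_accel hs)]
  refine setIntegral_congr_fun isOpen_incoming.measurableSet fun η hη => ?_
  simp only [det_accelDeriv, abs_of_nonneg (accelJac_nonneg hη), smul_eq_mul]

/-- The substitution ξ = `accel s η` turns the transported density back into g, at the cost of the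
Jacobian, which is the kernel of ρᵢ. -/
lemma integral_shift_mul (g : Velocity → ℝ) {s : ℝ} (hs : 0 ≤ s) (F : Velocity → ℝ) :
    ∫ ξ, shift g s ξ * F ξ = ∫ η in incoming, accelJac s η * (g η * F (accel s η)) := by
  rw [← setIntegral_eq_integral_of_forall_compl_eq_zero (s := accelRegion s)
    (fun ξ hξ => by rw [shift_of_notMem g hξ, zero_mul]), integral_accelRegion hs]
  refine setIntegral_congr_fun isOpen_incoming.measurableSet fun η hη => ?_
  simp only [shift_accel g hs hη]

/-- The Jacobian of the acceleration is at most one, so transport contracts the L¹ norm. -/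
lemma lintegral_enorm_shift_le (g : Velocity → ℝ) {s : ℝ} (hs : 0 ≤ s) :
    ∫⁻ ξ, ‖shift g s ξ‖ₑ ≤ ∫⁻ η, ‖g η‖ₑ := by
  rw [← setLIntegral_eq_of_support_subset (s := accelRegion s)
    (fun ξ hξ => by
      by_contra h
      exact hξ (by simp [shift_of_notMem g h])), lintegral_accelRegion hs]
  refine le_trans ?_ (setLIntegral_le_lintegral incoming _)
  refine setLIntegral_mono' isOpen_incoming.measurableSet fun η hη => ?_
  rw [shift_accel g hs hη]
  exact mul_le_of_le_one_left zero_le (ENNReal.ofReal_le_one.2 (accelJac_le_one hs η))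

/-- Differentiable maps send null sets to null sets, so the acceleration carries the exceptional set
of incoming velocities to a null set. This allows passing to measurable representatives. -/
lemma shift_congr {g g' : Velocity → ℝ} (h : g =ᵐ[volume] g') {s : ℝ} (hs : 0 ≤ s) :
    shift g s =ᵐ[volume] shift g' s := by
  have h0 : volume ({η | g η ≠ g' η} ∩ incoming) = 0 :=
    measure_mono_null inter_subset_left h
  have h1 : volume (accel s '' ({η | g η ≠ g' η} ∩ incoming)) = 0 :=
    addHaar_image_eq_zero_of_differentiableOn_of_addHaar_eq_zero volume
      (fun η hη => (hasFDerivAt_accel hs hη.2).differentiableAt.differentiableWithinAt) h0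
  refine measure_mono_null (fun ξ hξ => ?_) h1
  have hξ : shift g s ξ ≠ shift g' s ξ := hξ
  have hmem : ξ ∈ accelRegion s := by
    by_contra h
    exact hξ (by rw [shift_of_notMem g h, shift_of_notMem g' h])
  rw [shift_of_mem g hmem, shift_of_mem g' hmem] at hξ
  exact ⟨_, ⟨hξ, decel_mem hmem⟩, accel_decel hmem⟩

lemma measurable_shift {g : Velocity → ℝ} (hg : Measurable g) (s : ℝ) : Measurable (shift g s) := by
  unfold shift
  have := measurable_chi
  fun_prop

lemma integrable_shift {g : Velocity → ℝ} (hg : Integrable g) {s : ℝ} (hs : 0 ≤ s) :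
    Integrable (shift g s) := by
  refine ⟨?_, (lintegral_enorm_shift_le g hs).trans_lt hg.2⟩
  exact (measurable_shift hg.1.stronglyMeasurable_mk.measurable s).aestronglyMeasurable.congr
    (shift_congr hg.1.ae_eq_mk hs).symm

lemma integral_abs_shift_le {g : Velocity → ℝ} (hg : Integrable g) {s : ℝ} (hs : 0 ≤ s) :
    ∫ ξ, |shift g s ξ| ≤ ∫ ξ, |g ξ| := by
  have h1 := integral_norm_eq_lintegral_enorm (integrable_shift hg hs).1
  have h2 := integral_norm_eq_lintegral_enorm hg.1
  simp only [Real.norm_eq_abs] at h1 h2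
  rw [h1, h2]
  exact ENNReal.toReal_mono hg.2.ne (lintegral_enorm_shift_le g hs)

lemma shift_sub (g g' : Velocity → ℝ) (s : ℝ) (ξ : Velocity) :
    shift (fun η => g η - g' η) s ξ = shift g s ξ - shift g' s ξ := by
  simp only [shift]
  ring

lemma tendsto_chi {ι : Type*} {l : Filter ι} {u : ι → ℝ} {a : ℝ} (hu : Tendsto u l (𝓝 a))
    (ha : a ≠ 0) : ∀ᶠ i in l, chi (u i) = chi a := by
  rcases lt_or_gt_of_ne ha with h | h
  · filter_upwards [hu.eventually (gt_mem_nhds h)] with i hi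
    rw [chi_of_nonpos hi.le, chi_of_nonpos h.le]
  · filter_upwards [hu.eventually (lt_mem_nhds h)] with i hi
    rw [chi_of_pos hi, chi_of_pos h]

lemma tendsto_integral_abs_shift_sub_of_continuous {g : Velocity → ℝ} (hg : Continuous g)
    (hgc : HasCompactSupport g) {s : ℝ} :
    Tendsto (fun t => ∫ ξ, |shift g t ξ - shift g s ξ|) (𝓝 s) (𝓝 0) := by
  obtain ⟨M, hM⟩ := hg.bounded_above_of_compact_support hgc
  obtain ⟨R, hR⟩ := hgc.isCompact.isBounded.subset_closedBall 0
  have hM0 : 0 ≤ M := (norm_nonneg _).trans (hM 0)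
  -- Where `shift g t` is nonzero, ξ₁² ≤ R² + 2t, and |ξ₁| ≤ ξ₁² + 1; this one ball serves all t
  -- with |t| ≤ |s| + 1.
  set K := Metric.closedBall (0 : Velocity) (R ^ 2 + R + 2 * (|s| + 1) + 1)
  have hbound : ∀ t, |t| ≤ |s| + 1 → ∀ ξ, |shift g t ξ| ≤ K.indicator (fun _ => M) ξ := by
    intro t ht ξ
    by_cases hξ : ξ ∈ K
    · rw [indicator_of_mem hξ]
      by_cases hm : ξ ∈ accelRegion t
      · rw [shift_of_mem g hm]; exact hM _
      · rw [shift_of_notMem g hm]; simpa using hM0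
    · rw [indicator_of_notMem hξ]
      refine le_of_eq (abs_eq_zero.2 ?_)
      by_cases hm : ξ ∈ accelRegion t
      · rw [shift_of_mem g hm]
        by_contra hne
        apply hξ
        have h1 := hR (subset_tsupport _ hne)
        rw [mem_closedBall_zero_iff, Prod.norm_def, max_le_iff] at h1
        have h2 : Real.sqrt (ξ.1 ^ 2 - 2 * t) ≤ R := by
          have := h1.1
          simpa [abs_of_nonneg (Real.sqrt_nonneg _)] using this
        have hR0 : 0 ≤ R := (Real.sqrt_nonneg _).trans h2
        have h3 : ξ.1 ^ 2 - 2 * t ≤ R ^ 2 := (Real.sqrt_le_left hR0).1 h2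
        have h4 := (abs_le.1 ht).2
        rw [mem_closedBall_zero_iff, Prod.norm_def, max_le_iff]
        constructor
        · rw [Real.norm_eq_abs]
          have := sq_abs ξ.1
          nlinarith [sq_nonneg (|ξ.1| - 1), abs_nonneg s]
        · have : ‖ξ.2‖ ≤ R := h1.2
          nlinarith [abs_nonneg s]
      · exact shift_of_notMem g hm
  have hK : Integrable (K.indicator fun _ => M) :=
    (integrable_indicator_iff Metric.isClosed_closedBall.measurableSet).2
      (integrableOn_const (isCompact_closedBall _ _).measure_lt_top.ne)
  have hev : ∀ᶠ t in 𝓝 s, |t| ≤ |s| + 1 :=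
    (continuous_abs.tendsto s).eventually (ge_mem_nhds (by linarith))
  have hmeas := measurable_shift hg.measurable
  have := tendsto_integral_filter_of_dominated_convergence (μ := volume) (l := 𝓝 s)
    (F := fun t ξ => |shift g t ξ - shift g s ξ|) (f := fun _ => 0)
    (fun ξ => 2 * K.indicator (fun _ => M) ξ)
    (Eventually.of_forall fun t => ((hmeas t).sub (hmeas s)).abs.aestronglyMeasurable)
    ?_ (hK.const_mul 2) ?_
  · simpa using this
  · filter_upwards [hev] with t ht
    refine ae_of_all _ fun ξ => ?_
    rw [Real.norm_eq_abs, abs_abs]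
    have h1 := hbound t ht ξ
    have h2 := hbound s (by linarith) ξ
    have := abs_sub (shift g t ξ) (shift g s ξ)
    linarith
  -- The factor `chi (ξ.1 ^ 2 - 2 * t)` can jump at t = s only if ξ₁² = 2s; these velocities lie on
  -- two excluded hyperplanes.
  · filter_upwards [ae_fst_ne (-Real.sqrt (2 * s)), ae_fst_ne (Real.sqrt (2 * s))] with ξ h1 h2
    by_cases hz : ξ.1 ^ 2 - 2 * s = 0
    · exfalso
      have : |ξ.1| = Real.sqrt (2 * s) := by
        rw [← Real.sqrt_sq_eq_abs]; congr 1; linarith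
      rcases abs_choice ξ.1 with h | h
      · exact h2 (h ▸ this)
      · exact h1 (by linarith)
    have hcont : Continuous fun t : ℝ => ξ.1 ^ 2 - 2 * t := by fun_prop
    have h3 : Tendsto (fun t => g (-Real.sqrt (ξ.1 ^ 2 - 2 * t), ξ.2)) (𝓝 s)
        (𝓝 (g (-Real.sqrt (ξ.1 ^ 2 - 2 * s), ξ.2))) :=
      Continuous.tendsto (by fun_prop) s
    have h4 : Tendsto (fun t => chi (ξ.1 ^ 2 - 2 * t)) (𝓝 s) (𝓝 (chi (ξ.1 ^ 2 - 2 * s))) :=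
      tendsto_const_nhds.congr' ((tendsto_chi (hcont.tendsto s) hz).mono fun t ht => ht.symm)
    have h5 := (((h3.mul h4).mul_const (chi (-ξ.1))).sub_const (shift g s ξ)).abs
    simpa [shift] using h5

/-- The transport is continuous in `L¹` with respect to the potential. -/
theorem tendsto_integral_abs_shift_sub {g : Velocity → ℝ} (hg : Integrable g) {s : ℝ}
    (hs : 0 ≤ s) :
    Tendsto (fun t => ∫ ξ, |shift g t ξ - shift g s ξ|) (𝓝[Ici 0] s) (𝓝 0) := by
  rw [Metric.tendsto_nhds]
  intro ε hε
  -- By the L¹ contraction, replacing g by k costs at most ε/4 at each of t and s; the third ε/4 is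
  -- the continuous case, so the total is below ε.
  obtain ⟨k, hkc, hk, hkcont, hkint⟩ :=
    hg.exists_hasCompactSupport_integral_sub_le (ε := ε / 4) (by linarith)
  have h1 := (tendsto_integral_abs_shift_sub_of_continuous hkcont hkc (s := s)).mono_left
    (nhdsWithin_le_nhds (s := Ici 0))
  filter_upwards [h1.eventually (gt_mem_nhds (show (0 : ℝ) < ε / 4 by linarith)),
    self_mem_nhdsWithin] with t ht ht0
  have ht0 : 0 ≤ t := ht0
  rw [dist_zero_right, Real.norm_eq_abs, abs_of_nonneg (integral_nonneg fun _ => abs_nonneg _)]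
  have hgk := hg.sub hkint
  have hgk' : Integrable (fun η => g η - k η) := hgk
  have a1 := integral_abs_shift_le hgk' ht0
  have a2 := integral_abs_shift_le hgk' hs
  simp only [Real.norm_eq_abs] at hk
  have i1 := (integrable_shift hgk' ht0).abs
  have i2 := (integrable_shift hgk' hs).abs
  have i3 := ((integrable_shift hkint ht0).sub (integrable_shift hkint hs)).abs
  have hle : ∫ ξ, |shift g t ξ - shift g s ξ| ≤
      ∫ ξ, (|shift (fun η => g η - k η) t ξ| + |shift (fun η => g η - k η) s ξ| +
        |shift k t ξ - shift k s ξ|) := by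
    refine integral_mono ((integrable_shift hg ht0).sub (integrable_shift hg hs)).abs
      ((i1.add i2).add i3) fun ξ => ?_
    simp only [shift_sub]
    have : shift g t ξ - shift g s ξ = (shift g t ξ - shift k t ξ) - (shift g s ξ - shift k s ξ) +
      (shift k t ξ - shift k s ξ) := by ring
    rw [this]
    exact (abs_add_le _ _).trans (add_le_add_left (abs_sub _ _) _)
  have hsum : ∫ ξ, (|shift (fun η => g η - k η) t ξ| + |shift (fun η => g η - k η) s ξ| +
        |shift k t ξ - shift k s ξ|) = (∫ ξ, |shift (fun η => g η - k η) t ξ|) +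
        (∫ ξ, |shift (fun η => g η - k η) s ξ|) + ∫ ξ, |shift k t ξ - shift k s ξ| := by
    rw [← integral_add i1 i2]
    exact integral_add (i1.add i2) i3
  linarith

lemma IsIncoming.integral_shift {finf : Velocity → ℝ} (h : IsIncoming finf) {s : ℝ} (hs : 0 ≤ s) :
    ∫ ξ, shift finf s ξ = rhoI finf s := by
  have := integral_shift_mul finf hs (fun _ => 1)
  simp only [mul_one] at this
  rw [this, rhoI, ← integral_indicator isOpen_incoming.measurableSet]
  apply integral_congr_ae
  filter_upwards [h.ae_neg] with ξ hξ
  rcases hξ with hξ | hξ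
  · rw [indicator_of_mem (show ξ ∈ incoming from hξ), accelJac]
    ring
  · by_cases hm : ξ ∈ incoming
    · simp [indicator_of_mem hm, hξ]
    · simp [indicator_of_notMem hm, hξ]

lemma IsIncoming.shift_zero {finf : Velocity → ℝ} (h : IsIncoming finf) :
    shift finf 0 =ᵐ[volume] finf := by
  filter_upwards [h.ae_neg] with ξ hξ
  by_cases hm : ξ.1 < 0
  · rw [shift_of_mem finf ⟨hm, by nlinarith⟩, mul_zero, sub_zero, Real.sqrt_sq_eq_abs,
      abs_of_neg hm, neg_neg]
  · rw [shift_of_notMem finf fun hh => hm hh.1]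
    exact (hξ.resolve_left hm).symm

/-! ### Decreasing potentials and the associated test functions -/

/-- Strictly decreasing `C¹` potentials on the half line with boundary values `b` and `0`. -/
structure IsDecreasingPotential (b : ℝ) (φ : ℝ → ℝ) : Prop where
  contDiffOn : ContDiffOn ℝ 1 φ (Ici 0)
  dx_neg : ∀ x, 0 ≤ x → dx φ x < 0
  initial : φ 0 = b
  tendsto : Tendsto φ atTop (𝓝 0)

namespace IsDecreasingPotential

variable {b : ℝ} {φ : ℝ → ℝ}

lemma hasDerivWithinAt (h : IsDecreasingPotential b φ) {x : ℝ} (hx : 0 ≤ x) :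
    HasDerivWithinAt φ (dx φ x) (Ici 0) x :=
  (h.contDiffOn.differentiableOn (by norm_num) x hx).hasDerivWithinAt

lemma hasDerivAt (h : IsDecreasingPotential b φ) {x : ℝ} (hx : 0 < x) :
    HasDerivAt φ (dx φ x) x :=
  (h.hasDerivWithinAt hx.le).hasDerivAt (Ici_mem_nhds hx)

lemma continuousOn_dx (h : IsDecreasingPotential b φ) : ContinuousOn (dx φ) (Ici 0) :=
  h.contDiffOn.continuousOn_derivWithin (uniqueDiffOn_Ici 0) (by norm_num)

lemma strictAntiOn (h : IsDecreasingPotential b φ) : StrictAntiOn φ (Ici 0) := by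
  refine strictAntiOn_of_deriv_neg (convex_Ici 0) h.contDiffOn.continuousOn fun x hx => ?_
  rw [interior_Ici] at hx
  have hx : 0 < x := hx
  rw [(h.hasDerivAt hx).deriv]
  exact h.dx_neg x hx.le

lemma pos (h : IsDecreasingPotential b φ) {x : ℝ} (hx : 0 ≤ x) : 0 < φ x := by
  have h1 : φ (x + 1) < φ x :=
    h.strictAntiOn hx (show (0 : ℝ) ≤ x + 1 by linarith) (by linarith)
  refine lt_of_le_of_lt ?_ h1
  refine le_of_tendsto h.tendsto ?_
  filter_upwards [eventually_ge_atTop (x + 1)] with y hy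
  exact h.strictAntiOn.antitoneOn (show (0 : ℝ) ≤ x + 1 by linarith)
    (show (0 : ℝ) ≤ y by linarith) hy

lemma le_initial (h : IsDecreasingPotential b φ) {x : ℝ} (hx : 0 ≤ x) : φ x ≤ b := by
  rw [← h.initial]
  exact h.strictAntiOn.antitoneOn self_mem_Ici hx hx

lemma lt_initial (h : IsDecreasingPotential b φ) {x : ℝ} (hx : 0 < x) : φ x < b := by
  rw [← h.initial]
  exact h.strictAntiOn self_mem_Ici hx.le hx

end IsDecreasingPotential

/-- The product of a cutoff in space, a cutoff in velocity and a function of the invariants. -/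
noncomputable def invariantTest (φ a k : ℝ → ℝ) (G : Velocity → ℝ) (p : ℝ × Velocity) : ℝ :=
  a p.1 * k p.2.1 * G (p.2.1 ^ 2 / 2 - φ p.1, p.2.2)

lemma contDiffOn_invariantTest {φ a k : ℝ → ℝ} {G : Velocity → ℝ} (hφ : ContDiffOn ℝ 1 φ (Ici 0))
    (ha : ContDiff ℝ 1 a) (hk : ContDiff ℝ 1 k) (hG : ContDiff ℝ 1 G) :
    ContDiffOn ℝ 1 (invariantTest φ a k G) closedPhaseSpace := by
  have h1 : ContDiffOn ℝ 1 (fun p : ℝ × Velocity => φ p.1) closedPhaseSpace :=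
    hφ.comp contDiff_fst.contDiffOn fun p hp => hp.1
  unfold invariantTest
  refine ContDiffOn.mul ?_ ?_
  · exact ((ha.comp contDiff_fst).mul (hk.comp (contDiff_fst.comp contDiff_snd))).contDiffOn
  · refine hG.comp_contDiffOn (ContDiffOn.prodMk (ContDiffOn.sub ?_ h1) ?_)
    · exact ContDiff.contDiffOn (by fun_prop)
    · exact ContDiff.contDiffOn (by fun_prop)

/-- The transport operator annihilates functions of ξ₁²/2 − φ(x) and ξ', so only the derivatives of
the two cutoffs remain. -/
lemma transport_invariantTest {b : ℝ} {φ a k : ℝ → ℝ} {G : Velocity → ℝ}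
    (hφ : IsDecreasingPotential b φ) (ha : ContDiff ℝ 1 a) (hk : ContDiff ℝ 1 k)
    (hG : ContDiff ℝ 1 G) {p : ℝ × Velocity} (hp : 0 < p.1) :
    p.2.1 * deriv (fun y => invariantTest φ a k G (y, p.2)) p.1 +
        dx φ p.1 * deriv (fun s => invariantTest φ a k G (p.1, (s, p.2.2))) p.2.1 =
      (p.2.1 * deriv a p.1 * k p.2.1 + dx φ p.1 * a p.1 * deriv k p.2.1) *
        G (p.2.1 ^ 2 / 2 - φ p.1, p.2.2) := by
  obtain ⟨x, v, ζ⟩ := p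
  simp only at hp ⊢
  set g : ℝ → ℝ := fun e => G (e, ζ)
  have hg : ∀ e, HasDerivAt g (deriv g e) e := fun e => by
    have : Differentiable ℝ g := by
      have := hG.differentiable (by norm_num)
      fun_prop
    exact (this e).hasDerivAt
  have ha' : HasDerivAt a (deriv a x) x := (ha.differentiable (by norm_num) x).hasDerivAt
  have hk' : HasDerivAt k (deriv k v) v := (hk.differentiable (by norm_num) v).hasDerivAt
  have e1 : HasDerivAt (fun y => invariantTest φ a k G (y, (v, ζ)))
      (deriv a x * k v * g (v ^ 2 / 2 - φ x) +
        a x * k v * (deriv g (v ^ 2 / 2 - φ x) * (-dx φ x))) x := by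
    have h2 :=
      HasDerivAt.comp x (hg (v ^ 2 / 2 - φ x)) ((hφ.hasDerivAt hp).const_sub (v ^ 2 / 2))
    exact (ha'.mul_const (k v)).mul h2
  have e2 : HasDerivAt (fun s => invariantTest φ a k G (x, (s, ζ)))
      (a x * deriv k v * g (v ^ 2 / 2 - φ x) +
        a x * k v * (deriv g (v ^ 2 / 2 - φ x) * v)) v := by
    have h1 : HasDerivAt (fun s : ℝ => s ^ 2 / 2 - φ x) v v := by
      refine (((hasDerivAt_pow 2 v).div_const 2).sub_const (φ x)).congr_deriv ?_
      simp
    have h2 := HasDerivAt.comp v (hg (v ^ 2 / 2 - φ x)) h1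
    exact (hk'.const_mul (a x)).mul h2
  rw [e1.deriv, e2.deriv]
  ring

namespace IsSolution

variable {ne : ℝ → ℝ} {b : ℝ} {finf : Velocity → ℝ} {f : ℝ → Velocity → ℝ} {φ : ℝ → ℝ}

/-- If ∂ₓφ were positive, φ would stay above b > 0 and could not tend to 0. -/
lemma isDecreasingPotential (h : IsSolution ne 0 b 0 finf f φ) (hb : 0 < b) :
    IsDecreasingPotential b φ := by
  refine ⟨h.contDiffOn_one, ?_, h.potential_boundary, h.potential_tendsto⟩
  rcases h.strict_sign with hs | hs
  · exfalso
    have hmono : MonotoneOn φ (Ici 0) := by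
      refine monotoneOn_of_deriv_nonneg (convex_Ici 0) h.contDiffOn_one.continuousOn
        ((h.contDiffOn_one.differentiableOn (by norm_num)).mono interior_subset) fun x hx => ?_
      rw [interior_Ici] at hx
      have hx : 0 < x := hx
      have := (h.contDiffOn_one.differentiableOn (by norm_num) x hx.le).hasDerivWithinAt.hasDerivAt
        (Ici_mem_nhds hx)
      rw [this.deriv]
      exact (hs x hx.le).le
    have : b ≤ 0 := by
      refine ge_of_tendsto h.potential_tendsto ?_
      filter_upwards [eventually_ge_atTop 0] with x hx
      rw [← h.potential_boundary]
      exact hmono self_mem_Ici hx hx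
    linarith
  · exact hs

/-- The weak Vlasov equation tested against a function of the invariants with cutoffs. -/
lemma weak_invariantTest (h : IsSolution ne 0 b 0 finf f φ) (hb : 0 < b) {a k : ℝ → ℝ}
    {G : Velocity → ℝ} (ha : ContDiff ℝ 1 a) (hk : ContDiff ℝ 1 k) (hG : ContDiff ℝ 1 G)
    {R : ℝ} (hsupp : ∀ p ∈ closedPhaseSpace, invariantTest φ a k G p ≠ 0 → p.1 ≤ R ∧ ‖p.2‖ ≤ R)
    (hbd : ∀ ξ : Velocity, ξ.1 < 0 → invariantTest φ a k G (0, ξ) = 0) :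
    ∫ p in openPhaseSpace, f p.1 p.2 *
      ((p.2.1 * deriv a p.1 * k p.2.1 + dx φ p.1 * a p.1 * deriv k p.2.1) *
        G (p.2.1 ^ 2 / 2 - φ p.1, p.2.2)) = 0 := by
  have hφ := h.isDecreasingPotential hb
  have htest : IsTestFunction 0 (invariantTest φ a k G) := by
    refine ⟨contDiffOn_invariantTest h.contDiffOn_one ha hk hG,
      ⟨Icc 0 R ×ˢ Metric.closedBall 0 R, isCompact_Icc.prod (isCompact_closedBall _ _), ?_⟩, ?_⟩
    · intro p hp hpK
      by_contra hne
      obtain ⟨h1, h2⟩ := hsupp p hp hne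
      exact hpK ⟨⟨hp.1, h1⟩, mem_closedBall_zero_iff.2 h2⟩
    · intro ξ hξ
      rw [zero_mul, hbd _ (by simpa using hξ)]
  have := h.weak_vlasov _ htest
  simp only [Pi.zero_apply, zero_mul, integral_zero, add_zero] at this
  rw [← this]
  refine setIntegral_congr_fun ?_ fun p hp => ?_
  · exact measurableSet_Ioi.prod MeasurableSet.univ
  · simp only [transport_invariantTest hφ ha hk hG (show 0 < p.1 from hp.1)]

lemma integrableOn_mul (h : IsSolution ne 0 b 0 finf f φ) {q : ℝ × Velocity → ℝ}
    (hq : ContinuousOn q closedPhaseSpace) {R : ℝ}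
    (hsupp : ∀ p ∈ openPhaseSpace, q p ≠ 0 → p.1 ≤ R ∧ ‖p.2‖ ≤ R) :
    IntegrableOn (fun p => f p.1 p.2 * q p) openPhaseSpace := by
  set K : Set (ℝ × Velocity) := Icc 0 R ×ˢ Metric.closedBall 0 R
  have hK : IsCompact K := isCompact_Icc.prod (isCompact_closedBall _ _)
  have hKs : K ⊆ closedPhaseSpace := fun p hp => ⟨hp.1.1, trivial⟩
  have h1 : IntegrableOn (fun p => f p.1 p.2 * q p) K :=
    (h.locallyIntegrable.integrableOn_compact_subset hKs hK).mul_continuousOn (hq.mono hKs) hK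
  have hm : MeasurableSet openPhaseSpace := measurableSet_Ioi.prod MeasurableSet.univ
  refine h1.of_forall_sdiff_eq_zero hm fun p hp => ?_
  by_contra hne
  obtain ⟨h2, h3⟩ := hsupp p hp.1 (right_ne_zero_of_mul hne)
  exact hp.2 ⟨⟨le_of_lt hp.1.1, h2⟩, mem_closedBall_zero_iff.2 h3⟩

end IsSolution

/-! ### No particles on the orbits that emanate from the wall -/

/-- A `C¹` function that vanishes on `{v ≤ a}` and increases on `{v ≥ a}`. -/
noncomputable def ramp (a v : ℝ) : ℝ := ∫ t in a..v, max (t - a) 0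

lemma hasDerivAt_ramp (a v : ℝ) : HasDerivAt (ramp a) (max (v - a) 0) v :=
  ((show Continuous fun t : ℝ => max (t - a) 0 by fun_prop).integral_hasStrictDerivAt a v).hasDerivAt

lemma deriv_ramp (a : ℝ) : deriv (ramp a) = fun v => max (v - a) 0 :=
  funext fun v => (hasDerivAt_ramp a v).deriv

lemma contDiff_ramp (a : ℝ) : ContDiff ℝ 1 (ramp a) := by
  rw [contDiff_one_iff_deriv, deriv_ramp]
  exact ⟨fun v => (hasDerivAt_ramp a v).differentiableAt, by fun_prop⟩

lemma ramp_of_le {a v : ℝ} (h : v ≤ a) : ramp a v = 0 := by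
  rw [ramp, intervalIntegral.integral_congr (g := fun _ => (0 : ℝ)), intervalIntegral.integral_zero]
  intro t ht
  rw [uIcc_of_ge h] at ht
  simpa using ht.2

/-- Near an orbit of a particle leaving the wall or turning back, the energy levels stay away from
infinity in forward time and meet the wall only with outgoing velocities. -/
lemma exists_energy_window {v₀ e₀ b : ℝ} (h0 : 0 < v₀ ^ 2 / 2 - e₀) (hb : v₀ ^ 2 / 2 - e₀ < b)
    (h : 0 < v₀ ∨ e₀ < 0) :
    ∃ ε > 0, ∃ δ > 0, (∀ v e, v₀ - ε ≤ v → e ≤ e₀ + ε → δ ≤ v ^ 2 / 2 - e) ∧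
      ∀ v e, v < 0 → e₀ - ε ≤ e → v ^ 2 / 2 - e = b → v ≤ v₀ - ε := by
  rcases lt_or_ge 0 v₀ with hv | hv
  · set s := v₀ ^ 2 / 2 - e₀
    -- Passing from (v₀, e₀) to v₀ − ε and e₀ + ε lowers v²/2 − e by at most ε(v₀ + 1) ≤ s/2. The
    -- wall condition is immediate because v₀ − ε > 0.
    set ε := min (v₀ / 2) (s / (2 * (v₀ + 1)))
    have hε : 0 < ε := lt_min (by linarith) (by positivity)
    have hε1 : ε ≤ v₀ / 2 := min_le_left _ _
    have hε2 : ε * (2 * (v₀ + 1)) ≤ s := by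
      rw [← le_div_iff₀ (by positivity)]; exact min_le_right _ _
    refine ⟨ε, hε, s / 2, by linarith, fun v e h1 h2 => ?_, fun v e h1 _ _ => by linarith⟩
    have : (v₀ - ε) ^ 2 ≤ v ^ 2 := by
      apply pow_le_pow_left₀ (by linarith) h1
    have hs : s = v₀ ^ 2 / 2 - e₀ := rfl
    nlinarith
  · have he : e₀ < 0 := h.resolve_left (not_lt.2 hv)
    set d := b - (v₀ ^ 2 / 2 - e₀)
    have hd : 0 < d := by simp only [d]; linarith
    -- The second bound keeps e ≤ e₀/2 < 0. The third makes the window too narrow to cover the gap d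
    -- to the wall potential b at negative velocities above v₀ − ε.
    set ε := min (min 1 (-e₀ / 2)) (d / (2 * (-v₀ + 2)))
    have hε : 0 < ε := lt_min (lt_min one_pos (by linarith)) (div_pos hd (by linarith))
    have hε1 : ε ≤ 1 := (min_le_left _ _).trans (min_le_left _ _)
    have hε2 : ε ≤ -e₀ / 2 := (min_le_left _ _).trans (min_le_right _ _)
    have hε3 : ε * (2 * (-v₀ + 2)) ≤ d := by
      rw [← le_div_iff₀ (by linarith)]; exact min_le_right _ _
    refine ⟨ε, hε, -e₀ / 2, by linarith, fun v e _ h2 => by nlinarith [sq_nonneg v],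
      fun v e h1 h2 h3 => ?_⟩
    by_contra hlt
    push Not at hlt
    have : v ^ 2 ≤ (v₀ - ε) ^ 2 := by nlinarith
    have hd' : d = b - (v₀ ^ 2 / 2 - e₀) := rfl
    nlinarith

lemma restrict_openPhaseSpace :
    (volume : Measure (ℝ × Velocity)).restrict openPhaseSpace =
      (volume.restrict (Ioi 0)).prod volume := by
  rw [openPhaseSpace, Measure.volume_eq_prod, ← Measure.prod_restrict, Measure.restrict_univ]

lemma openPhaseSpace_subset : openPhaseSpace ⊆ closedPhaseSpace := by
  rintro p ⟨hp, -⟩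
  have hp : 0 < p.1 := hp
  exact ⟨hp.le, trivial⟩

lemma isOpen_openPhaseSpace : IsOpen openPhaseSpace := isOpen_Ioi.prod isOpen_univ

namespace IsSolution

variable {ne : ℝ → ℝ} {b : ℝ} {finf : Velocity → ℝ} {f : ℝ → Velocity → ℝ} {φ : ℝ → ℝ}

lemma aestronglyMeasurable (h : IsSolution ne 0 b 0 finf f φ) :
    AEStronglyMeasurable (fun p : ℝ × Velocity => f p.1 p.2) (volume.restrict openPhaseSpace) := by
  refine h.locallyIntegrable.aestronglyMeasurable.mono_measure
    (Measure.restrict_mono openPhaseSpace_subset le_rfl)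

/-- The sign is given separately for each x; Fubini, applied to a jointly measurable representative,
makes it an a.e. statement in phase space. -/
lemma ae_nonneg (h : IsSolution ne 0 b 0 finf f φ) :
    ∀ᵐ p ∂(volume.restrict openPhaseSpace : Measure (ℝ × Velocity)), 0 ≤ f p.1 p.2 := by
  set g := h.aestronglyMeasurable.mk
  have hg : (fun p : ℝ × Velocity => f p.1 p.2) =ᵐ[volume.restrict openPhaseSpace] g :=
    h.aestronglyMeasurable.ae_eq_mk
  have hgm : Measurable g := h.aestronglyMeasurable.stronglyMeasurable_mk.measurable
  have h1 : ∀ᵐ p ∂((volume.restrict (Ioi (0 : ℝ))).prod (volume : Measure Velocity)), 0 ≤ g p := by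
    rw [Measure.ae_prod_iff_ae_ae (measurableSet_le measurable_const hgm)]
    rw [restrict_openPhaseSpace] at hg
    filter_upwards [Measure.ae_ae_of_ae_prod hg, ae_restrict_mem measurableSet_Ioi] with x hx hx0
    filter_upwards [hx, h.nonneg x (le_of_lt hx0)] with ξ h1 h2
    rw [← h1]
    exact h2
  rw [← restrict_openPhaseSpace] at h1
  filter_upwards [hg, h1] with p h2 h3
  rw [h2]
  exact h3

/-- The test function is a ramp in ξ₁ times a bump B in the invariants. The energy window makes its
support compact and makes it vanish at the wall for ξ₁ < 0. The weak equation becomes ∫ f ∂ₓφ ramp'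
B = 0 with f ≥ 0, ramp' ≥ 0, B ≥ 0 and ∂ₓφ < 0, so f = 0 a.e. where ramp' and B are positive. -/
lemma vanish_locally (h : IsSolution ne 0 b 0 finf f φ) (hb : 0 < b) {p₀ : ℝ × Velocity}
    (hp₀ : 0 < p₀.1) (hv : 0 < p₀.2.1 ∨ p₀.2.1 ^ 2 < 2 * φ p₀.1) :
    ∃ u ∈ 𝓝 p₀, ∀ᵐ p, p ∈ u → f p.1 p.2 = 0 := by
  have hφ := h.isDecreasingPotential hb
  obtain ⟨x₀, v₀, ζ₀⟩ := p₀
  simp only at hp₀ hv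
  set e₀ := v₀ ^ 2 / 2 - φ x₀ with he₀
  have hs : v₀ ^ 2 / 2 - e₀ = φ x₀ := by rw [he₀]; ring
  obtain ⟨ε, hε, δ, hδ, hw1, hw2⟩ := exists_energy_window (v₀ := v₀) (e₀ := e₀) (b := b)
    (by rw [hs]; exact hφ.pos hp₀.le) (by rw [hs]; exact hφ.lt_initial hp₀)
    (hv.imp_right fun hh => by rw [he₀]; linarith)
  let B : ContDiffBump ((e₀, ζ₀) : Velocity) := ⟨ε / 2, ε, by linarith, by linarith⟩
  have hBsupp : ∀ q : Velocity, B q ≠ 0 → |q.1 - e₀| < ε ∧ ‖q.2 - ζ₀‖ < ε := by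
    intro q hq
    have : q ∈ Metric.ball ((e₀, ζ₀) : Velocity) ε := by
      have hh := B.support_eq
      rw [← hh]
      exact hq
    rw [mem_ball_iff_norm, Prod.norm_def, max_lt_iff] at this
    exact this
  -- On the support φ(x) = v²/2 − e ≥ δ, which fails for x ≥ X, so the support is bounded in space.
  obtain ⟨X, hX⟩ := eventually_atTop.1 (hφ.tendsto.eventually (gt_mem_nhds hδ))
  set R := max X (max (2 * (e₀ + ε + b) + 1) (‖ζ₀‖ + ε))
  have hR1 : X ≤ R := le_max_left _ _
  have hR2 : 2 * (e₀ + ε + b) + 1 ≤ R := (le_max_left _ _).trans (le_max_right _ _)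
  have hR3 : ‖ζ₀‖ + ε ≤ R := (le_max_right _ _).trans (le_max_right _ _)
  have hsuppk : ∀ p ∈ closedPhaseSpace, v₀ - ε < p.2.1 → B (p.2.1 ^ 2 / 2 - φ p.1, p.2.2) ≠ 0 →
      p.1 ≤ R ∧ ‖p.2‖ ≤ R := by
    rintro ⟨x, v, ζ⟩ hp hk hG
    obtain ⟨h1, h2⟩ := hBsupp _ hG
    simp only at h1 h2 hk ⊢
    rw [abs_lt] at h1
    have hx : 0 ≤ x := hp.1
    constructor
    · by_contra hlt
      have := hX x (hR1.trans (le_of_lt (not_le.1 hlt)))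
      have := hw1 v (v ^ 2 / 2 - φ x) hk.le (by linarith)
      linarith
    · rw [Prod.norm_def, max_le_iff]
      constructor
      · rw [Real.norm_eq_abs]
        have h3 := hφ.le_initial hx
        have h4 := sq_abs v
        nlinarith [sq_nonneg (|v| - 1)]
      · calc ‖ζ‖ = ‖ζ₀ + (ζ - ζ₀)‖ := by congr 1; abel
          _ ≤ ‖ζ₀‖ + ‖ζ - ζ₀‖ := norm_add_le _ _
          _ ≤ R := by linarith
  have hweak := h.weak_invariantTest hb (a := fun _ => 1) (k := ramp (v₀ - ε)) (G := B)
    (R := R) contDiff_const (contDiff_ramp _) B.contDiff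
    (fun p hp hne => by
      refine hsuppk p hp ?_ (right_ne_zero_of_mul hne)
      by_contra hlt
      apply right_ne_zero_of_mul (left_ne_zero_of_mul hne)
      exact ramp_of_le (not_lt.1 hlt))
    (fun ξ hξ => by
      by_contra hne
      obtain ⟨h1, -⟩ := hBsupp _ (right_ne_zero_of_mul hne)
      apply right_ne_zero_of_mul (left_ne_zero_of_mul hne)
      apply ramp_of_le
      rw [abs_lt] at h1
      refine hw2 ξ.1 (ξ.1 ^ 2 / 2 - b) hξ ?_ (by ring)
      have := h1.1
      simp only [hφ.initial] at this
      linarith)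
  simp only [deriv_const, mul_zero, zero_mul, zero_add, mul_one, deriv_ramp] at hweak
  set q : ℝ × Velocity → ℝ := fun p =>
    dx φ p.1 * max (p.2.1 - (v₀ - ε)) 0 * B (p.2.1 ^ 2 / 2 - φ p.1, p.2.2)
  have hq : ContinuousOn q closedPhaseSpace := by
    have h1 : ContinuousOn (fun p : ℝ × Velocity => dx φ p.1) closedPhaseSpace :=
      hφ.continuousOn_dx.comp continuousOn_fst fun p hp => hp.1
    have h2 : ContinuousOn (fun p : ℝ × Velocity => φ p.1) closedPhaseSpace :=
      hφ.contDiffOn.continuousOn.comp continuousOn_fst fun p hp => hp.1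
    refine (h1.mul (by fun_prop)).mul ?_
    refine B.continuous.comp_continuousOn (ContinuousOn.prodMk (ContinuousOn.sub ?_ h2) ?_)
    · fun_prop
    · fun_prop
  have hqint : IntegrableOn (fun p => f p.1 p.2 * q p) openPhaseSpace := by
    refine h.integrableOn_mul hq (R := R) fun p hp hne => ?_
    refine hsuppk p (openPhaseSpace_subset hp) ?_ (right_ne_zero_of_mul hne)
    by_contra hlt
    apply right_ne_zero_of_mul (left_ne_zero_of_mul hne)
    rw [max_eq_right]
    linarith
  have hmo : MeasurableSet openPhaseSpace := isOpen_openPhaseSpace.measurableSet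
  have hzero : ∀ᵐ p ∂(volume.restrict openPhaseSpace : Measure (ℝ × Velocity)),
      -(f p.1 p.2 * q p) = 0 := by
    refine (integral_eq_zero_iff_of_nonneg_ae ?_ hqint.neg).1 ?_
    · filter_upwards [h.ae_nonneg, ae_restrict_mem hmo] with p h1 h2
      have h3 := hφ.dx_neg p.1 (le_of_lt h2.1)
      have h4 : 0 ≤ -q p := by
        simp only [q, ← neg_mul]
        exact mul_nonneg (mul_nonneg (by linarith) (le_max_right _ _)) B.nonneg
      have h5 := mul_nonneg h1 h4
      rw [mul_neg] at h5
      exact h5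
    · rw [integral_neg', hweak, neg_zero]
  refine ⟨{p | 0 < p.1 ∧ v₀ - ε < p.2.1 ∧
    ((p.2.1 ^ 2 / 2 - φ p.1, p.2.2) : Velocity) ∈ Metric.ball ((e₀, ζ₀) : Velocity) ε}, ?_, ?_⟩
  · have hc : ContinuousAt (fun p : ℝ × Velocity => φ p.1) (x₀, v₀, ζ₀) :=
      ContinuousAt.comp (f := Prod.fst) (hφ.hasDerivAt hp₀).continuousAt continuousAt_fst
    have hc2 : ContinuousAt (fun p : ℝ × Velocity =>
        ((p.2.1 ^ 2 / 2 - φ p.1, p.2.2) : Velocity)) (x₀, v₀, ζ₀) :=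
      ContinuousAt.prodMk (ContinuousAt.sub (by fun_prop) hc) (by fun_prop)
    have e1 : ∀ᶠ p : ℝ × Velocity in 𝓝 (x₀, v₀, ζ₀), 0 < p.1 :=
      continuousAt_fst.eventually (lt_mem_nhds hp₀)
    have e2 : ∀ᶠ p : ℝ × Velocity in 𝓝 (x₀, v₀, ζ₀), v₀ - ε < p.2.1 :=
      (show ContinuousAt (fun p : ℝ × Velocity => p.2.1) (x₀, v₀, ζ₀) by fun_prop).eventually
        (lt_mem_nhds (by simp only; linarith))
    have e3 := hc2.eventually (Metric.ball_mem_nhds _ hε)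
    exact e1.and (e2.and e3)
  · filter_upwards [(ae_restrict_iff' hmo).1 hzero] with p hp hpu
    have h1 := hp ⟨hpu.1, trivial⟩
    rw [neg_eq_zero] at h1
    refine (mul_eq_zero.1 h1).resolve_right ?_
    refine mul_ne_zero (mul_ne_zero (hφ.dx_neg _ hpu.1.le).ne ?_) ?_
    · exact (lt_max_of_lt_left (sub_pos.2 hpu.2.1)).ne'
    · have hh := B.support_eq
      have : ((p.2.1 ^ 2 / 2 - φ p.1, p.2.2) : Velocity) ∈ Function.support B := by
        rw [hh]; exact hpu.2.2
      exact this

/-- There are no outgoing and no trapped particles. -/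
lemma ae_vanish (h : IsSolution ne 0 b 0 finf f φ) (hb : 0 < b) :
    ∀ᵐ x ∂(volume.restrict (Ioi (0 : ℝ))), ∀ᵐ ξ : Velocity,
      (0 < ξ.1 ∨ ξ.1 ^ 2 < 2 * φ x) → f x ξ = 0 := by
  have h1 : ∀ᵐ p : ℝ × Velocity, p ∈ openPhaseSpace →
      (0 < p.2.1 ∨ p.2.1 ^ 2 < 2 * φ p.1) → f p.1 p.2 = 0 := by
    rw [ae_iff]
    -- Each bad point has a neighborhood in which the bad set is null; second countability makes the
    -- whole bad set null.
    apply measure_null_of_locally_null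
    intro p hp
    simp only [mem_ofPred_eq, Classical.not_imp] at hp
    obtain ⟨u, hu, hzero⟩ := h.vanish_locally hb hp.1.1 hp.2.1
    refine ⟨u ∩ {p | ¬(p ∈ openPhaseSpace → (0 < p.2.1 ∨ p.2.1 ^ 2 < 2 * φ p.1) →
      f p.1 p.2 = 0)}, inter_mem (mem_nhdsWithin_of_mem_nhds hu) self_mem_nhdsWithin, ?_⟩
    refine measure_mono_null (fun p hp => ?_) hzero
    obtain ⟨hp1, hp2⟩ := hp
    simp only [mem_ofPred_eq, Classical.not_imp] at hp2
    exact fun hh => hp2.2.2 (hh hp1)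
  rw [← ae_restrict_iff' isOpen_openPhaseSpace.measurableSet, restrict_openPhaseSpace] at h1
  exact Measure.ae_ae_of_ae_prod h1

end IsSolution

/-! ### The incoming particles -/

lemma exists_Icc_of_isCompact {K : Set ℝ} (hK : IsCompact K) (hsub : K ⊆ Ioi 0) :
    ∃ r > 0, ∃ R, K ⊆ Icc r R := by
  rcases K.eq_empty_or_nonempty with rfl | hne
  · exact ⟨1, one_pos, 1, empty_subset _⟩
  · obtain ⟨r, hr, hmin⟩ := hK.exists_isMinOn hne continuousOn_id
    obtain ⟨R, -, hmax⟩ := hK.exists_isMaxOn hne continuousOn_id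
    exact ⟨r, hsub hr, R, fun x hx => ⟨hmin hx, hmax hx⟩⟩

/-- A continuous function on the half line with vanishing weak derivative is constant. -/
lemma exists_eq_const_of_weak_deriv_eq_zero {m : ℝ → ℝ} (hm : ContinuousOn m (Ioi 0))
    (hw : ∀ a : ℝ → ℝ, ContDiff ℝ 1 a → ∀ r R, 0 < r → (∀ x, a x ≠ 0 → x ∈ Icc r R) →
      ∫ x in Ioi 0, deriv a x * m x = 0) : ∃ c, ∀ x, 0 < x → m x = c := by
  have hint : ∀ k : ℝ → ℝ, Continuous k → ∀ r R, 0 < r → (∀ x, k x ≠ 0 → x ∈ Icc r R) →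
      IntegrableOn (fun x => k x * m x) (Ioi 0) := by
    intro k hk r R hr hsupp
    have h1 : IntegrableOn (fun x => k x * m x) (Icc r R) :=
      (hk.continuousOn.mul (hm.mono fun x hx => lt_of_lt_of_le hr hx.1)).integrableOn_Icc
    refine h1.of_forall_sdiff_eq_zero measurableSet_Ioi fun x hx => ?_
    by_contra hne
    exact hx.2 (hsupp x (left_ne_zero_of_mul hne))
  have key : ∀ k : ℝ → ℝ, Continuous k → ∀ r R, 0 < r → (∀ x, k x ≠ 0 → x ∈ Icc r R) →
      ∫ x, k x = 0 → ∫ x in Ioi 0, k x * m x = 0 := by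
    intro k hk r R hr hsupp hk0
    set a : ℝ → ℝ := fun x => ∫ t in r..x, k t
    have hd : ∀ x, HasDerivAt a (k x) x := fun x => (hk.integral_hasStrictDerivAt r x).hasDerivAt
    have hda : deriv a = k := funext fun x => (hd x).deriv
    have ha : ContDiff ℝ 1 a := by
      rw [contDiff_one_iff_deriv, hda]
      exact ⟨fun x => (hd x).differentiableAt, hk⟩
    have := hw a ha r R hr fun x hx => ?_
    · rwa [hda] at this
    · by_contra hmem
      apply hx
      rcases lt_or_ge x r with h1 | h1
      · simp only [a]
        rw [intervalIntegral.integral_symm, intervalIntegral.integral_of_le h1.le,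
          integral_Ioc_eq_integral_Ioo, setIntegral_eq_zero_of_forall_eq_zero, neg_zero]
        intro t ht
        by_contra hne
        exact absurd (hsupp t hne).1 (not_le.2 ht.2)
      · have h2 : R < x := by
          by_contra h2
          exact hmem ⟨h1, not_lt.1 h2⟩
        simp only [a]
        rw [intervalIntegral.integral_of_le h1, ← integral_Icc_eq_integral_Ioc,
          setIntegral_eq_integral_of_forall_compl_eq_zero, hk0]
        intro t ht
        by_contra hne
        exact ht ⟨(hsupp t hne).1, (hsupp t hne).2.trans h2.le⟩
  let B : ContDiffBump (1 : ℝ) := ⟨1 / 4, 1 / 2, by norm_num, by norm_num⟩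
  set g₀ : ℝ → ℝ := B.normed volume
  have hg₀c : Continuous g₀ := B.continuous_normed
  have hg₀s : ∀ x, g₀ x ≠ 0 → x ∈ Icc (1 / 2) (3 / 2) := by
    intro x hx
    have h1 : x ∈ Function.support g₀ := hx
    rw [B.support_normed_eq, Real.ball_eq_Ioo] at h1
    have h2 : B.rOut = 1 / 2 := rfl
    rw [h2] at h1
    constructor <;> linarith [h1.1, h1.2]
  have hg₀i : ∫ x, g₀ x = 1 := B.integral_normed
  set c := ∫ x in Ioi 0, g₀ x * m x
  refine ⟨c, ?_⟩
  have hae : ∀ᵐ x, x ∈ Ioi (0 : ℝ) → m x - c = 0 := by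
    refine isOpen_Ioi.ae_eq_zero_of_integral_contDiff_smul_eq_zero
      ((hm.sub continuousOn_const).locallyIntegrableOn measurableSet_Ioi) ?_
    intro g hg hgc hgs
    obtain ⟨r, hr, R, hrR⟩ := exists_Icc_of_isCompact hgc hgs
    have hgsupp : ∀ x, g x ≠ 0 → x ∈ Icc r R := fun x hx => hrR (subset_tsupport _ hx)
    -- Subtracting the multiple of the reference bump with the same integral makes the primitive of
    -- k compactly supported, hence admissible as a.
    set k : ℝ → ℝ := fun x => g x - (∫ y, g y) * g₀ x
    have hkc : Continuous k := hg.continuous.sub (continuous_const.mul hg₀c)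
    have hks : ∀ x, k x ≠ 0 → x ∈ Icc (min r (1 / 2)) (max R (3 / 2)) := by
      intro x hx
      by_cases h1 : g x = 0
      · have h2 : g₀ x ≠ 0 := fun h2 => hx (by simp [k, h1, h2])
        exact ⟨(min_le_right _ _).trans (hg₀s x h2).1, (hg₀s x h2).2.trans (le_max_right _ _)⟩
      · exact ⟨(min_le_left _ _).trans (hgsupp x h1).1, (hgsupp x h1).2.trans (le_max_left _ _)⟩
    have hgint : Integrable g := hg.continuous.integrable_of_hasCompactSupport hgc
    have hk0 : ∫ x, k x = 0 := by
      rw [integral_sub hgint (B.integrable_normed.const_mul _), integral_const_mul, hg₀i]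
      ring
    have h1 := key k hkc _ _ (lt_min hr (by norm_num)) hks hk0
    have i1 := hint g hg.continuous r R hr hgsupp
    have i2 := hint g₀ hg₀c (1 / 2) (3 / 2) (by norm_num) hg₀s
    have h2 : ∫ x in Ioi 0, k x * m x = (∫ x in Ioi 0, g x * m x) - (∫ y, g y) * c := by
      simp only [k, sub_mul, mul_assoc]
      rw [integral_sub i1 (i2.const_mul _), integral_const_mul]
    rw [← setIntegral_eq_integral_of_forall_compl_eq_zero (s := Ioi 0)]
    · have h3 : ∫ x in Ioi 0, g x = ∫ x, g x :=
        setIntegral_eq_integral_of_forall_compl_eq_zero fun x hx => by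
          by_contra hne
          exact hx (lt_of_lt_of_le hr (hgsupp x hne).1)
      simp only [smul_eq_mul, mul_sub]
      rw [integral_sub i1 (hgint.integrableOn.mul_const c), integral_mul_const, h3]
      linarith
    · intro x hx
      have : g x = 0 := by
        by_contra hne
        exact hx (lt_of_lt_of_le hr (hgsupp x hne).1)
      simp [this]
  have hae' : m =ᵐ[volume.restrict (Ioi 0)] fun _ => c := by
    filter_upwards [(ae_restrict_iff' measurableSet_Ioi).2 hae] with x hx
    linarith
  exact fun x hx => Measure.eqOn_open_of_ae_eq hae' isOpen_Ioi hm continuousOn_const hx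

/-- Split fH = (f − f₀)H + f₀H: the first part is controlled by L¹ convergence and the bound on H,
the second by dominated convergence. It serves both continuity in x and the limit at infinity. -/
lemma tendsto_integral_mul_of_tendsto_L1 {α : Type*} [MeasurableSpace α] {μ : Measure α}
    {l : Filter ℝ} [l.IsCountablyGenerated] {f : ℝ → α → ℝ} {f₀ : α → ℝ}
    {H : ℝ → α → ℝ} {H₀ : α → ℝ} {M : ℝ} (hf : ∀ᶠ x in l, Integrable (f x) μ)
    (hf₀ : Integrable f₀ μ) (hL : Tendsto (fun x => ∫ ξ, |f x ξ - f₀ ξ| ∂μ) l (𝓝 0))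
    (hM : ∀ᶠ x in l, ∀ ξ, |H x ξ| ≤ M) (hH : ∀ x, AEStronglyMeasurable (H x) μ)
    (hlim : ∀ ξ, Tendsto (fun x => H x ξ) l (𝓝 (H₀ ξ))) :
    Tendsto (fun x => ∫ ξ, f x ξ * H x ξ ∂μ) l (𝓝 (∫ ξ, f₀ ξ * H₀ ξ ∂μ)) := by
  have h1 : Tendsto (fun x => ∫ ξ, f₀ ξ * H x ξ ∂μ) l (𝓝 (∫ ξ, f₀ ξ * H₀ ξ ∂μ)) := by
    refine tendsto_integral_filter_of_dominated_convergence (fun ξ => |f₀ ξ| * M)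
      (Eventually.of_forall fun x => hf₀.1.mul (hH x)) ?_ (hf₀.abs.mul_const M)
      (ae_of_all _ fun ξ => (hlim ξ).const_mul _)
    filter_upwards [hM] with x hx
    refine ae_of_all _ fun ξ => ?_
    rw [norm_mul, Real.norm_eq_abs, Real.norm_eq_abs]
    exact mul_le_mul_of_nonneg_left (hx ξ) (abs_nonneg _)
  have h2 : Tendsto (fun x => ∫ ξ, (f x ξ - f₀ ξ) * H x ξ ∂μ) l (𝓝 0) := by
    have h3 := hL.mul_const M
    rw [zero_mul] at h3
    refine squeeze_zero_norm' ?_ h3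
    filter_upwards [hM, hf] with x hx hfx
    refine (norm_integral_le_integral_norm _).trans ?_
    rw [← integral_mul_const]
    refine integral_mono_of_nonneg (ae_of_all _ fun _ => norm_nonneg _)
      ((hfx.sub hf₀).abs.mul_const M) (ae_of_all _ fun ξ => ?_)
    simp only [norm_mul, Real.norm_eq_abs]
    exact mul_le_mul_of_nonneg_left (hx ξ) (abs_nonneg _)
  have h4 := h2.add h1
  rw [zero_add] at h4
  refine h4.congr' ?_
  filter_upwards [hM, hf] with x hx hfx
  have hb : ∀ᵐ ξ ∂μ, ‖H x ξ‖ ≤ M := ae_of_all _ hx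
  have hsub : Integrable (fun ξ => (f x ξ - f₀ ξ) * H x ξ) μ := (hfx.sub hf₀).mul_bdd (hH x) hb
  rw [← integral_add hsub (hf₀.mul_bdd (hH x) hb)]
  congr 1 with ξ
  ring

/-- A function of the velocity at potential `s` as a function of the energy. -/
noncomputable def energyForm (s : ℝ) (g : Velocity → ℝ) (q : Velocity) : ℝ :=
  g (-Real.sqrt (2 * (q.1 + s)), q.2)

/-- By compactness the energy ξ₁²/2 − s has a positive minimum δ on the support of g, so c = √δ
gives c²/2 < δ. Particles in this energy range move with speed above c at every nonnegative
potential. -/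
lemma exists_energyForm_bounds {s : ℝ} {g : Velocity → ℝ} (hgc : HasCompactSupport g)
    (hgs : tsupport g ⊆ accelRegion s) :
    ∃ c > 0, ∃ R, ∀ q : Velocity, energyForm s g q ≠ 0 →
      0 < q.1 + s ∧ c ^ 2 / 2 < q.1 ∧ q.1 ≤ R ∧ ‖q.2‖ ≤ R := by
  obtain ⟨R, hR⟩ := hgc.isCompact.isBounded.subset_closedBall 0
  have hpos : ∃ δ > 0, ∀ ξ ∈ tsupport g, δ ≤ ξ.1 ^ 2 / 2 - s := by
    rcases (tsupport g).eq_empty_or_nonempty with he | hne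
    · exact ⟨1, one_pos, by simp [he]⟩
    · obtain ⟨ξ₀, h0, hmin⟩ := hgc.isCompact.exists_isMinOn hne
        (f := fun ξ : Velocity => ξ.1 ^ 2 / 2 - s) (by fun_prop)
      refine ⟨_, ?_, fun ξ hξ => hmin hξ⟩
      have := (hgs h0).2
      simp only
      linarith
  obtain ⟨δ, hδ, hmin⟩ := hpos
  refine ⟨Real.sqrt δ, Real.sqrt_pos.2 hδ, max (R ^ 2 / 2 - s) R, fun q hq => ?_⟩
  have hmem : ((-Real.sqrt (2 * (q.1 + s)), q.2) : Velocity) ∈ tsupport g := subset_tsupport _ hq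
  have hneg : Real.sqrt (2 * (q.1 + s)) ≠ 0 := by
    have := (hgs hmem).1
    simp only at this
    intro h0
    rw [h0] at this
    simp at this
  have hqs : 0 < q.1 + s := by
    by_contra hle
    exact hneg (Real.sqrt_eq_zero_of_nonpos (by linarith))
  have hsq : Real.sqrt (2 * (q.1 + s)) ^ 2 = 2 * (q.1 + s) := Real.sq_sqrt (by linarith)
  have h1 := hmin _ hmem
  simp only [neg_sq, hsq] at h1
  have h2 := hR hmem
  rw [mem_closedBall_zero_iff, Prod.norm_def, max_le_iff] at h2
  refine ⟨hqs, ?_, ?_, h2.2.trans (le_max_right _ _)⟩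
  · rw [Real.sq_sqrt hδ.le]
    linarith
  · refine le_trans ?_ (le_max_left _ _)
    have h3 : Real.sqrt (2 * (q.1 + s)) ≤ R := by
      simpa [abs_of_nonneg (Real.sqrt_nonneg _)] using h2.1
    nlinarith [Real.sqrt_nonneg (2 * (q.1 + s))]

/-- For energies below c²/2 the function is zero; for the others the argument of the square root is
at least 2s > 0. -/
lemma contDiff_energyForm {s : ℝ} (hs : 0 < s) {g : Velocity → ℝ} (hg : ContDiff ℝ 1 g)
    (hgc : HasCompactSupport g) (hgs : tsupport g ⊆ accelRegion s) :
    ContDiff ℝ 1 (energyForm s g) := by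
  obtain ⟨c, hc, R, h⟩ := exists_energyForm_bounds hgc hgs
  rw [contDiff_iff_contDiffAt]
  intro q
  rcases lt_or_ge q.1 (c ^ 2 / 2) with hq | hq
  · refine (contDiffAt_const (c := (0 : ℝ))).congr_of_eventuallyEq ?_
    filter_upwards [continuousAt_fst.eventually (gt_mem_nhds hq)] with p hp
    by_contra hne
    exact absurd (h p hne).2.1 (not_lt.2 hp.le)
  · have hpos : 2 * (q.1 + s) ≠ 0 := ne_of_gt (by nlinarith [sq_nonneg c])
    refine hg.contDiffAt.comp q (ContDiffAt.prodMk ?_ contDiffAt_snd)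
    exact ((contDiffAt_const.mul (contDiffAt_fst.add contDiffAt_const)).sqrt hpos).neg

/-- A smooth cutoff that equals one on `{v ≤ -c}` and vanishes on `{v ≥ 0}`. -/
noncomputable def negCutoff (c v : ℝ) : ℝ := Real.smoothTransition (-v / c)

lemma contDiff_negCutoff (c : ℝ) : ContDiff ℝ 1 (negCutoff c) :=
  Real.smoothTransition.contDiff.comp (contDiff_id.neg.div_const c)

lemma negCutoff_of_le {c v : ℝ} (hc : 0 < c) (h : v ≤ -c) : negCutoff c v = 1 :=
  Real.smoothTransition.one_of_one_le ((one_le_div hc).2 (by linarith))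

lemma negCutoff_of_nonneg {c v : ℝ} (hc : 0 < c) (h : 0 ≤ v) : negCutoff c v = 0 :=
  Real.smoothTransition.zero_of_nonpos (div_nonpos_of_nonpos_of_nonneg (by linarith) hc.le)

lemma abs_negCutoff_le (c v : ℝ) : |negCutoff c v| ≤ 1 := by
  rw [negCutoff, abs_of_nonneg (Real.smoothTransition.nonneg _)]
  exact Real.smoothTransition.le_one _

lemma deriv_negCutoff {c v : ℝ} (hc : 0 < c) (h : c < |v|) : deriv (negCutoff c) v = 0 := by
  rcases lt_abs.1 h with h1 | h1
  · have : negCutoff c =ᶠ[𝓝 v] fun _ => 0 := by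
      filter_upwards [lt_mem_nhds (hc.trans h1)] with w hw
      exact negCutoff_of_nonneg hc hw.le
    rw [this.deriv_eq, deriv_const]
  · have : negCutoff c =ᶠ[𝓝 v] fun _ => 1 := by
      filter_upwards [gt_mem_nhds (show v < -c by linarith)] with w hw
      exact negCutoff_of_le hc hw.le
    rw [this.deriv_eq, deriv_const]

/-- The flux density of incoming particles with weight `G` at potential `s`. -/
noncomputable def fluxWeight (c : ℝ) (G : Velocity → ℝ) (s : ℝ) (ξ : Velocity) : ℝ :=
  ξ.1 * negCutoff c ξ.1 * G (ξ.1 ^ 2 / 2 - s, ξ.2)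

/-! ### Support and size of the flux weight -/

section fluxWeight

variable {c R b s : ℝ} {G : Velocity → ℝ}

lemma continuous_fluxWeight (hG : Continuous G) :
    Continuous fun p : ℝ × Velocity => fluxWeight c G p.1 p.2 := by
  unfold fluxWeight
  have := (contDiff_negCutoff c).continuous
  fun_prop

/-- On the support of G the velocity avoids [−c, c], the range where `negCutoff c` is not locally
constant; the cutoff therefore only selects the incoming branch. -/
lemma lt_abs_of_energy (hc : 0 < c)
    (hG : ∀ q : Velocity, G q ≠ 0 → c ^ 2 / 2 < q.1 ∧ q.1 ≤ R ∧ ‖q.2‖ ≤ R)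
    (hs : 0 ≤ s) {ξ : Velocity} (hξ : G (ξ.1 ^ 2 / 2 - s, ξ.2) ≠ 0) : c < |ξ.1| := by
  have h1 := (hG _ hξ).1
  simp only at h1
  rw [← abs_of_pos hc]
  exact sq_lt_sq.1 (by linarith)

lemma norm_le_of_energy
    (hG : ∀ q : Velocity, G q ≠ 0 → c ^ 2 / 2 < q.1 ∧ q.1 ≤ R ∧ ‖q.2‖ ≤ R)
    (hs : s ≤ b) {ξ : Velocity} (hξ : G (ξ.1 ^ 2 / 2 - s, ξ.2) ≠ 0) :
    ‖ξ‖ ≤ max (R + b + 1) R := by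
  obtain ⟨-, h1, h2⟩ := hG _ hξ
  simp only at h1 h2
  rw [Prod.norm_def]
  refine max_le_max ?_ h2
  rw [Real.norm_eq_abs]
  nlinarith [sq_nonneg (|ξ.1| - 1), sq_abs ξ.1]

lemma fluxWeight_eq_of_neg (hc : 0 < c)
    (hG : ∀ q : Velocity, G q ≠ 0 → c ^ 2 / 2 < q.1 ∧ q.1 ≤ R ∧ ‖q.2‖ ≤ R)
    (hs : 0 ≤ s) {ξ : Velocity} (hξ : ξ.1 < 0) :
    fluxWeight c G s ξ = ξ.1 * G (ξ.1 ^ 2 / 2 - s, ξ.2) := by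
  by_cases h : G (ξ.1 ^ 2 / 2 - s, ξ.2) = 0
  · simp [fluxWeight, h]
  · have := lt_abs_of_energy hc hG hs h
    rw [abs_of_neg hξ] at this
    rw [fluxWeight, negCutoff_of_le hc (by linarith), mul_one]

lemma fluxWeight_of_nonneg (hc : 0 < c) {ξ : Velocity} (hξ : 0 ≤ ξ.1) :
    fluxWeight c G s ξ = 0 := by
  rw [fluxWeight, negCutoff_of_nonneg hc hξ, mul_zero, zero_mul]

lemma abs_fluxWeight_le
    (hG : ∀ q : Velocity, G q ≠ 0 → c ^ 2 / 2 < q.1 ∧ q.1 ≤ R ∧ ‖q.2‖ ≤ R) {M : ℝ}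
    (hM : ∀ q, |G q| ≤ M) (hs : s ≤ b) (ξ : Velocity) :
    |fluxWeight c G s ξ| ≤ |max (R + b + 1) R| * M := by
  by_cases h : G (ξ.1 ^ 2 / 2 - s, ξ.2) = 0
  · simp only [fluxWeight, h, mul_zero, abs_zero]
    exact mul_nonneg (abs_nonneg _) ((abs_nonneg _).trans (hM 0))
  · have h1 : |ξ.1| ≤ |max (R + b + 1) R| :=
      (norm_fst_le ξ).trans ((norm_le_of_energy hG hs h).trans (le_abs_self _))
    rw [fluxWeight, abs_mul, abs_mul]
    refine mul_le_mul ?_ (hM _) (abs_nonneg _) (abs_nonneg _)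
    calc |ξ.1| * |negCutoff c ξ.1| ≤ |ξ.1| * 1 :=
          mul_le_mul_of_nonneg_left (abs_negCutoff_le _ _) (abs_nonneg _)
      _ ≤ _ := by rw [mul_one]; exact h1

end fluxWeight

namespace IsSolution

variable {ne : ℝ → ℝ} {b : ℝ} {finf : Velocity → ℝ} {f : ℝ → Velocity → ℝ} {φ : ℝ → ℝ}

/-- The flux of incoming particles in each energy range is the same at all points. -/
lemma integral_fluxWeight (h : IsSolution ne 0 b 0 finf f φ) (hb : 0 < b) (hfinf : Integrable finf)
    {c R M : ℝ} {G : Velocity → ℝ} (hc : 0 < c) (hGd : ContDiff ℝ 1 G)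
    (hG : ∀ q : Velocity, G q ≠ 0 → c ^ 2 / 2 < q.1 ∧ q.1 ≤ R ∧ ‖q.2‖ ≤ R)
    (hM : ∀ q, |G q| ≤ M) {x : ℝ} (hx : 0 < x) :
    ∫ ξ, f x ξ * fluxWeight c G (φ x) ξ = ∫ ξ, finf ξ * fluxWeight c G 0 ξ := by
  have hφ := h.isDecreasingPotential hb
  have hcw := continuous_fluxWeight (c := c) hGd.continuous
  have hcξ : ∀ s, Continuous (fluxWeight c G s) := fun s =>
    hcw.comp (f := fun ξ : Velocity => (s, ξ)) (by fun_prop)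
  have hcs : ∀ ξ, Continuous fun s => fluxWeight c G s ξ := fun ξ =>
    hcw.comp (f := fun s : ℝ => (s, ξ)) (by fun_prop)
  set m : ℝ → ℝ := fun x => ∫ ξ, f x ξ * fluxWeight c G (φ x) ξ
  have hm : ContinuousOn m (Ioi 0) := by
    intro y hy
    have hy : 0 < y := hy
    apply ContinuousAt.continuousWithinAt
    have hev : ∀ᶠ z in 𝓝 y, 0 < z := lt_mem_nhds hy
    have hL := h.continuous_L1 y hy.le
    rw [nhdsWithin_eq_nhds.2 (Ici_mem_nhds hy)] at hL
    refine tendsto_integral_mul_of_tendsto_L1 (H := fun x => fluxWeight c G (φ x))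
      (H₀ := fluxWeight c G (φ y))
      (hev.mono fun z hz => h.integrable z hz.le) (h.integrable y hy.le) hL
      (hev.mono fun z hz => abs_fluxWeight_le hG hM (hφ.le_initial hz.le))
      (fun z => (hcξ _).aestronglyMeasurable)
      (fun ξ => ((hcs ξ).tendsto _).comp (hφ.hasDerivAt hy).continuousAt)
  have hlim : Tendsto m atTop (𝓝 (∫ ξ, finf ξ * fluxWeight c G 0 ξ)) := by
    have hev : ∀ᶠ z : ℝ in atTop, 0 < z := eventually_gt_atTop 0
    exact tendsto_integral_mul_of_tendsto_L1 (H := fun x => fluxWeight c G (φ x))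
      (H₀ := fluxWeight c G 0)
      (hev.mono fun z hz => h.integrable z hz.le) hfinf h.tendsto_L1
      (hev.mono fun z hz => abs_fluxWeight_le hG hM (hφ.le_initial hz.le))
      (fun z => (hcξ _).aestronglyMeasurable)
      (fun ξ => ((hcs ξ).tendsto _).comp hφ.tendsto)
  -- The flux m converges at infinity to the flux of `finf`, so its constancy suffices.
  suffices hconst : ∃ C, ∀ y, 0 < y → m y = C by
    obtain ⟨C, hC⟩ := hconst
    have h1 : Tendsto m atTop (𝓝 C) :=
      tendsto_const_nhds.congr' ((eventually_gt_atTop 0).mono fun z hz => (hC z hz).symm)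
    change m x = _
    rw [hC x hx]
    exact tendsto_nhds_unique h1 hlim
  refine exists_eq_const_of_weak_deriv_eq_zero hm fun a ha r R' hr hsupp => ?_
  have hφc : ContinuousOn (fun p : ℝ × Velocity => φ p.1) closedPhaseSpace :=
    hφ.contDiffOn.continuousOn.comp continuousOn_fst fun p hp => hp.1
  have hbound : ∀ p ∈ closedPhaseSpace, p.1 ≤ R' → G (p.2.1 ^ 2 / 2 - φ p.1, p.2.2) ≠ 0 →
      p.1 ≤ max R' (max (R + b + 1) R) ∧ ‖p.2‖ ≤ max R' (max (R + b + 1) R) :=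
    fun p hp h1 h2 => ⟨h1.trans (le_max_left _ _),
      (norm_le_of_energy hG (hφ.le_initial hp.1) h2).trans (le_max_right _ _)⟩
  have hweak := h.weak_invariantTest hb ha (contDiff_negCutoff c) hGd
    (R := max R' (max (R + b + 1) R))
    (fun p hp hne => hbound p hp
      (hsupp _ (left_ne_zero_of_mul (left_ne_zero_of_mul hne))).2 (right_ne_zero_of_mul hne))
    (fun ξ _ => by
      by_contra hne
      have := (hsupp _ (left_ne_zero_of_mul (left_ne_zero_of_mul hne))).1
      linarith)
  have hda : ∀ y, deriv a y ≠ 0 → y ≤ R' := by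
    intro y hy
    by_contra hlt
    apply hy
    have : a =ᶠ[𝓝 y] fun _ => 0 := by
      filter_upwards [lt_mem_nhds (not_le.1 hlt)] with w hw
      by_contra hne
      exact absurd (hsupp w hne).2 (not_le.2 hw)
    rw [this.deriv_eq, deriv_const]
  -- The derivative of the velocity cutoff vanishes wherever G does not, so only the term with a'
  -- survives.
  have hrw : ∀ p ∈ openPhaseSpace, f p.1 p.2 *
      ((p.2.1 * deriv a p.1 * negCutoff c p.2.1 + dx φ p.1 * a p.1 * deriv (negCutoff c) p.2.1) *
        G (p.2.1 ^ 2 / 2 - φ p.1, p.2.2)) =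
      f p.1 p.2 * (deriv a p.1 * fluxWeight c G (φ p.1) p.2) := by
    intro p hp
    by_cases hz : G (p.2.1 ^ 2 / 2 - φ p.1, p.2.2) = 0
    · simp [fluxWeight, hz]
    · have h0 : 0 ≤ p.1 := (openPhaseSpace_subset hp).1
      rw [deriv_negCutoff hc (lt_abs_of_energy hc hG (hφ.pos h0).le hz), fluxWeight]
      ring
  have hint : IntegrableOn (fun p : ℝ × Velocity =>
      f p.1 p.2 * (deriv a p.1 * fluxWeight c G (φ p.1) p.2)) openPhaseSpace := by
    refine h.integrableOn_mul (R := max R' (max (R + b + 1) R)) ?_ fun p hp hne => ?_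
    · have h1 : Continuous (deriv a) := ha.continuous_deriv (by norm_num)
      refine ContinuousOn.mul (h1.comp continuous_fst).continuousOn ?_
      exact hcw.comp_continuousOn (hφc.prodMk continuousOn_snd)
    · exact hbound p (openPhaseSpace_subset hp) (hda _ (left_ne_zero_of_mul hne))
        (right_ne_zero_of_mul (right_ne_zero_of_mul hne))
  rw [setIntegral_congr_fun isOpen_openPhaseSpace.measurableSet hrw] at hweak
  rw [IntegrableOn, restrict_openPhaseSpace] at hint
  rw [restrict_openPhaseSpace, integral_prod _ hint] at hweak
  refine Eq.trans ?_ hweak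
  congr 1 with y
  rw [← integral_const_mul]
  congr 1 with ξ
  ring

/-- Any test function g of velocity supported in the region is a function of the invariants. Flux
conservation equates ∫ f ξ₁ g with a far-field flux, which the change of variables rewrites as the
same integral for the transported density. The weight ξ₁ drops out because it is nonzero there. -/
lemma ae_eq_shift_on_accelRegion (h : IsSolution ne 0 b 0 finf f φ) (hb : 0 < b)
    (hfinf : Integrable finf) {x : ℝ} (hx : 0 < x) :
    ∀ᵐ ξ, ξ ∈ accelRegion (φ x) → f x ξ = shift finf (φ x) ξ := by
  have hφ := h.isDecreasingPotential hb
  have hs := hφ.pos hx.le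
  set s := φ x
  have hfx := h.integrable x hx.le
  have hsx := integrable_shift hfinf hs.le
  have key : ∀ᵐ ξ, ξ ∈ accelRegion s → (f x ξ - shift finf s ξ) * ξ.1 = 0 := by
    refine (isOpen_accelRegion s).ae_eq_zero_of_integral_contDiff_smul_eq_zero ?_ ?_
    · have h1 : LocallyIntegrable (fun ξ => f x ξ - shift finf s ξ) :=
        (hfx.sub hsx).locallyIntegrable
      exact (h1.locallyIntegrableOn _).mul_continuousOn (by fun_prop)
        (isOpen_accelRegion s).isLocallyClosed
    intro g hg hgc hgs
    obtain ⟨c, hc, R, hG⟩ := exists_energyForm_bounds hgc hgs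
    have hG' : ∀ q : Velocity, energyForm s g q ≠ 0 → c ^ 2 / 2 < q.1 ∧ q.1 ≤ R ∧ ‖q.2‖ ≤ R :=
      fun q hq => (hG q hq).2
    obtain ⟨M, hM⟩ := hg.continuous.bounded_above_of_compact_support hgc
    have hflux := h.integral_fluxWeight hb hfinf hc
      (contDiff_energyForm hs (hg.of_le (by exact_mod_cast le_top)) hgc hgs) hG'
      (M := M) (fun q => hM _) hx
    have hgout : ∀ ξ : Velocity, 0 ≤ ξ.1 → g ξ = 0 := fun ξ hξ => by
      by_contra hne
      exact absurd (hgs (subset_tsupport _ hne)).1 (not_lt.2 hξ)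
    have e1 : ∀ ξ, fluxWeight c (energyForm s g) s ξ = ξ.1 * g ξ := by
      intro ξ
      rcases lt_or_ge ξ.1 0 with hξ | hξ
      · rw [fluxWeight_eq_of_neg hc hG' hs.le hξ, energyForm]
        have : 2 * (ξ.1 ^ 2 / 2 - s + s) = ξ.1 ^ 2 := by ring
        simp only [this, Real.sqrt_sq_eq_abs, abs_of_neg hξ, neg_neg]
      · rw [fluxWeight_of_nonneg hc hξ, hgout ξ hξ, mul_zero]
    have e2 : ∫ ξ, finf ξ * fluxWeight c (energyForm s g) 0 ξ =
        ∫ ξ, shift finf s ξ * (ξ.1 * g ξ) := by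
      rw [integral_shift_mul finf hs.le,
        ← setIntegral_eq_integral_of_forall_compl_eq_zero (s := incoming)]
      · refine setIntegral_congr_fun isOpen_incoming.measurableSet fun η hη => ?_
        have hη' : η.1 < 0 := hη
        rw [fluxWeight_eq_of_neg hc hG' le_rfl hη', energyForm, accelJac, accel]
        have e3 : 2 * (η.1 ^ 2 / 2 - 0 + s) = η.1 ^ 2 + 2 * s := by ring
        have e4 : Real.sqrt (η.1 ^ 2 + 2 * s) ≠ 0 := (Real.sqrt_pos.2 (by positivity)).ne'
        simp only [e3]
        field_simp
      · intro η hη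
        rw [fluxWeight_of_nonneg hc (not_lt.1 hη), mul_zero]
    simp only [e1, s] at hflux
    rw [e2] at hflux
    have hcg : Continuous fun ξ : Velocity => ξ.1 * g ξ := continuous_fst.mul hg.continuous
    have hcgc : HasCompactSupport fun ξ : Velocity => ξ.1 * g ξ := hgc.mul_left
    obtain ⟨N, hN⟩ := hcg.bounded_above_of_compact_support hcgc
    have i1 := hfx.mul_bdd hcg.aestronglyMeasurable (ae_of_all _ hN)
    have i2 := hsx.mul_bdd hcg.aestronglyMeasurable (ae_of_all _ hN)
    have e5 : ∀ ξ, g ξ • ((f x ξ - shift finf s ξ) * ξ.1) =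
        f x ξ * (ξ.1 * g ξ) - shift finf s ξ * (ξ.1 * g ξ) := fun ξ => by
      rw [smul_eq_mul]; ring
    simp only [e5]
    rw [integral_sub i1 i2, hflux, sub_self]
  filter_upwards [key] with ξ hξ hmem
  exact sub_eq_zero.1 ((mul_eq_zero.1 (hξ hmem)).resolve_right hmem.1.ne)

/-- A solution is the transport of its far field along the energy levels. -/
theorem ae_eq_shift (h : IsSolution ne 0 b 0 finf f φ) (hb : 0 < b) (hfinf : Integrable finf)
    {x : ℝ} (hx : 0 ≤ x) : f x =ᵐ[volume] shift finf (φ x) := by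
  have hφ := h.isDecreasingPotential hb
  have hgood : ∀ᵐ y ∂(volume.restrict (Ioi (0 : ℝ))), f y =ᵐ[volume] shift finf (φ y) := by
    filter_upwards [h.ae_vanish hb, ae_restrict_mem measurableSet_Ioi] with y h1 h2
    filter_upwards [h1, h.ae_eq_shift_on_accelRegion hb hfinf h2, ae_fst_ne 0,
      ae_fst_ne (-Real.sqrt (2 * φ y))] with ξ h3 h4 h5 h6
    by_cases hmem : ξ ∈ accelRegion (φ y)
    · exact h4 hmem
    · rw [shift_of_notMem finf hmem]
      apply h3
      by_contra hcon
      push Not at hcon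
      have hlt : ξ.1 < 0 := lt_of_le_of_ne hcon.1 h5
      apply hmem
      refine ⟨hlt, lt_of_le_of_ne hcon.2 fun heq => h6 ?_⟩
      rw [heq, Real.sqrt_sq_eq_abs, abs_of_neg hlt, neg_neg]
  have hfx := h.integrable x hx
  have hsx := integrable_shift hfinf (hφ.pos hx).le
  -- The identity is so far known for almost every position only. Both sides are L¹-continuous in
  -- the position, so it extends to every x ≥ 0 through nearby good points y > x.
  have hlim : Tendsto (fun y => (∫ ξ, |f y ξ - f x ξ|) +
      ∫ ξ, |shift finf (φ y) ξ - shift finf (φ x) ξ|) (𝓝[Ici 0] x) (𝓝 0) := by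
    have h1 : Tendsto φ (𝓝[Ici 0] x) (𝓝[Ici 0] (φ x)) :=
      tendsto_nhdsWithin_iff.2 ⟨hφ.contDiffOn.continuousOn x hx, by
        filter_upwards [self_mem_nhdsWithin] with y hy using (hφ.pos hy).le⟩
    simpa using (h.continuous_L1 x hx).add
      ((tendsto_integral_abs_shift_sub hfinf (hφ.pos hx).le).comp h1)
  have hzero : ∫ ξ, |f x ξ - shift finf (φ x) ξ| ≤ 0 := by
    refine le_of_forall_pos_lt_add fun ε hε => ?_
    rw [zero_add]
    have hlim' := hlim.mono_left (nhdsWithin_mono x (Ioi_subset_Ici hx : Ioi x ⊆ Ici 0))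
    obtain ⟨ε', hε', hsub⟩ := mem_nhdsGT_iff_exists_Ioo_subset.1
      (hlim'.eventually (gt_mem_nhds hε))
    have hε' : x < ε' := hε'
    have hex : ∃ y ∈ Ioo x ε', f y =ᵐ[volume] shift finf (φ y) := by
      by_contra hcon
      push Not at hcon
      have h1 : volume.restrict (Ioi (0 : ℝ)) (Ioo x ε') = 0 :=
        measure_mono_null (fun y hy => hcon y hy) hgood
      have h2 : Ioo x ε' ⊆ Ioi 0 := fun y hy => lt_of_le_of_lt hx hy.1
      rw [Measure.restrict_apply measurableSet_Ioo, inter_eq_left.2 h2, Real.volume_Ioo, ENNReal.ofReal_eq_zero] at h1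
      linarith
    obtain ⟨y, hy, hyeq⟩ := hex
    have hy0 : 0 ≤ y := hx.trans hy.1.le
    refine lt_of_le_of_lt ?_ (hsub hy)
    have i1 := ((h.integrable y hy0).sub hfx).abs
    have i2 := ((integrable_shift hfinf (hφ.pos hy0).le).sub hsx).abs
    have i1' : Integrable (fun ξ => |f y ξ - f x ξ|) := i1
    have i2' : Integrable (fun ξ => |shift finf (φ y) ξ - shift finf (φ x) ξ|) := i2
    rw [← integral_add i1' i2']
    refine integral_mono_ae (hfx.sub hsx).abs (i1'.add i2') ?_
    filter_upwards [hyeq] with ξ hξ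
    rw [← hξ, abs_sub_comm (f y ξ) (f x ξ)]
    exact abs_sub_le _ _ _
  have h0 := le_antisymm hzero (integral_nonneg fun _ => abs_nonneg _)
  have h1 := (integral_eq_zero_iff_of_nonneg (fun _ => abs_nonneg _) (hfx.sub hsx).abs).1 h0
  filter_upwards [h1] with ξ hξ
  exact sub_eq_zero.1 (abs_eq_zero.1 hξ)

end IsSolution

/-! ### The transported density solves the Vlasov equation -/

lemma uniqueDiffOn_closedPhaseSpace : UniqueDiffOn ℝ closedPhaseSpace :=
  (uniqueDiffOn_Ici 0).prod uniqueDiffOn_univ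

lemma isClosed_closedPhaseSpace : IsClosed closedPhaseSpace := isClosed_Ici.prod isClosed_univ

/-- The derivative of `ψ` along the characteristics. -/
noncomputable def transportDeriv (φ : ℝ → ℝ) (ψ : ℝ × Velocity → ℝ) (p : ℝ × Velocity) : ℝ :=
  fderivWithin ℝ ψ closedPhaseSpace p (p.2.1, (dx φ p.1, 0))

section transportDeriv

variable {φ : ℝ → ℝ} {ψ : ℝ × Velocity → ℝ}

lemma hasFDerivAt_of_mem_openPhaseSpace (hψ : ContDiffOn ℝ 1 ψ closedPhaseSpace)
    {p : ℝ × Velocity} (hp : p ∈ openPhaseSpace) :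
    HasFDerivAt ψ (fderivWithin ℝ ψ closedPhaseSpace p) p :=
  ((hψ.differentiableOn (by norm_num)) p (openPhaseSpace_subset hp)).hasFDerivWithinAt.hasFDerivAt
    (mem_of_superset (isOpen_openPhaseSpace.mem_nhds hp) openPhaseSpace_subset)

lemma transportDeriv_eq (hψ : ContDiffOn ℝ 1 ψ closedPhaseSpace) {p : ℝ × Velocity}
    (hp : p ∈ openPhaseSpace) :
    p.2.1 * deriv (fun y => ψ (y, p.2)) p.1 +
        dx φ p.1 * deriv (fun s => ψ (p.1, (s, p.2.2))) p.2.1 = transportDeriv φ ψ p := by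
  obtain ⟨x, v, ζ⟩ := p
  have hd := hasFDerivAt_of_mem_openPhaseSpace hψ hp
  rw [transportDeriv]
  set L := fderivWithin ℝ ψ closedPhaseSpace (x, v, ζ)
  have h1 : HasDerivAt (fun y : ℝ => ((y, v, ζ) : ℝ × Velocity)) (1, 0) x :=
    (hasDerivAt_id x).prodMk (hasDerivAt_const x _)
  have h2 : HasDerivAt (fun s : ℝ => ((x, s, ζ) : ℝ × Velocity)) (0, (1, 0)) v :=
    (hasDerivAt_const v _).prodMk ((hasDerivAt_id v).prodMk (hasDerivAt_const v _))
  have e1 := (hd.comp_hasDerivAt x h1).deriv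
  have e2 := (HasFDerivAt.comp_hasDerivAt v (f := fun s : ℝ => ((x, s, ζ) : ℝ × Velocity))
    hd h2).deriv
  simp only [Function.comp_def] at e1 e2
  simp only [e1, e2]
  rw [← smul_eq_mul, ← smul_eq_mul, ← map_smul, ← map_smul, ← map_add]
  congr 1
  ext <;> simp

lemma continuousOn_transportDeriv (hφ : ContinuousOn (dx φ) (Ici 0))
    (hψ : ContDiffOn ℝ 1 ψ closedPhaseSpace) :
    ContinuousOn (transportDeriv φ ψ) closedPhaseSpace := by
  have h1 := hψ.continuousOn_fderivWithin uniqueDiffOn_closedPhaseSpace (by norm_num)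
  have h2 : ContinuousOn (fun p : ℝ × Velocity => dx φ p.1) closedPhaseSpace :=
    hφ.comp continuousOn_fst fun p hp => hp.1
  refine h1.clm_apply (ContinuousOn.prodMk (by fun_prop) (h2.prodMk continuousOn_const))

lemma exists_transportDeriv_bound (hφ : ContinuousOn (dx φ) (Ici 0))
    (hψ : IsTestFunction 0 ψ) : ∃ R > 0, ∃ M, ∀ p ∈ closedPhaseSpace,
      |transportDeriv φ ψ p| ≤ M ∧ (R < p.1 → ψ p = 0 ∧ transportDeriv φ ψ p = 0) := by
  obtain ⟨K, hK, hKz⟩ := hψ.compactSupport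
  obtain ⟨R, hR⟩ := hK.isBounded.subset_closedBall 0
  obtain ⟨M, hM⟩ := (hK.inter_right isClosed_closedPhaseSpace).exists_bound_of_continuousOn
    ((continuousOn_transportDeriv hφ hψ.contDiffOn).mono inter_subset_right)
  have hz : ∀ p ∈ closedPhaseSpace, p ∉ K → transportDeriv φ ψ p = 0 := by
    intro p hp hpK
    have h1 : ψ =ᶠ[𝓝[closedPhaseSpace] p] fun _ => 0 := by
      filter_upwards [self_mem_nhdsWithin,
        mem_nhdsWithin_of_mem_nhds (hK.isClosed.isOpen_compl.mem_nhds hpK)] with q h2 h3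
      exact hKz q h2 h3
    rw [transportDeriv, h1.fderivWithin_eq (hKz p hp hpK), fderivWithin_const_apply]
    rfl
  refine ⟨max R 1, by positivity, max M 0, fun p hp => ⟨?_, fun hRp => ?_⟩⟩
  · by_cases hpK : p ∈ K
    · exact (hM p ⟨hpK, hp⟩).trans (le_max_left _ _)
    · rw [hz p hp hpK, abs_zero]
      exact le_max_right _ _
  · have hpK : p ∉ K := fun hpK => by
      have h1 := hR hpK
      rw [mem_closedBall_zero_iff] at h1
      have h2 := (le_abs_self p.1).trans ((norm_fst_le p).trans h1)
      exact absurd (h2.trans (le_max_left _ _)) (not_le.2 hRp)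
    exact ⟨hKz p hp hpK, hz p hp hpK⟩

end transportDeriv

lemma continuous_accel : Continuous fun p : ℝ × Velocity => accel p.1 p.2 := by
  unfold accel
  fun_prop

lemma measurable_shift_uncurry {g : Velocity → ℝ} (hg : Measurable g) :
    Measurable fun p : ℝ × Velocity => shift g p.1 p.2 := by
  unfold shift
  have := measurable_chi
  fun_prop

/-- By Tonelli, since the L¹ norm at each x is at most that of g, uniformly in x. -/
lemma integrableOn_shift_slab {g : Velocity → ℝ} (hgm : Measurable g) (hg : Integrable g)
    {φ : ℝ → ℝ} (hφ : Measurable φ) (hφ0 : ∀ x, 0 ≤ φ x) {I : Set ℝ} (hI : volume I ≠ ⊤) :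
    IntegrableOn (fun p : ℝ × Velocity => shift g (φ p.1) p.2) (I ×ˢ univ) := by
  have hm : Measurable fun p : ℝ × Velocity => shift g (φ p.1) p.2 :=
    (measurable_shift_uncurry hgm).comp ((hφ.comp measurable_fst).prodMk measurable_snd)
  refine ⟨hm.aestronglyMeasurable, ?_⟩
  rw [HasFiniteIntegral, Measure.volume_eq_prod, ← Measure.prod_restrict, Measure.restrict_univ,
    lintegral_prod _ hm.enorm.aemeasurable]
  calc ∫⁻ x in I, ∫⁻ ξ, ‖shift g (φ x) ξ‖ₑ ≤ ∫⁻ _ in I, ∫⁻ ξ, ‖g ξ‖ₑ :=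
        lintegral_mono fun x => lintegral_enorm_shift_le g (hφ0 x)
    _ < ⊤ := by
      rw [lintegral_const, Measure.restrict_apply_univ]
      exact ENNReal.mul_lt_top hg.2 hI.lt_top

lemma locallyIntegrable_shift {g : Velocity → ℝ} (hgm : Measurable g) (hg : Integrable g)
    {φ : ℝ → ℝ} (hφ : Measurable φ) (hφ0 : ∀ x, 0 ≤ φ x) :
    LocallyIntegrable (fun p : ℝ × Velocity => shift g (φ p.1) p.2) := by
  intro p
  refine ⟨Ioo (p.1 - 1) (p.1 + 1) ×ˢ univ, ?_,
    integrableOn_shift_slab hgm hg hφ hφ0 measure_Ioo_lt_top.ne⟩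
  refine (isOpen_Ioo.prod isOpen_univ).mem_nhds ⟨⟨?_, ?_⟩, trivial⟩ <;> linarith

/-- Along a characteristic, the transport derivative is the velocity times the derivative of the
test function in space. -/
lemma hasDerivAt_along_characteristic {b : ℝ} {φ : ℝ → ℝ} {ψ : ℝ × Velocity → ℝ}
    (hφ : IsDecreasingPotential b φ) (hψ : ContDiffOn ℝ 1 ψ closedPhaseSpace) (η : Velocity)
    {x : ℝ} (hx : 0 < x) :
    HasDerivAt (fun y => ψ (y, accel (φ y) η))
      (-(Real.sqrt (η.1 ^ 2 + 2 * φ x))⁻¹ * transportDeriv φ ψ (x, accel (φ x) η)) x := by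
  have hS : 0 < η.1 ^ 2 + 2 * φ x := by have := hφ.pos hx.le; positivity
  have hd := hasFDerivAt_of_mem_openPhaseSpace hψ (p := (x, accel (φ x) η)) ⟨hx, trivial⟩
  have h1 : HasDerivAt (fun y => -Real.sqrt (η.1 ^ 2 + 2 * φ y))
      (-(dx φ x / Real.sqrt (η.1 ^ 2 + 2 * φ x))) x := by
    have h2 := ((((hφ.hasDerivAt hx).const_mul 2).const_add (η.1 ^ 2)).sqrt hS.ne').fun_neg
    refine h2.congr_deriv ?_
    rw [mul_div_mul_left _ _ two_ne_zero]
  have h3 : HasDerivAt (fun y => ((y, accel (φ y) η) : ℝ × Velocity))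
      (1, (-(dx φ x / Real.sqrt (η.1 ^ 2 + 2 * φ x)), 0)) x :=
    (hasDerivAt_id x).prodMk (h1.prodMk (hasDerivAt_const x _))
  have h4 := HasFDerivAt.comp_hasDerivAt x
    (f := fun y => ((y, accel (φ y) η) : ℝ × Velocity)) hd h3
  refine h4.congr_deriv ?_
  rw [transportDeriv, ← smul_eq_mul (-(Real.sqrt (η.1 ^ 2 + 2 * φ x))⁻¹), ← map_smul]
  congr 1
  have hne := (Real.sqrt_pos.2 hS).ne'
  ext
  · simp only [accel, Prod.smul_fst, smul_eq_mul]
    field_simp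
  · simp only [Prod.smul_fst, Prod.smul_snd, smul_eq_mul]
    field_simp
  all_goals simp

/-- The integrand is the x-derivative of ψ along the orbit. The end values vanish: at infinity by
compact support, at the wall because the orbit arrives there with ξ₁ < 0. -/
lemma integral_deriv_along_characteristic {b : ℝ} {φ : ℝ → ℝ} {ψ : ℝ × Velocity → ℝ}
    (hφ : IsDecreasingPotential b φ) (hψ : IsTestFunction 0 ψ) {η : Velocity} (hη : η ∈ incoming) :
    ∫ x in Ioi 0, -(Real.sqrt (η.1 ^ 2 + 2 * φ x))⁻¹ *
      transportDeriv φ ψ (x, accel (φ x) η) = 0 := by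
  obtain ⟨R, hR, M, hM⟩ := exists_transportDeriv_bound hφ.continuousOn_dx hψ
  have hb : 0 < b := hφ.initial ▸ hφ.pos le_rfl
  have hφc := hφ.contDiffOn.continuousOn
  have hmaps : ContinuousOn (fun y => ((y, accel (φ y) η) : ℝ × Velocity)) (Ici 0) :=
    continuousOn_id.prodMk (continuous_accel.comp_continuousOn (hφc.prodMk continuousOn_const))
  have hmem : MapsTo (fun y => ((y, accel (φ y) η) : ℝ × Velocity)) (Ici 0) closedPhaseSpace :=
    fun y hy => ⟨hy, trivial⟩
  have hcont : ContinuousOn (fun x => -(Real.sqrt (η.1 ^ 2 + 2 * φ x))⁻¹ *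
      transportDeriv φ ψ (x, accel (φ x) η)) (Ici 0) := by
    refine ContinuousOn.mul (ContinuousOn.neg (ContinuousOn.inv₀ ?_ fun x hx => ?_)) ?_
    · exact Real.continuous_sqrt.comp_continuousOn
        (continuousOn_const.add (continuousOn_const.mul hφc))
    · have := hφ.pos hx
      exact (Real.sqrt_pos.2 (by positivity)).ne'
    · exact (continuousOn_transportDeriv hφ.continuousOn_dx hψ.contDiffOn).comp hmaps hmem
  have hint : IntegrableOn (fun x => -(Real.sqrt (η.1 ^ 2 + 2 * φ x))⁻¹ *
      transportDeriv φ ψ (x, accel (φ x) η)) (Ioi 0) := by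
    refine ((hcont.mono Icc_subset_Ici_self).integrableOn_Icc (b := R)).of_forall_sdiff_eq_zero
      measurableSet_Ioi fun x hx => ?_
    have hx0 : 0 < x := hx.1
    have hxR : R < x := by
      by_contra hle
      exact hx.2 ⟨hx0.le, not_lt.1 hle⟩
    rw [((hM (x, accel (φ x) η) (hmem hx0.le)).2 hxR).2, mul_zero]
  have hlim : Tendsto (fun y => ψ (y, accel (φ y) η)) atTop (𝓝 0) := by
    refine tendsto_const_nhds.congr' ?_
    filter_upwards [eventually_gt_atTop R] with y hy
    exact ((hM (y, accel (φ y) η) (hmem (hR.trans hy).le)).2 hy).1.symm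
  rw [integral_Ioi_of_hasDerivAt_of_tendsto
    ((hψ.contDiffOn.continuousOn.comp hmaps hmem) 0 self_mem_Ici)
    (fun x hx => hasDerivAt_along_characteristic hφ hψ.contDiffOn η hx) hint hlim]
  have h0 := (accel_mem (hφ.pos le_rfl).le hη).1
  -- The boundary condition is stated at positive velocities, so it is used at the reflected
  -- velocity.
  have := hψ.boundary (-(accel (φ 0) η).1, (accel (φ 0) η).2) (by simpa using h0)
  simp only [zero_mul, neg_neg, Prod.mk.eta] at this
  simp only [← this, sub_zero, Function.comp_apply]

/-- The weak Vlasov equation for the transported density. -/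
theorem weak_vlasov_shift {b : ℝ} {φ : ℝ → ℝ} (hφ : IsDecreasingPotential b φ)
    (hφm : Measurable φ) (hφ0 : ∀ x, 0 ≤ φ x) {g : Velocity → ℝ} (hgm : Measurable g)
    (hg : Integrable g) {ψ : ℝ × Velocity → ℝ} (hψ : IsTestFunction 0 ψ) :
    ∫ p in openPhaseSpace, shift g (φ p.1) p.2 * transportDeriv φ ψ p = 0 := by
  obtain ⟨R, hR, M, hM⟩ := exists_transportDeriv_bound hφ.continuousOn_dx hψ
  have hmo : MeasurableSet openPhaseSpace := isOpen_openPhaseSpace.measurableSet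
  have htc := continuousOn_transportDeriv hφ.continuousOn_dx hψ.contDiffOn
  have hM0 : 0 ≤ M := (abs_nonneg _).trans (hM (0, 0) ⟨self_mem_Ici, trivial⟩).1
  have hint : IntegrableOn (fun p => shift g (φ p.1) p.2 * transportDeriv φ ψ p)
      openPhaseSpace := by
    set S : Set (ℝ × Velocity) := Icc 0 R ×ˢ univ
    have hS : MeasurableSet S := measurableSet_Icc.prod MeasurableSet.univ
    have hSc : S ⊆ closedPhaseSpace := fun p hp => ⟨hp.1.1, trivial⟩
    have h1 : IntegrableOn (fun p => shift g (φ p.1) p.2 * transportDeriv φ ψ p) S := by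
      refine Integrable.mul_bdd (c := M)
        (integrableOn_shift_slab hgm hg hφm hφ0 measure_Icc_lt_top.ne)
        ((htc.mono hSc).aestronglyMeasurable hS) ?_
      filter_upwards [ae_restrict_mem hS] with p hp using (hM p (hSc hp)).1
    refine h1.of_forall_sdiff_eq_zero hmo fun p hp => ?_
    have hpc := openPhaseSpace_subset hp.1
    have hpR : R < p.1 := by
      by_contra hle
      exact hp.2 ⟨⟨hpc.1, not_lt.1 hle⟩, trivial⟩
    rw [((hM p hpc).2 hpR).2, mul_zero]
  -- The integrand in terms of the incoming velocity η. Fixing η and integrating over x follows a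
  -- single orbit, hence the exchange of integrals below.
  set Q : ℝ → Velocity → ℝ := fun x η =>
    accelJac (φ x) η * (g η * transportDeriv φ ψ (x, accel (φ x) η))
  have hQ : Integrable (Function.uncurry Q)
      ((volume.restrict (Ioi (0 : ℝ))).prod (volume.restrict incoming)) := by
    have hbd : Integrable (fun p : ℝ × Velocity => (Icc 0 R).indicator (fun _ => M) p.1 * ‖g p.2‖)
        ((volume.restrict (Ioi (0 : ℝ))).prod (volume.restrict incoming)) := by
      refine Integrable.mul_prod ?_ hg.norm.integrableOn
      refine Integrable.restrict ?_
      rw [integrable_indicator_iff measurableSet_Icc]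
      exact integrableOn_const measure_Icc_lt_top.ne
    refine hbd.mono ?_ ?_
    · rw [Measure.prod_restrict, ← Measure.volume_eq_prod]
      have hms : MeasurableSet (Ioi (0 : ℝ) ×ˢ incoming) :=
        measurableSet_Ioi.prod isOpen_incoming.measurableSet
      have h1 : Measurable fun p : ℝ × Velocity => accelJac (φ p.1) p.2 := by
        unfold accelJac
        fun_prop
      have h2 : ContinuousOn (fun p : ℝ × Velocity =>
          transportDeriv φ ψ (p.1, accel (φ p.1) p.2)) (Ioi (0 : ℝ) ×ˢ incoming) := by
        refine htc.comp (f := fun p : ℝ × Velocity => (p.1, accel (φ p.1) p.2)) ?_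
          fun p hp => ⟨le_of_lt (show 0 < p.1 from hp.1), trivial⟩
        have h3 : ContinuousOn (fun p : ℝ × Velocity => φ p.1) (Ioi (0 : ℝ) ×ˢ incoming) :=
          hφ.contDiffOn.continuousOn.comp continuousOn_fst
            fun p hp => le_of_lt (show 0 < p.1 from hp.1)
        exact continuousOn_fst.prodMk
          (continuous_accel.comp_continuousOn (h3.prodMk continuousOn_snd))
      exact h1.aestronglyMeasurable.mul
        ((hgm.comp measurable_snd).aestronglyMeasurable.mul (h2.aestronglyMeasurable hms))
    · have hmem : ∀ᵐ p ∂((volume.restrict (Ioi (0 : ℝ))).prod (volume.restrict incoming)),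
          p ∈ Ioi (0 : ℝ) ×ˢ incoming := by
        rw [Measure.prod_restrict]
        exact ae_restrict_mem (measurableSet_Ioi.prod isOpen_incoming.measurableSet)
      filter_upwards [hmem] with p hp
      have hp0 : 0 < p.1 := hp.1
      have hpc : ((p.1, accel (φ p.1) p.2) : ℝ × Velocity) ∈ closedPhaseSpace := ⟨hp0.le, trivial⟩
      have hJ : |accelJac (φ p.1) p.2| ≤ 1 := abs_velocity_ratio_le_one (hφ0 _)
      have h1 := hM _ hpc
      simp only [Function.uncurry, Q, Real.norm_eq_abs, abs_mul, abs_abs]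
      by_cases hpR : p.1 ∈ Icc 0 R
      · rw [indicator_of_mem hpR, abs_of_nonneg hM0]
        calc |accelJac (φ p.1) p.2| * (|g p.2| * |transportDeriv φ ψ (p.1, accel (φ p.1) p.2)|)
            ≤ 1 * (|g p.2| * M) := by gcongr; exact h1.1
          _ = M * |g p.2| := by ring
      · have hlt : R < p.1 := by
          by_contra hle
          exact hpR ⟨hp0.le, not_lt.1 hle⟩
        rw [(h1.2 hlt).2, indicator_of_notMem hpR]
        simp
  rw [IntegrableOn, restrict_openPhaseSpace] at hint
  rw [restrict_openPhaseSpace, integral_prod _ hint]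
  have e1 : ∀ x, ∫ ξ, shift g (φ x) ξ * transportDeriv φ ψ (x, ξ) = ∫ η in incoming, Q x η :=
    fun x => integral_shift_mul g (hφ0 x) _
  simp only [e1]
  rw [integral_integral_swap hQ]
  refine setIntegral_eq_zero_of_forall_eq_zero fun η hη => ?_
  have e2 : ∀ x ∈ Ioi (0 : ℝ), Q x η = g η * η.1 * (-(Real.sqrt (η.1 ^ 2 + 2 * φ x))⁻¹ *
      transportDeriv φ ψ (x, accel (φ x) η)) := by
    intro x _
    simp only [Q, accelJac]
    ring
  rw [setIntegral_congr_fun measurableSet_Ioi e2, integral_const_mul,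
    integral_deriv_along_characteristic hφ hψ hη, mul_zero]

/-! ### Solutions and profiles -/

namespace IsProfile

variable {W w : ℝ → ℝ} {b : ℝ} {φ χ : ℝ → ℝ}

lemma congr (h : IsProfile W b φ) (hχ : ∀ x, 0 ≤ x → χ x = φ x) : IsProfile W b χ := by
  refine ⟨(hχ 0 le_rfl).trans h.initial, fun x hx => hχ x hx ▸ h.pos x hx, fun x hx => ?_, ?_⟩
  · rw [hχ x hx]
    exact (h.hasDeriv x hx).congr (fun y hy => hχ y hy) (hχ x hx)
  · exact h.tendsto.congr' ((eventually_ge_atTop 0).mono fun x hx => (hχ x hx).symm)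

lemma isDecreasingPotential (h : IsProfile W b φ) (hpos : ∀ s ∈ Ioc 0 b, 0 < W s)
    (hw : ∀ s ∈ Ioc 0 b, HasDerivAt W (w s) s) (hwc : ContinuousOn w (Ioc 0 b)) :
    IsDecreasingPotential b φ := by
  refine ⟨(h.contDiffOn_two hpos hw hwc).of_le (by norm_num), fun x hx => ?_, h.initial, h.tendsto⟩
  rw [h.dx_eq hx]
  exact neg_neg_of_pos (Real.sqrt_pos.2 (mul_pos two_pos (hpos _ (h.mem_Ioc hx))))

end IsProfile

namespace IsIncoming

variable {finf : Velocity → ℝ} {ne : ℝ → ℝ} {b : ℝ} {φ : ℝ → ℝ}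

lemma congr {g : Velocity → ℝ} (h : IsIncoming finf) (hg : finf =ᵐ[volume] g) :
    IsIncoming g := by
  refine ⟨h.integrable.congr hg, ?_, (integral_congr_ae hg).symm.trans h.mass, ?_⟩
  · filter_upwards [h.nonneg, hg] with ξ h1 h2 using h2 ▸ h1
  · filter_upwards [h.support, hg] with ξ h1 h2 using h2 ▸ h1

lemma hasDerivAt_sagdeev_Ioc (h : IsIncoming finf) (hne : Continuous ne) :
    ∀ s ∈ Ioc 0 b, HasDerivAt (sagdeev ne finf) (rhoI finf s - ne s) s :=
  fun _ hs => h.hasDerivAt_sagdeev hne hs.1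

lemma continuousOn_charge (h : IsIncoming finf) (hne : Continuous ne) :
    ContinuousOn (fun s => rhoI finf s - ne s) (Ioc 0 b) :=
  (h.continuousOn_rhoI.mono fun _ hs => le_of_lt hs.1).sub hne.continuousOn

lemma continuousOn_sagdeev_Ioc (h : IsIncoming finf) (hne : Continuous ne) :
    ContinuousOn (sagdeev ne finf) (Ioc 0 b) :=
  (h.continuousOn_sagdeev hne).mono fun _ hs => le_of_lt hs.1

theorem exists_isSolution (h : IsIncoming finf) (hne : ContDiff ℝ 2 ne) (hne0 : ne 0 = 1)
    (hb : b ∈ setB ne finf) : ∃ f φ, IsSolution ne 0 b 0 finf f φ := by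
  have hnec := hne.continuous
  obtain ⟨C, -, hC⟩ := h.exists_sagdeev_le hne hne0 b
  obtain ⟨φ₀, hφ₀⟩ := exists_isProfile hb.1 (h.continuousOn_sagdeev_Ioc hnec) hb.2
    (fun s hs => hC s ⟨hs.1.le, hs.2⟩)
  -- Constant extension to x < 0 makes the potential measurable and nonnegative on the whole line.
  set φ : ℝ → ℝ := fun x => φ₀ (max x 0)
  have hprof : IsProfile (sagdeev ne finf) b φ :=
    hφ₀.congr fun x hx => by simp only [φ, max_eq_left hx]
  have hφ := hprof.isDecreasingPotential hb.2 (h.hasDerivAt_sagdeev_Ioc hnec)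
    (h.continuousOn_charge hnec)
  have hφ2 := hprof.contDiffOn_two hb.2 (h.hasDerivAt_sagdeev_Ioc hnec) (h.continuousOn_charge hnec)
  have hφm : Measurable φ :=
    (hφ₀.continuousOn.comp_continuous (by fun_prop) fun x => le_max_right x 0).measurable
  have hφ0 : ∀ x, 0 ≤ φ x := fun x => (hφ₀.pos _ (le_max_right x 0)).le
  -- A measurable, everywhere nonnegative representative of `finf`, so that the transported density
  -- is jointly measurable and nonnegative pointwise.
  set g : Velocity → ℝ := fun ξ => max (h.integrable.1.mk finf ξ) 0
  have hgm : Measurable g := h.integrable.1.stronglyMeasurable_mk.measurable.max measurable_const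
  have hfg : finf =ᵐ[volume] g := by
    filter_upwards [h.integrable.1.ae_eq_mk, h.nonneg] with ξ h1 h2
    simp only [g, ← h1, max_eq_left h2]
  have hg := h.congr hfg
  have htend : ∀ {l : Filter ℝ} {s : ℝ}, 0 ≤ s → Tendsto φ l (𝓝 s) →
      Tendsto (fun x => ∫ ξ, |shift g (φ x) ξ - shift g s ξ|) l (𝓝 0) := fun hs hl =>
    (tendsto_integral_abs_shift_sub hg.integrable hs).comp
      (tendsto_nhdsWithin_iff.2 ⟨hl, Eventually.of_forall hφ0⟩)
  refine ⟨fun x => shift g (φ x), φ, ?_⟩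
  constructor
  · exact (locallyIntegrable_shift hgm hg.integrable hφm hφ0).locallyIntegrableOn _
  · exact fun x _ => integrable_shift hg.integrable (hφ0 x)
  · exact fun x hx => htend (hφ0 x) (hφ.contDiffOn.continuousOn x hx)
  · exact hφ.contDiffOn
  · exact hφ2.mono Ioi_subset_Ici_self
  · refine fun x _ => ae_of_all _ fun ξ => ?_
    by_cases hξ : ξ ∈ accelRegion (φ x)
    · rw [shift_of_mem g hξ]
      exact le_max_right _ _
    · rw [shift_of_notMem g hξ]
  · exact Or.inr hφ.dx_neg
  · intro ψ hψ
    simp only [Pi.zero_apply, zero_mul, integral_zero, add_zero]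
    rw [← weak_vlasov_shift hφ hφm hφ0 hgm hg.integrable hψ]
    refine setIntegral_congr_fun isOpen_openPhaseSpace.measurableSet fun p hp => ?_
    simp only [transportDeriv_eq hψ.contDiffOn hp]
  · refine (htend le_rfl hφ.tendsto).congr fun x => integral_congr_ae ?_
    filter_upwards [hg.shift_zero, hfg] with ξ h1 h2
    rw [h1, h2]
  · intro x hx
    rw [hprof.dxx_eq hb.2 (h.hasDerivAt_sagdeev_Ioc hnec) hx.le, ← h.integral_shift (hφ0 x),
      integral_congr_ae (shift_congr hfg (hφ0 x))]
  · exact hφ.initial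
  · exact hφ.tendsto

end IsIncoming

namespace IsSolution

variable {ne : ℝ → ℝ} {b : ℝ} {finf : Velocity → ℝ} {f : ℝ → Velocity → ℝ} {φ : ℝ → ℝ}

lemma hasDerivAt_dx (h : IsSolution ne 0 b 0 finf f φ) {x : ℝ} (hx : 0 < x) :
    HasDerivAt (dx φ) (dxx φ x) x := by
  have hnhds : Ici (0 : ℝ) ∈ 𝓝 x := Ici_mem_nhds hx
  have h1 : ContDiffOn ℝ 1 (deriv φ) (Ioi 0) := by
    have h2 : ContDiffOn ℝ (1 + 1) φ (Ioi 0) := by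
      convert h.contDiffOn_two using 1
      norm_num
    exact ((contDiffOn_succ_iff_deriv_of_isOpen isOpen_Ioi).1 h2).2.2
  have h3 : DifferentiableAt ℝ (dx φ) x := by
    refine ((h1.differentiableOn (by norm_num)).differentiableAt
      (Ioi_mem_nhds hx)).congr_of_eventuallyEq ?_
    filter_upwards [Ioi_mem_nhds hx] with y hy
    exact derivWithin_of_mem_nhds (Ici_mem_nhds hy)
  have h4 : iteratedDerivWithin 1 φ (Ici 0) = dx φ := iteratedDerivWithin_one
  rw [dxx, iteratedDerivWithin_succ, h4, derivWithin_of_mem_nhds hnhds]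
  exact h3.hasDerivAt

lemma dxx_eq (h : IsSolution ne 0 b 0 finf f φ) (hb : 0 < b) (hinc : IsIncoming finf) {x : ℝ}
    (hx : 0 < x) : dxx φ x = rhoI finf (φ x) - ne (φ x) := by
  have hφ := h.isDecreasingPotential hb
  rw [h.poisson x hx, integral_congr_ae (h.ae_eq_shift hb hinc.integrable hx.le),
    hinc.integral_shift (hφ.pos hx.le).le]

/-- Conservation of energy for the Poisson equation. -/
lemma dx_sq_eq (h : IsSolution ne 0 b 0 finf f φ) (hb : 0 < b) (hinc : IsIncoming finf)
    (hne : Continuous ne) {x : ℝ} (hx : 0 ≤ x) :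
    dx φ x ^ 2 / 2 = sagdeev ne finf (φ x) := by
  have hφ := h.isDecreasingPotential hb
  set E : ℝ → ℝ := fun x => dx φ x ^ 2 / 2 - sagdeev ne finf (φ x)
  have hEd : ∀ y, 0 < y → HasDerivAt E 0 y := fun y hy => by
    have h1 := ((h.hasDerivAt_dx hy).fun_pow 2).div_const 2
    have h2 := (hinc.hasDerivAt_sagdeev hne (hφ.pos hy.le)).comp y (hφ.hasDerivAt hy)
    refine (h1.sub h2).congr_deriv ?_
    rw [h.dxx_eq hb hinc hy]
    simp only [Nat.cast_ofNat, Nat.add_one_sub_one, pow_one]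
    ring
  have hVc : ContinuousOn (fun x => sagdeev ne finf (φ x)) (Ici 0) :=
    (hinc.continuousOn_sagdeev hne).comp hφ.contDiffOn.continuousOn fun y hy => (hφ.pos hy).le
  have hEc : ContinuousOn E (Ici 0) := ((hφ.continuousOn_dx.pow 2).div_const 2).sub hVc
  have hconst : ∀ y, x < y → E y = E x := fun y hy => by
    obtain ⟨z, hz, hz'⟩ := exists_hasDerivAt_eq_slope E (fun _ => 0) hy
      (hEc.mono fun z hz => hx.trans hz.1) fun z hz => hEd z (lt_of_le_of_lt hx hz.1)
    have : 0 < y - x := sub_pos.2 hy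
    rw [eq_div_iff this.ne', zero_mul] at hz'
    linarith
  -- No limit of ∂ₓφ at infinity is assumed. The mean value theorem on [n, n + 1] provides points
  -- going to infinity where ∂ₓφ tends to 0, which suffices because the energy is constant.
  have hmv : ∀ n : ℕ, ∃ c, (n : ℝ) < c ∧ dx φ c = φ (n + 1) - φ n := fun n => by
    have hn : (0 : ℝ) ≤ n := Nat.cast_nonneg n
    obtain ⟨c, hc, hc'⟩ := exists_hasDerivAt_eq_slope φ (dx φ) (show (n : ℝ) < n + 1 by linarith)
      (hφ.contDiffOn.continuousOn.mono fun z hz => hn.trans hz.1)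
      fun z hz => hφ.hasDerivAt (lt_of_le_of_lt hn hz.1)
    refine ⟨c, hc.1, ?_⟩
    rw [hc']
    simp
  choose c hc hc' using hmv
  have hct : Tendsto c atTop atTop :=
    tendsto_atTop_mono (fun n => (hc n).le) tendsto_natCast_atTop_atTop
  have hV0 : Tendsto (fun n => sagdeev ne finf (φ (c n))) atTop (𝓝 0) := by
    have h1 := hinc.continuousOn_sagdeev hne 0 self_mem_Ici
    have h2 : sagdeev ne finf 0 = 0 := by simp [sagdeev]
    rw [ContinuousWithinAt, h2] at h1
    refine h1.comp (tendsto_nhdsWithin_iff.2 ⟨hφ.tendsto.comp hct, Eventually.of_forall fun n => ?_⟩)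
    exact (hφ.pos ((Nat.cast_nonneg n).trans (hc n).le)).le
  have hdx : Tendsto (fun n => dx φ (c n)) atTop (𝓝 0) := by
    have h1 : Tendsto (fun n : ℕ => φ (n + 1)) atTop (𝓝 0) :=
      hφ.tendsto.comp (tendsto_atTop_add_const_right _ _ tendsto_natCast_atTop_atTop)
    have h2 : Tendsto (fun n : ℕ => φ n) atTop (𝓝 0) :=
      hφ.tendsto.comp tendsto_natCast_atTop_atTop
    simpa [hc'] using h1.sub h2
  have hE0 : Tendsto (fun n => E (c n)) atTop (𝓝 0) := by
    simpa using ((hdx.pow 2).div_const 2).sub hV0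
  have hEx : Tendsto (fun n => E (c n)) atTop (𝓝 (E x)) := by
    refine tendsto_const_nhds.congr' ?_
    filter_upwards [hct.eventually (eventually_gt_atTop x)] with n hn
    exact (hconst _ hn).symm
  have : E x = 0 := tendsto_nhds_unique hEx hE0
  simp only [E] at this
  linarith

theorem isProfile (h : IsSolution ne 0 b 0 finf f φ) (hb : 0 < b) (hinc : IsIncoming finf)
    (hne : Continuous ne) : IsProfile (sagdeev ne finf) b φ := by
  have hφ := h.isDecreasingPotential hb
  refine ⟨hφ.initial, fun x hx => hφ.pos hx, fun x hx => ?_, hφ.tendsto⟩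
  have h1 := hφ.hasDerivWithinAt hx
  have h2 : -Real.sqrt (2 * sagdeev ne finf (φ x)) = dx φ x := by
    rw [← h.dx_sq_eq hb hinc hne hx, mul_div_cancel₀ _ two_ne_zero, Real.sqrt_sq_eq_abs,
      abs_of_neg (hφ.dx_neg x hx), neg_neg]
  rwa [h2]

/-- Every s in (0, b] is a value φ(x) by the intermediate value theorem, and there V(s) = (∂ₓφ)²/2 >
0. -/
theorem mem_setB (h : IsSolution ne 0 b 0 finf f φ) (hb : 0 < b) (hinc : IsIncoming finf)
    (hne : Continuous ne) : b ∈ setB ne finf := by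
  have hφ := h.isDecreasingPotential hb
  refine ⟨hb, fun s hs => ?_⟩
  obtain ⟨X, hX, hX0⟩ := ((hφ.tendsto.eventually (gt_mem_nhds hs.1)).and
    (eventually_ge_atTop 0)).exists
  obtain ⟨x, hx, rfl⟩ := intermediate_value_Icc' hX0
    (hφ.contDiffOn.continuousOn.mono Icc_subset_Ici_self)
    (show s ∈ Icc (φ X) (φ 0) from ⟨hX.le, hφ.initial ▸ hs.2⟩)
  rw [← h.dx_sq_eq hb hinc hne hx.1]
  have := hφ.dx_neg x hx.1
  have : 0 < dx φ x ^ 2 := by nlinarith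
  linarith

end IsSolution

/-! ### Classical regularity -/

lemma eq_zero_of_eq_zero_of_pos {E : Type*} [NormedAddCommGroup E] {g : Velocity → E}
    (hg : Continuous g) (h : ∀ ξ : Velocity, 0 < ξ.1 → g ξ = 0) {ξ : Velocity} (hξ : 0 ≤ ξ.1) :
    g ξ = 0 := by
  have h1 : Tendsto (fun t : ℝ => g (ξ.1 + t, ξ.2)) (𝓝[>] 0) (𝓝 (g (ξ.1 + 0, ξ.2))) :=
    (Continuous.tendsto (by fun_prop) 0).mono_left nhdsWithin_le_nhds
  have h2 : Tendsto (fun t : ℝ => g (ξ.1 + t, ξ.2)) (𝓝[>] 0) (𝓝 0) := by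
    refine tendsto_const_nhds.congr' ?_
    filter_upwards [self_mem_nhdsWithin] with t ht
    exact (h _ (add_pos_of_nonneg_of_pos hξ ht)).symm
  simpa using tendsto_nhds_unique h1 h2

lemma eventually_norm_lt_of_eq_zero {X E : Type*} [TopologicalSpace X] [NormedAddCommGroup E]
    {g : X → E} (hg : Continuous g) {p : X} (hp : g p = 0) {ε : ℝ} (hε : 0 < ε) :
    ∀ᶠ q in 𝓝 p, ‖g q‖ < ε := by
  have h1 := hg.norm.tendsto p
  rw [hp, norm_zero] at h1
  exact h1.eventually (gt_mem_nhds hε)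

lemma fderiv_eq_zero_of_eq_zero {E : Type*} [NormedAddCommGroup E] [NormedSpace ℝ E]
    {g : Velocity → E} (h : ∀ ξ : Velocity, 0 < ξ.1 → g ξ = 0) {ξ : Velocity} (hξ : 0 < ξ.1) :
    fderiv ℝ g ξ = 0 := by
  have : g =ᶠ[𝓝 ξ] fun _ => 0 := by
    filter_upwards [continuousAt_fst.eventually (lt_mem_nhds hξ)] with q hq using h q hq
  rw [this.fderiv_eq, fderiv_const_apply]

/-- The density at squared velocity `u`, extended by zero. -/
noncomputable def squareForm (g : Velocity → ℝ) (q : Velocity) : ℝ :=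
  g (-Real.sqrt q.1, q.2) * chi q.1

/-- The derivative of `squareForm`. -/
noncomputable def squareFormDeriv (g : Velocity → ℝ) (q : Velocity) : Velocity →L[ℝ] ℝ :=
  (fderiv ℝ g (-Real.sqrt q.1, q.2)).comp
    ((-(1 / (2 * Real.sqrt q.1)) • ContinuousLinearMap.id ℝ ℝ).prodMap
      (ContinuousLinearMap.id ℝ (ℝ × ℝ)))

section squareForm

variable {g : Velocity → ℝ}

lemma squareForm_of_nonpos {q : Velocity} (hq : q.1 ≤ 0) : squareForm g q = 0 := by
  rw [squareForm, chi_of_nonpos hq, mul_zero]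

lemma squareForm_of_pos {q : Velocity} (hq : 0 < q.1) :
    squareForm g q = g (-Real.sqrt q.1, q.2) := by
  rw [squareForm, chi_of_pos hq, mul_one]

/-- A `C²` function vanishing on a half space vanishes to second order at its boundary. -/
lemma exists_second_order_bound (hg : ContDiff ℝ 2 g) (h : ∀ ξ : Velocity, 0 < ξ.1 → g ξ = 0)
    (ζ₀ : ℝ × ℝ) {ε : ℝ} (hε : 0 < ε) :
    ∃ r > 0, ∀ v ∈ Ioc (-r) 0, ∀ ζ ∈ Metric.ball ζ₀ r,
      ‖fderiv ℝ g (v, ζ)‖ ≤ ε * |v| ∧ |g (v, ζ)| ≤ ε * v ^ 2 := by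
  have hD : ContDiff ℝ 1 (fderiv ℝ g) := hg.fderiv_right (by norm_num)
  have hD0 : ∀ ξ : Velocity, 0 < ξ.1 → fderiv ℝ g ξ = 0 := fun ξ => fderiv_eq_zero_of_eq_zero h
  have hDD : Continuous (fderiv ℝ (fderiv ℝ g)) := hD.continuous_fderiv (by norm_num)
  -- The second derivative vanishes for ξ₁ > 0, hence by continuity on ξ₁ = 0, and is below ε
  -- nearby. The mean value inequality, used twice from the boundary plane, gives the two bounds.
  have hz : fderiv ℝ (fderiv ℝ g) ((0, ζ₀) : Velocity) = 0 :=
    eq_zero_of_eq_zero_of_pos hDD (fun ξ => fderiv_eq_zero_of_eq_zero hD0) le_rfl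
  have hev := eventually_norm_lt_of_eq_zero (E := Velocity →L[ℝ] Velocity →L[ℝ] ℝ) hDD hz hε
  obtain ⟨r, hr, hball⟩ := Metric.eventually_nhds_iff_ball.1 hev
  have hmem : ∀ v ∈ Ioc (-r) 0, ∀ ζ ∈ Metric.ball ζ₀ r,
      ((v, ζ) : Velocity) ∈ Metric.ball ((0, ζ₀) : Velocity) r := by
    intro v hv ζ hζ
    rw [← ball_prod_same]
    refine ⟨?_, hζ⟩
    rw [mem_ball_zero_iff, Real.norm_eq_abs, abs_lt]
    exact ⟨hv.1, lt_of_le_of_lt hv.2 hr⟩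
  have hfirst : ∀ v ∈ Ioc (-r) 0, ∀ ζ ∈ Metric.ball ζ₀ r,
      ‖fderiv ℝ g (v, ζ)‖ ≤ ε * |v| := by
    intro v hv ζ hζ
    have h1 := (convex_ball ((0, ζ₀) : Velocity) r).norm_image_sub_le_of_norm_fderiv_le
      (f := fderiv ℝ g) (𝕜 := ℝ) (fun q _ => hD.differentiable (by norm_num) q)
      (fun q hq => (hball q hq).le)
      (hmem 0 ⟨by linarith, le_rfl⟩ ζ hζ) (hmem v hv ζ hζ)
    rw [eq_zero_of_eq_zero_of_pos hD.continuous hD0 (ξ := (0, ζ)) le_rfl, sub_zero] at h1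
    simpa [Prod.norm_def] using h1
  refine ⟨r, hr, fun v hv ζ hζ => ⟨hfirst v hv ζ hζ, ?_⟩⟩
  have hconv : Convex ℝ (Icc v 0 ×ˢ Metric.ball ζ₀ r) := (convex_Icc v 0).prod (convex_ball ζ₀ r)
  have h1 := hconv.norm_image_sub_le_of_norm_fderiv_le (f := g) (𝕜 := ℝ) (C := ε * |v|)
    (fun q _ => hg.differentiable (by norm_num) q)
    (fun q hq => (hfirst q.1 ⟨lt_of_lt_of_le hv.1 hq.1.1, hq.1.2⟩ q.2 hq.2).trans
      (mul_le_mul_of_nonneg_left (by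
        rw [abs_of_nonpos hv.2, abs_of_nonpos hq.1.2]
        linarith [hq.1.1]) hε.le))
    (show ((0, ζ) : Velocity) ∈ Icc v 0 ×ˢ Metric.ball ζ₀ r from ⟨⟨hv.2, le_rfl⟩, hζ⟩)
    (show ((v, ζ) : Velocity) ∈ Icc v 0 ×ˢ Metric.ball ζ₀ r from ⟨⟨le_rfl, hv.2⟩, hζ⟩)
  rw [eq_zero_of_eq_zero_of_pos hg.continuous h (ξ := (0, ζ)) le_rfl, sub_zero] at h1
  have h2 : ‖((v, ζ) : Velocity) - (0, ζ)‖ = |v| := by simp [Prod.norm_def]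
  rw [h2, mul_assoc, abs_mul_abs_self, ← sq] at h1
  exact h1

lemma hasFDerivAt_squareForm_of_pos (hg : ContDiff ℝ 2 g) {q : Velocity} (hq : 0 < q.1) :
    HasFDerivAt (squareForm g) (squareFormDeriv g q) q := by
  have h1 : HasDerivAt (fun u : ℝ => -Real.sqrt u) (-(1 / (2 * Real.sqrt q.1))) q.1 :=
    (Real.hasDerivAt_sqrt hq.ne').fun_neg
  have h2 := HasFDerivAt.prodMap q h1.hasFDerivAt (hasFDerivAt_id q.2)
  have h3 : HasFDerivAt g (fderiv ℝ g (-Real.sqrt q.1, q.2))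
      (Prod.map (fun u : ℝ => -Real.sqrt u) id q) :=
    (hg.differentiable (by norm_num) _).hasFDerivAt
  have h4 := h3.comp q h2
  have h5 : squareForm g =ᶠ[𝓝 q] g ∘ Prod.map (fun u : ℝ => -Real.sqrt u) id := by
    filter_upwards [continuousAt_fst.eventually (lt_mem_nhds hq)] with p hp
    exact squareForm_of_pos hp
  refine (h4.congr_of_eventuallyEq h5).congr_fderiv ?_
  rw [squareFormDeriv]
  congr 2
  ext
  simp

lemma squareFormDeriv_of_nonpos (hg : ContDiff ℝ 2 g) (h : ∀ ξ : Velocity, 0 < ξ.1 → g ξ = 0)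
    {q : Velocity} (hq : q.1 ≤ 0) : squareFormDeriv g q = 0 := by
  have hD : ContDiff ℝ 1 (fderiv ℝ g) := hg.fderiv_right (by norm_num)
  rw [squareFormDeriv, Real.sqrt_eq_zero_of_nonpos hq,
    eq_zero_of_eq_zero_of_pos hD.continuous (fun ξ => fderiv_eq_zero_of_eq_zero h)
      (ξ := (-0, q.2)) (by simp), ContinuousLinearMap.zero_comp]

/-- With v = −√u, the derivative of v contributes a factor 1/(2√u), while Dg is at most a small
multiple of |v| = √u; the product stays small. -/
lemma eventually_squareForm_bound (hg : ContDiff ℝ 2 g) (h : ∀ ξ : Velocity, 0 < ξ.1 → g ξ = 0)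
    {q₀ : Velocity} (hq₀ : q₀.1 = 0) {ε : ℝ} (hε : 0 < ε) :
    ∀ᶠ q in 𝓝 q₀, |squareForm g q| ≤ ε * |q.1| ∧ ‖squareFormDeriv g q‖ ≤ ε := by
  obtain ⟨r, hr, hb⟩ := exists_second_order_bound hg h q₀.2 (ε := ε / 2) (by linarith)
  have e1 : ∀ᶠ q : Velocity in 𝓝 q₀, Real.sqrt q.1 < min r 1 := by
    have : ContinuousAt (fun q : Velocity => Real.sqrt q.1) q₀ := by fun_prop
    refine this.eventually (gt_mem_nhds ?_)
    simp only [hq₀, Real.sqrt_zero]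
    exact lt_min hr one_pos
  have e2 : ∀ᶠ q : Velocity in 𝓝 q₀, q.2 ∈ Metric.ball q₀.2 r :=
    continuousAt_snd.eventually (Metric.ball_mem_nhds _ hr)
  filter_upwards [e1, e2] with q h1 h2
  rcases le_or_gt q.1 0 with hq | hq
  · rw [squareForm_of_nonpos hq, squareFormDeriv_of_nonpos hg h hq, abs_zero, norm_zero]
    exact ⟨by positivity, hε.le⟩
  · have hS : 0 < Real.sqrt q.1 := Real.sqrt_pos.2 hq
    have hSr : Real.sqrt q.1 < r := h1.trans_le (min_le_left _ _)
    have hS1 : Real.sqrt q.1 < 1 := h1.trans_le (min_le_right _ _)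
    obtain ⟨h3, h4⟩ := hb (-Real.sqrt q.1) ⟨by linarith, by linarith⟩ q.2 h2
    rw [neg_sq, Real.sq_sqrt hq.le] at h4
    rw [abs_neg, abs_of_pos hS] at h3
    constructor
    · rw [squareForm_of_pos hq, abs_of_pos hq]
      refine h4.trans ?_
      nlinarith
    · rw [squareFormDeriv]
      refine ContinuousLinearMap.opNorm_le_bound _ hε.le fun w => ?_
      rw [ContinuousLinearMap.comp_apply]
      refine (ContinuousLinearMap.le_opNorm _ _).trans ?_
      have h5 : ‖((-(1 / (2 * Real.sqrt q.1)) • ContinuousLinearMap.id ℝ ℝ).prodMap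
          (ContinuousLinearMap.id ℝ (ℝ × ℝ))) w‖ ≤ (1 / Real.sqrt q.1) * ‖w‖ := by
        rw [Prod.norm_def]
        refine max_le ?_ ?_
        · change ‖-(1 / (2 * Real.sqrt q.1)) • w.1‖ ≤ _
          rw [norm_smul]
          refine mul_le_mul ?_ (norm_fst_le w) (norm_nonneg _) (by positivity)
          rw [norm_neg, Real.norm_eq_abs, abs_of_pos (by positivity)]
          exact one_div_le_one_div_of_le hS (by linarith)
        · refine (norm_snd_le w).trans (le_mul_of_one_le_left (norm_nonneg _) ?_)
          rw [le_div_iff₀ hS]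
          linarith
      calc _ ≤ (ε / 2 * Real.sqrt q.1) * ((1 / Real.sqrt q.1) * ‖w‖) :=
            mul_le_mul h3 h5 (norm_nonneg _) (by positivity)
        _ = ε / 2 * ‖w‖ := by field_simp
        _ ≤ ε * ‖w‖ := mul_le_mul_of_nonneg_right (by linarith) (norm_nonneg _)

lemma hasFDerivAt_squareForm (hg : ContDiff ℝ 2 g) (h : ∀ ξ : Velocity, 0 < ξ.1 → g ξ = 0)
    (q : Velocity) : HasFDerivAt (squareForm g) (squareFormDeriv g q) q := by
  rcases lt_trichotomy q.1 0 with hq | hq | hq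
  · rw [squareFormDeriv_of_nonpos hg h hq.le]
    refine (hasFDerivAt_const (0 : ℝ) q).congr_of_eventuallyEq ?_
    filter_upwards [continuousAt_fst.eventually (gt_mem_nhds hq)] with p hp
    exact squareForm_of_nonpos hp.le
  · rw [squareFormDeriv_of_nonpos hg h hq.le, hasFDerivAt_iff_isLittleO,
      Asymptotics.isLittleO_iff]
    intro ε hε
    filter_upwards [eventually_squareForm_bound hg h hq hε] with p hp
    rw [squareForm_of_nonpos hq.le, sub_zero, zero_apply, sub_zero]
    refine hp.1.trans (mul_le_mul_of_nonneg_left ?_ hε.le)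
    have := norm_fst_le (p - q)
    rwa [Prod.fst_sub, hq, sub_zero] at this
  · exact hasFDerivAt_squareForm_of_pos hg hq

lemma continuous_squareFormDeriv (hg : ContDiff ℝ 2 g) (h : ∀ ξ : Velocity, 0 < ξ.1 → g ξ = 0) :
    Continuous (squareFormDeriv g) := by
  rw [continuous_iff_continuousAt]
  intro q
  rcases lt_trichotomy q.1 0 with hq | hq | hq
  · refine (continuousAt_const (y := (0 : Velocity →L[ℝ] ℝ))).congr_of_eventuallyEq ?_
    filter_upwards [continuousAt_fst.eventually (gt_mem_nhds hq)] with p hp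
    exact squareFormDeriv_of_nonpos hg h hp.le
  · rw [ContinuousAt, squareFormDeriv_of_nonpos hg h hq.le, Metric.tendsto_nhds]
    intro ε hε
    filter_upwards [eventually_squareForm_bound hg h hq (half_pos hε)] with p hp
    rw [dist_zero_right]
    linarith [hp.2]
  · have hD : Continuous (fderiv ℝ g) := hg.continuous_fderiv (by norm_num)
    have hS : 2 * Real.sqrt q.1 ≠ 0 := by positivity
    have hc : ContinuousAt (fun p : Velocity => -(1 / (2 * Real.sqrt p.1))) q :=
      ContinuousAt.neg (ContinuousAt.div continuousAt_const
        (show ContinuousAt (fun p : Velocity => 2 * Real.sqrt p.1) q by fun_prop) hS)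
    refine ContinuousAt.clm_comp (by fun_prop) ?_
    have hc2 : ContinuousAt (fun p : Velocity =>
        -(1 / (2 * Real.sqrt p.1)) • ContinuousLinearMap.id ℝ ℝ) q := hc.smul continuousAt_const
    exact ContinuousAt.comp
      (g := fun A : (ℝ →L[ℝ] ℝ) × ((ℝ × ℝ) →L[ℝ] (ℝ × ℝ)) => A.1.prodMap A.2)
      (f := fun p : Velocity => (-(1 / (2 * Real.sqrt p.1)) • ContinuousLinearMap.id ℝ ℝ,
        ContinuousLinearMap.id ℝ (ℝ × ℝ)))
      (ContinuousLinearMap.prodMapL ℝ ℝ ℝ (ℝ × ℝ) (ℝ × ℝ)).continuous.continuousAt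
      (hc2.prodMk continuousAt_const)

lemma contDiff_squareForm (hg : ContDiff ℝ 2 g) (h : ∀ ξ : Velocity, 0 < ξ.1 → g ξ = 0) :
    ContDiff ℝ 1 (squareForm g) :=
  contDiff_one_iff_hasFDerivAt.2
    ⟨squareFormDeriv g, continuous_squareFormDeriv hg h, hasFDerivAt_squareForm hg h⟩

end squareForm

lemma explicitForm_eq_squareForm (finf : Velocity → ℝ) (φ : ℝ → ℝ) (x : ℝ) (ξ : Velocity) :
    explicitForm finf φ x ξ = squareForm finf (ξ.1 ^ 2 - 2 * φ x, ξ.2) * chi (-ξ.1) := rfl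

lemma explicitForm_of_neg (finf : Velocity → ℝ) (φ : ℝ → ℝ) (x : ℝ) {ξ : Velocity}
    (hξ : ξ.1 < 0) :
    explicitForm finf φ x ξ = squareForm finf (ξ.1 ^ 2 - 2 * φ x, ξ.2) := by
  rw [explicitForm_eq_squareForm, chi_of_pos (by linarith), mul_one]

lemma explicitForm_of_nonneg (finf : Velocity → ℝ) (φ : ℝ → ℝ) (x : ℝ) {ξ : Velocity}
    (hξ : 0 ≤ ξ.1) : explicitForm finf φ x ξ = 0 := by
  rw [explicitForm_eq_squareForm, chi_of_nonpos (by linarith), mul_zero]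

lemma explicitForm_of_sq_le (finf : Velocity → ℝ) {φ : ℝ → ℝ} {x : ℝ} {ξ : Velocity}
    (hξ : ξ.1 ^ 2 ≤ 2 * φ x) : explicitForm finf φ x ξ = 0 := by
  rw [explicitForm_eq_squareForm, squareForm_of_nonpos (by simpa using hξ), zero_mul]

lemma contDiffOn_explicitForm {finf : Velocity → ℝ} (hg : ContDiff ℝ 2 finf)
    (h : ∀ ξ : Velocity, 0 < ξ.1 → finf ξ = 0) {φ : ℝ → ℝ} (hφ : ContDiffOn ℝ 1 φ (Ici 0))
    (hpos : ∀ x, 0 ≤ x → 0 < φ x) :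
    ContDiffOn ℝ 1 (fun p : ℝ × Velocity => explicitForm finf φ p.1 p.2) closedPhaseSpace := by
  have h1 : ContDiffOn ℝ 1 (fun p : ℝ × Velocity => φ p.1) closedPhaseSpace :=
    hφ.comp contDiff_fst.contDiffOn fun p hp => hp.1
  have h2 : ContDiffOn ℝ 1 (fun p : ℝ × Velocity => p.2.1 ^ 2 - 2 * φ p.1) closedPhaseSpace :=
    (ContDiff.contDiffOn (by fun_prop)).sub (contDiffOn_const.mul h1)
  have h3 : ContDiffOn ℝ 1 (fun p : ℝ × Velocity =>
      squareForm finf (p.2.1 ^ 2 - 2 * φ p.1, p.2.2)) closedPhaseSpace :=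
    (contDiff_squareForm hg h).comp_contDiffOn
      (h2.prodMk (ContDiff.contDiffOn (by fun_prop)))
  have hc : Continuous fun p : ℝ × Velocity => p.2.1 := by fun_prop
  intro p hp
  rcases lt_or_ge p.2.1 0 with hv | hv
  · refine (h3 p hp).congr_of_eventuallyEq ?_ (explicitForm_of_neg finf φ p.1 hv)
    filter_upwards [mem_nhdsWithin_of_mem_nhds (hc.continuousAt.eventually (gt_mem_nhds hv))]
      with q hq
    exact explicitForm_of_neg finf φ q.1 hq
  · refine (contDiffWithinAt_const (c := (0 : ℝ))).congr_of_eventuallyEq ?_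
      (explicitForm_of_nonneg finf φ p.1 hv)
    rcases hv.eq_or_lt with hv0 | hv0
    -- At ξ₁ = 0 one has ξ₁² < 2φ, so the density is zero in a whole neighborhood and the factor
    -- `chi (-ξ.1)` creates no jump.
    · have hlt : p.2.1 ^ 2 - 2 * φ p.1 < 0 := by
        rw [← hv0]
        have := hpos p.1 hp.1
        simpa using this
      filter_upwards [(h2.continuousOn p hp).eventually (gt_mem_nhds hlt)] with q hq
      exact explicitForm_of_sq_le finf (by linarith)
    · filter_upwards [mem_nhdsWithin_of_mem_nhds (hc.continuousAt.eventually (lt_mem_nhds hv0))]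
        with q hq
      exact explicitForm_of_nonneg finf φ q.1 (le_of_lt hq)

lemma vlasov_explicitForm {finf : Velocity → ℝ} (hg : ContDiff ℝ 2 finf)
    (h : ∀ ξ : Velocity, 0 < ξ.1 → finf ξ = 0) {b : ℝ} {φ : ℝ → ℝ}
    (hφ : IsDecreasingPotential b φ) {x : ℝ} (hx : 0 < x) (ξ : Velocity) :
    ξ.1 * deriv (fun y => explicitForm finf φ y ξ) x +
      dx φ x * deriv (fun s => explicitForm finf φ x (s, ξ.2)) ξ.1 = 0 := by
  obtain ⟨v, ζ⟩ := ξ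
  rcases lt_or_ge v 0 with hv | hv
  · set k : ℝ → ℝ := fun u => squareForm finf (u, ζ)
    have hk : ∀ u, HasDerivAt k (deriv k u) u := fun u => by
      have h1 := (contDiff_squareForm hg h).differentiable (by norm_num)
      have : Differentiable ℝ k := by fun_prop
      exact (this u).hasDerivAt
    have e1 : HasDerivAt (fun y => explicitForm finf φ y (v, ζ))
        (deriv k (v ^ 2 - 2 * φ x) * (-(2 * dx φ x))) x := by
      have h1 := HasDerivAt.comp x (hk (v ^ 2 - 2 * φ x))
        (((hφ.hasDerivAt hx).const_mul 2).const_sub (v ^ 2))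
      refine h1.congr_of_eventuallyEq (Eventually.of_forall fun y => ?_)
      exact explicitForm_of_neg finf φ y hv
    have e2 : HasDerivAt (fun s => explicitForm finf φ x (s, ζ))
        (deriv k (v ^ 2 - 2 * φ x) * (2 * v)) v := by
      have h0 : HasDerivAt (fun s : ℝ => s ^ 2 - 2 * φ x) (2 * v) v := by
        refine ((hasDerivAt_pow 2 v).sub_const (2 * φ x)).congr_deriv ?_
        simp
      have h1 := HasDerivAt.comp v (hk (v ^ 2 - 2 * φ x)) h0
      refine h1.congr_of_eventuallyEq ?_
      filter_upwards [gt_mem_nhds hv] with s hs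
      exact explicitForm_of_neg finf φ x (ξ := (s, ζ)) hs
    simp only [e1.deriv, e2.deriv]
    ring
  · have e1 : (fun y => explicitForm finf φ y (v, ζ)) = fun _ => 0 :=
      funext fun y => explicitForm_of_nonneg finf φ y hv
    have e2 : (fun s => explicitForm finf φ x (s, ζ)) =ᶠ[𝓝 v] fun _ => 0 := by
      rcases hv.eq_or_lt with hv0 | hv0
      · have hlt : v ^ 2 < 2 * φ x := by
          rw [← hv0]
          have := hφ.pos hx.le
          simpa using this
        have hc : ContinuousAt (fun s : ℝ => s ^ 2) v := by fun_prop
        filter_upwards [hc.eventually (gt_mem_nhds hlt)] with s hs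
        exact explicitForm_of_sq_le finf (ξ := (s, ζ)) (le_of_lt hs)
      · filter_upwards [lt_mem_nhds hv0] with s hs
        exact explicitForm_of_nonneg finf φ x (ξ := (s, ζ)) (le_of_lt hs)
    simp only [e1, e2.deriv_eq, deriv_const, mul_zero, add_zero]

namespace IsIncoming

variable {finf : Velocity → ℝ} {ne : ℝ → ℝ} {b : ℝ} {φ : ℝ → ℝ}

/-- For a continuous density an a.e. identity on an open set holds everywhere; the regularity
arguments need the pointwise version. -/
lemma eq_zero_of_pos (h : IsIncoming finf) (hc : Continuous finf) {ξ : Velocity} (hξ : 0 < ξ.1) :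
    finf ξ = 0 := by
  have hU : IsOpen {ξ : Velocity | 0 < ξ.1} := isOpen_lt (by fun_prop) (by fun_prop)
  have h1 : finf =ᵐ[volume.restrict {ξ : Velocity | 0 < ξ.1}] fun _ => 0 :=
    (ae_restrict_iff' hU.measurableSet).2 h.support
  exact Measure.eqOn_open_of_ae_eq h1 hU hc.continuousOn continuousOn_const hξ

theorem isClassicalSolution (h : IsIncoming finf) (hne : Continuous ne)
    (hg : ContDiff ℝ 2 finf) (hb : b ∈ setB ne finf)
    (hprof : IsProfile (sagdeev ne finf) b φ) :
    IsClassicalSolution ne 0 b 0 finf (explicitForm finf φ) φ := by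
  have hz : ∀ ξ : Velocity, 0 < ξ.1 → finf ξ = 0 := fun ξ => h.eq_zero_of_pos hg.continuous
  have hφ := hprof.isDecreasingPotential hb.2 (h.hasDerivAt_sagdeev_Ioc hne)
    (h.continuousOn_charge hne)
  constructor
  · exact contDiffOn_explicitForm hg hz hφ.contDiffOn hprof.pos
  · exact hprof.contDiffOn_two hb.2 (h.hasDerivAt_sagdeev_Ioc hne) (h.continuousOn_charge hne)
  · exact fun x hx ξ => vlasov_explicitForm hg hz hφ hx ξ
  · intro x hx
    rw [hprof.dxx_eq hb.2 (h.hasDerivAt_sagdeev_Ioc hne) hx.le,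
      ← h.integral_shift (hprof.pos x hx.le).le]
    rfl
  · intro ξ hξ
    rw [explicitForm_of_nonneg finf φ 0 hξ.le]
    simp
  · exact hφ.initial
  · intro ξ
    rcases lt_or_ge ξ.1 0 with hξ | hξ
    · simp only [explicitForm_of_neg finf φ _ hξ]
      have h1 : finf ξ = squareForm finf (ξ.1 ^ 2 - 2 * 0, ξ.2) := by
        have : 0 < ξ.1 ^ 2 := by nlinarith
        rw [squareForm_of_pos (by simpa using this)]
        simp only [mul_zero, sub_zero, Real.sqrt_sq_eq_abs, abs_of_neg hξ, neg_neg]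
      rw [h1]
      have h2 : Continuous fun s : ℝ => squareForm finf (ξ.1 ^ 2 - 2 * s, ξ.2) := by
        have := (contDiff_squareForm hg hz).continuous
        fun_prop
      exact (h2.tendsto 0).comp hφ.tendsto
    · simp only [explicitForm_of_nonneg finf φ _ hξ,
        eq_zero_of_eq_zero_of_pos hg.continuous hz hξ]
      exact tendsto_const_nhds
  · exact hφ.tendsto

end IsIncoming

/-! ### Existence criterion, uniqueness and exponential decay -/

namespace IsIncoming

variable {finf : Velocity → ℝ} {ne : ℝ → ℝ} {b : ℝ}

theorem exists_isSolution_iff (h : IsIncoming finf) (hne : ContDiff ℝ 2 ne) (hne0 : ne 0 = 1)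
    (hb : 0 < b) : (∃ f φ, IsSolution ne 0 b 0 finf f φ) ↔ (b : EReal) < supB ne finf := by
  rw [← h.mem_setB_iff hne.continuous hb]
  exact ⟨fun ⟨_, _, hs⟩ => hs.mem_setB hb h hne.continuous, h.exists_isSolution hne hne0⟩

theorem atMostOneSolution (h : IsIncoming finf) (hne : Continuous ne) (hb : 0 < b) :
    AtMostOneSolution ne 0 b 0 finf := by
  intro f φ g χ hf hg x hx
  have hB := hf.mem_setB hb h hne
  have hφχ : φ x = χ x := (hf.isProfile hb h hne).unique (hg.isProfile hb h hne)
    (h.continuousOn_sagdeev_Ioc hne) hB.2 hx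
  refine ⟨hφχ, (hf.ae_eq_shift hb h.integrable hx).trans ?_⟩
  rw [hφχ]
  exact (hg.ae_eq_shift hb h.integrable hx).symm

theorem expDecay (h : IsIncoming finf) (hne : ContDiff ℝ 2 ne) (hne0 : ne 0 = 1)
    (hne1 : deriv ne 0 = -1) (hbohm : bohmIntegral finf < 1) (hB : b ∈ setB ne finf) {φ : ℝ → ℝ}
    (hφ : IsProfile (sagdeev ne finf) b φ) : ExpDecay φ := by
  obtain ⟨K, -, hK⟩ := h.exists_sagdeev_le hne hne0 b
  obtain ⟨L, -, hL⟩ := h.exists_abs_charge_le hne hne0 hbohm.ne_top b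
  obtain ⟨c, hc, ε, hε, hlow⟩ := h.exists_le_sagdeev hne hne0 hne1 hbohm
  -- The quadratic lower bound is only local at 0. Away from 0, V has a positive minimum m by
  -- compactness, and m ≥ (m/b²) s² for s ≤ b.
  obtain ⟨m, hm, hmin⟩ : ∃ m > 0, ∀ s ∈ Icc (min ε b) b, m ≤ sagdeev ne finf s := by
    have hε' : 0 < min ε b := lt_min hε hB.1
    have hsub : Icc (min ε b) b ⊆ Ioc 0 b := fun s hs => ⟨hε'.trans_le hs.1, hs.2⟩
    obtain ⟨s₀, hs₀, hmin⟩ := isCompact_Icc.exists_isMinOn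
      (nonempty_Icc.2 (min_le_right ε b))
      ((h.continuousOn_sagdeev_Ioc hne.continuous).mono hsub)
    exact ⟨_, hB.2 s₀ (hsub hs₀), fun s hs => hmin hs⟩
  have hb2 : 0 < b ^ 2 := pow_pos hB.1 2
  refine hφ.expDecay hB.2 (h.hasDerivAt_sagdeev_Ioc hne.continuous)
    (k := min c (m / b ^ 2)) (K := K) (L := L) (lt_min hc (div_pos hm hb2)) (fun s hs => ?_)
    (fun s hs => hK s ⟨hs.1.le, hs.2⟩) (fun s hs => hL s ⟨hs.1.le, hs.2⟩)
  rcases le_or_gt s ε with hsε | hsε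
  · exact (mul_le_mul_of_nonneg_right (min_le_left _ _) (sq_nonneg s)).trans
      (hlow s ⟨hs.1.le, hsε⟩)
  · calc min c (m / b ^ 2) * s ^ 2 ≤ m / b ^ 2 * b ^ 2 := by
          refine mul_le_mul (min_le_right _ _) (pow_le_pow_left₀ hs.1.le hs.2 2) (sq_nonneg s)
            (div_pos hm hb2).le
      _ = m := div_mul_cancel₀ _ hb2.ne'
      _ ≤ _ := hmin s ⟨(min_le_left _ _).trans hsε.le, hs.2⟩

end IsIncoming

end VlasovPoisson

theorem theorem2p1
    (ne : ℝ → ℝ) (hne : ContDiff ℝ 2 ne) (hne0 : ne 0 = 1) (hne1 : deriv ne 0 = -1)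
    (φb : ℝ) (hφb : 0 < φb)
    (finf : Velocity → ℝ) (hint : Integrable finf) (hnonneg : ∀ᵐ ξ, 0 ≤ finf ξ)
    (hmass : ∫ ξ, finf ξ = 1) (hpos : ∀ᵐ ξ : Velocity, 0 < ξ.1 → finf ξ = 0) :
    -- (i)
    (bohmIntegral finf < 1 →
      (setB ne finf).Nonempty ∧
      ((∃ f φ, IsSolution ne 0 φb 0 finf f φ) ↔ (φb : EReal) < supB ne finf) ∧
      AtMostOneSolution ne 0 φb 0 finf ∧
      ∀ f φ, IsSolution ne 0 φb 0 finf f φ →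
        (∀ x, 0 ≤ x → f x =ᵐ[volume] explicitForm finf φ x) ∧
        ExpDecay φ ∧
        (ContDiff ℝ 2 finf →
          IsClassicalSolution ne 0 φb 0 finf (explicitForm finf φ) φ)) ∧
    -- (ii)
    (bohmIntegral finf = 1 → (setB ne finf).Nonempty →
      ((∃ f φ, IsSolution ne 0 φb 0 finf f φ) ↔ (φb : EReal) < supB ne finf) ∧
      AtMostOneSolution ne 0 φb 0 finf ∧
      ∀ f φ, IsSolution ne 0 φb 0 finf f φ →
        (∀ x, 0 ≤ x → f x =ᵐ[volume] explicitForm finf φ x) ∧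
        (ContDiff ℝ 2 finf →
          IsClassicalSolution ne 0 φb 0 finf (explicitForm finf φ) φ)) ∧
    -- (iii)
    (bohmIntegral finf = 1 → setB ne finf = ∅ →
      ¬ ∃ f φ, IsSolution ne 0 φb 0 finf f φ) ∧
    -- (iv)
    (1 < bohmIntegral finf →
      ¬ ∃ f φ, IsSolution ne 0 φb 0 finf f φ) := by
  have h : IsIncoming finf := ⟨hint, hnonneg, hmass, hpos⟩
  have hnec := hne.continuous
  have hform : ∀ f φ, IsSolution ne 0 φb 0 finf f φ →
      (∀ x, 0 ≤ x → f x =ᵐ[volume] explicitForm finf φ x) ∧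
      (ContDiff ℝ 2 finf → IsClassicalSolution ne 0 φb 0 finf (explicitForm finf φ) φ) :=
    -- `explicitForm finf φ x` unfolds to `shift finf (φ x)`.
    fun f φ hs => ⟨fun x hx => hs.ae_eq_shift hφb h.integrable hx, fun hg =>
      h.isClassicalSolution hnec hg (hs.mem_setB hφb h hnec) (hs.isProfile hφb h hnec)⟩
  refine ⟨fun hbohm => ⟨h.setB_nonempty hne hne0 hne1 hbohm, h.exists_isSolution_iff hne hne0 hφb,
    h.atMostOneSolution hnec hφb, fun f φ hs => ⟨(hform f φ hs).1, ?_, (hform f φ hs).2⟩⟩,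
    fun _ _ => ⟨h.exists_isSolution_iff hne hne0 hφb, h.atMostOneSolution hnec hφb, hform⟩,
    fun _ hB => ?_, fun hbohm => ?_⟩
  · exact h.expDecay hne hne0 hne1 hbohm (hs.mem_setB hφb h hnec) (hs.isProfile hφb h hnec)
  · rintro ⟨f, φ, hs⟩
    exact (hB ▸ hs.mem_setB hφb h hnec : φb ∈ (∅ : Set ℝ))
  · rintro ⟨f, φ, hs⟩
    exact (h.setB_eq_empty hne hne0 hne1 hbohm ▸ hs.mem_setB hφb h hnec : φb ∈ (∅ : Set ℝ))
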